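/- Let $n\ge 3$, let $G(2,n)$ be the Grassmannian of $2$-dimensional subspaces of $\mathbb C^n$ with its Plücker coordinates $p_{ij}$ ($1\le i<j\le n$), and let $R=\bigoplus_{k\ge 0}H^0(G(2,n),\mathcal L(k\varpi_2))$ be its homogeneous coordinate ring (the algebra generated by the $2\times 2$ minors $p_{ij}$ of a generic $2\times n$ matrix, with $\deg p_{ij}=1$), where $\mathcal L(\varpi_2)$ is the Plücker line bundle. Let $\lambda:\mathbb G_m\to SL(n,\mathbb C)$ be the one-parameter subgroup $\lambda(t)=\operatorname{diag}(t^{n-2},t^{n-2},t^{-2},\dots,t^{-2})$, and let $$X=\lambda\backslash\backslash G(2,n)^{ss}_\lambda(\mathcal L(\varpi_2))=\operatorname{Proj}R^{\lambda(\mathbb G_m)}$$ be the GIT quotient, with the action of $H=SL(2,\mathbb C)\times SL(n-2,\mathbb C)\subset SL(n,\mathbb C)$ (block diagonal matrices) induced by the standard action on $G(2,n)$. 1. If $n=3$, then $R^{\lambda(\mathbb G_m)}=\mathbb C[p_{12}p_{13}^2,\;p_{12}p_{13}p_{23},\;p_{12}p_{23}^2]$, and the ideal of relations between these three generators is generated by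 $(p_{12}p_{13}p_{23})^2=(p_{12}p_{13}^2)(p_{12}p_{23}^2)$. The line bundle $\mathcal L(3\varpi_2)$ descends to a line bundle $\mathcal M$ on $X$, and $(X,\mathcal M)\cong(\mathbb P^1,\mathcal O(2))$ over $\mathbb C$. 2. If $n=4$, then $R^{\lambda(\mathbb G_m)}=\mathbb C[p_{13},p_{14},p_{23},p_{24}]$, these four elements are algebraically independent, and $p_{12}p_{34}=p_{13}p_{24}-p_{14}p_{23}$. The line bundles $\mathcal L(\varpi_2)$ and $\mathcal L(2\varpi_2)$ descend to line bundles $\mathcal M_1$ and $\mathcal M_2$ on $X$, and there is one isomorphism $X\cong\mathbb P^3$ over $\mathbb C$ under which $\mathcal M_1$ corresponds to $\mathcal O(1)$ and $\mathcal M_2$ to $\mathcal O(2)$. In particular $(X,\mathcal M_1)\cong(\mathbb P^3,\mathcal O(1))$. 3. If $n\ge 5$, then $X$ is a wonderful $H$-variety of rank one with exactly two $H$-orbits. Here a smooth projective variety $X$ with an algebraic action of a connected reductive group $H$ is called wonderful of rank $k$ if it has a dense open orbit whose complement is the union of $k$ smooth irreducible $H$-stable divisors $X_1,\dots,X_k$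 meeting transversally, every intersection $\bigcap_{i\in I}X_i$ with $I\subseteq\{1,\dots,k\}$ is the closure of an $H$-orbit, and every closure of an $H$-orbit is of this form. -/

import Mathlib

open CategoryTheory AlgebraicGeometry TopologicalSpace Opposite

noncomputable section

namespace SerreTwist

variable {A : Type} [CommRing A] [Algebra ℂ A] (𝒜 : ℕ → Submodule ℂ A) [GradedAlgebra 𝒜]

/-- The localization of `A` at a homogeneous prime `x`. -/
abbrev Loc (x : ProjectiveSpectrum 𝒜) : Type :=
  Localization (HomogeneousIdeal.toIdeal (ProjectiveSpectrum.asHomogeneousIdeal x)).primeCompl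

variable {𝒜} in
/-- `f` is given on all of `U` by one fraction `a / b` of homogeneous elements with
`deg a = deg b + k` and `b` outside every prime of `U`. -/
def IsFraction (k : ℕ) {U : Opens (ProjectiveSpectrum.top 𝒜)} (f : ∀ x : U, Loc 𝒜 x.1) : Prop :=
  ∃ (d : ℕ) (a : 𝒜 (d + k)) (b : 𝒜 d) (hb : ∀ x : U, b.1 ∉ x.1.asHomogeneousIdeal),
    ∀ x : U, f x = Localization.mk a.1 ⟨b.1, hb x⟩

variable {𝒜} in
lemma mul_notMem (x : ProjectiveSpectrum 𝒜) {a b : A} (ha : a ∉ x.asHomogeneousIdeal)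
    (hb : b ∉ x.asHomogeneousIdeal) : a * b ∉ x.asHomogeneousIdeal := fun h =>
  (x.isPrime.mem_or_mem h).elim ha hb

/-- Being a fraction of degree `k` is stable under restriction. -/
def isFractionPrelocal (k : ℕ) : TopCat.PrelocalPredicate fun x : ProjectiveSpectrum.top 𝒜 => Loc 𝒜 x where
  pred f := IsFraction k f
  res := by
    rintro V U i f ⟨d, a, b, hb, w⟩
    exact ⟨d, a, b, fun x => hb (i x), fun x => w (i x)⟩

/-- Being locally a fraction of degree `k`. -/
def isLocallyFraction (k : ℕ) : TopCat.LocalPredicate fun x : ProjectiveSpectrum.top 𝒜 => Loc 𝒜 x :=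
  (isFractionPrelocal 𝒜 k).sheafify

/-- The sections of `𝒪(k)` over `U`: families of elements of the localizations `A_x`, `x ∈ U`,
that are locally fractions of degree `k`. -/
def sectionsAddSubgroup (k : ℕ) (U : (Opens (ProjectiveSpectrum.top 𝒜))ᵒᵖ) :
    AddSubgroup (∀ x : U.unop, Loc 𝒜 x.1) where
  carrier := {f | (isLocallyFraction 𝒜 k).pred f}
  zero_mem' := fun x => ⟨U.unop, x.2, 𝟙 _, 0, 0, ⟨1, SetLike.GradedOne.one_mem⟩,
    fun y h => y.1.isPrime.ne_top ((Ideal.eq_top_iff_one _).2 h), fun y => (Localization.mk_zero _).symm⟩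
  add_mem' := by
    intro f g hf hg x
    obtain ⟨V, mV, iV, d, a, b, hb, hw⟩ := hf x
    obtain ⟨W, mW, iW, e, a', b', hb', hw'⟩ := hg x
    refine ⟨V ⊓ W, ⟨mV, mW⟩, Opens.infLELeft _ _ ≫ iV, d + e,
      ⟨b.1 * a'.1 + b'.1 * a.1, add_mem ?_ ?_⟩, ⟨b.1 * b'.1, SetLike.mul_mem_graded b.2 b'.2⟩,
      fun y => mul_notMem y.1 (hb ⟨y.1, y.2.1⟩) (hb' ⟨y.1, y.2.2⟩), ?_⟩
    · rw [add_assoc]; exact SetLike.mul_mem_graded b.2 a'.2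
    · rw [show d + e + k = e + (d + k) by omega]; exact SetLike.mul_mem_graded b'.2 a.2
    · rintro ⟨y, hy⟩
      have h1 := hw ⟨y, hy.1⟩
      have h2 := hw' ⟨y, hy.2⟩
      refine (congrArg₂ (· + ·) h1 h2).trans ?_
      exact Localization.add_mk _ _ _ _
  neg_mem' := by
    intro f hf x
    obtain ⟨V, mV, iV, d, a, b, hb, hw⟩ := hf x
    refine ⟨V, mV, iV, d, -a, b, hb, fun y => ?_⟩
    refine (congrArg (- ·) (hw y)).trans ?_
    exact Localization.neg_mk _ _

/-- The sheaf of sets underlying `𝒪(k)`. -/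
def sheafInType (k : ℕ) : TopCat.Sheaf Type (ProjectiveSpectrum.top 𝒜) :=
  TopCat.subsheafToTypes (isLocallyFraction 𝒜 k)

instance instAddCommGroupSections (k : ℕ) (U : (Opens (ProjectiveSpectrum.top 𝒜))ᵒᵖ) :
    AddCommGroup ((sheafInType 𝒜 k).1.obj U) :=
  inferInstanceAs (AddCommGroup (sectionsAddSubgroup 𝒜 k U))

lemma smul_mem (k : ℕ) {U : (Opens (ProjectiveSpectrum.top 𝒜))ᵒᵖ}
    (r : (ProjectiveSpectrum.Proj.structureSheaf 𝒜).1.obj U) (s : (sheafInType 𝒜 k).1.obj U) :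
    (isLocallyFraction 𝒜 k).pred (fun x : U.unop => ((r.1 x).val : Loc 𝒜 x.1) * (s.1 x : Loc 𝒜 x.1)) := by
  intro x
  obtain ⟨V, mV, iV, d, a, b, hb, hw⟩ := s.2 x
  obtain ⟨W, mW, iW, e, a', b', hb', hw'⟩ := r.2 x
  refine ⟨V ⊓ W, ⟨mV, mW⟩, Opens.infLELeft _ _ ≫ iV, e + d,
      ⟨a'.1 * a.1, ?_⟩, ⟨b'.1 * b.1, SetLike.mul_mem_graded b'.2 b.2⟩,
      fun y => mul_notMem y.1 (hb' ⟨y.1, y.2.2⟩) (hb ⟨y.1, y.2.1⟩), ?_⟩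
  · rw [add_assoc]; exact SetLike.mul_mem_graded a'.2 a.2
  · rintro ⟨y, hy⟩
    have h1 := hw ⟨y, hy.1⟩
    have h2 := congrArg HomogeneousLocalization.val (hw' ⟨y, hy.2⟩)
    refine (congrArg₂ (· * ·) h2 h1).trans ?_
    exact Localization.mk_mul _ _ _ _

/-- Sections of the structure sheaf of `Proj 𝒜` are locally fractions of degree `0`; they act on
fractions of degree `k` by multiplication. -/
instance instModuleSections (k : ℕ) (U : (Opens (ProjectiveSpectrum.top 𝒜))ᵒᵖ) :
    Module ((ProjectiveSpectrum.Proj.structureSheaf 𝒜).1.obj U) ((sheafInType 𝒜 k).1.obj U) where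
  smul r s := ⟨fun x => ((r.1 x).val : Loc 𝒜 x.1) * (s.1 x : Loc 𝒜 x.1), smul_mem 𝒜 k r s⟩
  one_smul s := Subtype.ext <| funext fun x =>
    (congrArg (· * s.1 x) (HomogeneousLocalization.val_one (𝒜 := 𝒜))).trans (one_mul _)
  mul_smul r r' s := Subtype.ext <| funext fun x =>
    (congrArg (· * s.1 x) (HomogeneousLocalization.val_mul (r.1 x) (r'.1 x))).trans (mul_assoc _ _ _)
  smul_zero _ := Subtype.ext <| funext fun _ => mul_zero _
  smul_add _ _ _ := Subtype.ext <| funext fun _ => mul_add _ _ _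
  add_smul r r' s := Subtype.ext <| funext fun x =>
    (congrArg (· * s.1 x) (HomogeneousLocalization.val_add (r.1 x) (r'.1 x))).trans (add_mul _ _ _)
  zero_smul s := Subtype.ext <| funext fun x =>
    (congrArg (· * s.1 x) (HomogeneousLocalization.val_zero (𝒜 := 𝒜))).trans (zero_mul _)

/-- The presheaf of abelian groups underlying `𝒪(k)`. -/
def presheafInAb (k : ℕ) : (Opens (ProjectiveSpectrum.top 𝒜))ᵒᵖ ⥤ Ab where
  obj U := AddCommGrpCat.of ((sheafInType 𝒜 k).1.obj U)
  map i := AddCommGrpCat.ofHom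
    { toFun := (sheafInType 𝒜 k).1.map i
      map_zero' := rfl
      map_add' := fun _ _ => rfl }

/-- The twisting sheaf `𝒪(k)` on `Proj 𝒜`, as a sheaf of modules. -/
def twist (k : ℕ) : (Proj 𝒜).Modules where
  val :=
    letI (U : (Opens (Proj 𝒜))ᵒᵖ) :
      Module ((Proj 𝒜).ringCatSheaf.obj.obj U) ((presheafInAb 𝒜 k).obj U) :=
      instModuleSections 𝒜 k U
    PresheafOfModules.ofPresheaf (R := (Proj 𝒜).ringCatSheaf.obj) (presheafInAb 𝒜 k) fun _ _ _ _ _ => rfl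
  isSheaf := (TopCat.Presheaf.isSheaf_iff_isSheaf_comp (forget AddCommGrpCat) _).2
    (sheafInType 𝒜 k).2

end SerreTwist

open MvPolynomial

namespace PluckerGIT

/-- Index set of the standard basis of `ℂⁿ = ℂˢ ⊕ ℂⁿ⁻ˢ` (used for `s ≤ n`). -/
abbrev Col (s n : ℕ) : Type := Fin s ⊕ Fin (n - s)
/-- Polynomial functions on `r × n` matrices, whose rows span a subspace of `ℂⁿ`. -/
abbrev MatPoly (r s n : ℕ) : Type := MvPolynomial (Fin r × Col s n) ℂ

/-- The Plücker coordinate: the `r × r` minor of the generic `r × n` matrix on the columns `f`. -/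
def plucker {r s n : ℕ} (f : Fin r → Col s n) : MatPoly r s n :=
  ((Matrix.mvPolynomialX (Fin r) (Col s n) ℂ).submatrix id f).det

/-- The homogeneous coordinate ring `⨁ₖ H⁰(G(r,n), 𝓛(k ϖᵣ))` of the Grassmannian in its Plücker
embedding, realized as the algebra generated by the maximal minors. -/
def pluckerRing (r s n : ℕ) : Subalgebra ℂ (MatPoly r s n) :=
  Algebra.adjoin ℂ (Set.range plucker)

/-- Pullback of functions along `v ↦ g v` on row vectors, i.e. along `M ↦ M gᵀ` on matrices. -/
def colSubst {r s n : ℕ} (g : Matrix (Col s n) (Col s n) ℂ) : MatPoly r s n →ₐ[ℂ] MatPoly r s n :=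
  aeval fun p => ∑ k, C (g p.2 k) * X (p.1, k)

/-- The one-parameter subgroup `λ(t) = diag(tⁿ⁻ˢ, …, tⁿ⁻ˢ, t⁻ˢ, …, t⁻ˢ)` with `s` entries `tⁿ⁻ˢ`. -/
def oneParam (s n : ℕ) (t : ℂˣ) : Matrix (Col s n) (Col s n) ℂ :=
  Matrix.diagonal (Sum.elim (fun _ => ((t ^ (n - s) : ℂˣ) : ℂ)) (fun _ => ((t⁻¹ ^ s : ℂˣ) : ℂ)))

/-- The ring of `λ`-invariants in the Plücker coordinate ring. -/
def invariantRing (r s n : ℕ) : Subalgebra ℂ (MatPoly r s n) :=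
  pluckerRing r s n ⊓ ⨅ t : ℂˣ, AlgHom.equalizer (colSubst (oneParam s n t)) (AlgHom.id ℂ _)

lemma mem_invariantRing {r s n : ℕ} {f : MatPoly r s n} :
    f ∈ invariantRing r s n ↔
      f ∈ pluckerRing r s n ∧ ∀ t : ℂˣ, colSubst (oneParam s n t) f = f := by
  simp [invariantRing, Algebra.mem_inf, Algebra.mem_iInf, AlgHom.mem_equalizer]

/-- The grading for which Plücker coordinates have degree `1`: degree `k` consists of the elements
of `B` that are homogeneous of degree `r k` in the matrix entries. -/
def pluckerGrading (r s n : ℕ) (B : Subalgebra ℂ (MatPoly r s n)) (k : ℕ) : Submodule ℂ B :=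
  (homogeneousSubmodule (Fin r × Col s n) ℂ (r * k)).comap B.val.toLinearMap

lemma mem_pluckerGrading {r s n : ℕ} {B : Subalgebra ℂ (MatPoly r s n)} {k : ℕ} {f : B} :
    f ∈ pluckerGrading r s n B k ↔ (f : MatPoly r s n).IsHomogeneous (r * k) := Iff.rfl

lemma plucker_isHomogeneous {r s n : ℕ} (f : Fin r → Col s n) :
    (plucker f : MatPoly r s n).IsHomogeneous r := by
  rw [plucker, Matrix.det_apply]
  refine IsHomogeneous.sum _ _ _ fun σ _ => ?_
  have h : (∏ i, (Matrix.mvPolynomialX (Fin r) (Col s n) ℂ).submatrix id f (σ i) i).IsHomogeneous r := by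
    have := IsHomogeneous.prod Finset.univ
      (fun i => (Matrix.mvPolynomialX (Fin r) (Col s n) ℂ).submatrix id f (σ i) i) (fun _ => 1)
      (fun i _ => isHomogeneous_X ℂ (σ i, f i))
    simpa using this
  rcases Int.units_eq_one_or (Equiv.Perm.sign σ) with h' | h' <;> rw [h']
  · rwa [one_smul]
  · rw [Units.neg_smul, one_smul]; exact h.neg

lemma colSubst_isHomogeneous {r s n : ℕ} (g : Matrix (Col s n) (Col s n) ℂ)
    {f : MatPoly r s n} {d : ℕ} (hf : f.IsHomogeneous d) : (colSubst g f).IsHomogeneous d := by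
  have h := IsHomogeneous.aeval (φ := f) (m := d) (n := 1) hf
    (fun p : Fin r × Col s n => ∑ k, C (g p.2 k) * (X (p.1, k) : MatPoly r s n))
    (fun p => IsHomogeneous.sum _ _ _ fun k _ => isHomogeneous_C_mul_X _ _)
  rw [one_mul] at h
  exact h

lemma homogeneousComponent_colSubst {r s n : ℕ} (g : Matrix (Col s n) (Col s n) ℂ)
    (f : MatPoly r s n) (d : ℕ) :
    homogeneousComponent d (colSubst g f) = colSubst g (homogeneousComponent d f) := by
  conv_lhs => rw [← sum_homogeneousComponent f, map_sum, map_sum]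
  have h : ∀ i, homogeneousComponent d (colSubst g (homogeneousComponent i f)) =
      if i = d then colSubst g (homogeneousComponent d f) else 0 := by
    intro i
    rw [homogeneousComponent_of_mem (colSubst_isHomogeneous g (homogeneousComponent_isHomogeneous i f))]
    by_cases h : i = d
    · subst h; simp
    · simp [h, Ne.symm h]
  simp only [h, Finset.sum_ite_eq', Finset.mem_range]
  split_ifs with hd
  · rfl
  · rw [homogeneousComponent_eq_zero _ _ (by omega), map_zero]

/-- `B` contains the homogeneous components of its elements, and only degrees divisible by `r`
occur. -/
def IsGradedSubalgebra (r s n : ℕ) (B : Subalgebra ℂ (MatPoly r s n)) : Prop :=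
  ∀ f ∈ B, ∀ i, homogeneousComponent i f ∈ B ∧ (¬ r ∣ i → homogeneousComponent i f = 0)

lemma isGradedSubalgebra_pluckerRing (r s n : ℕ) : IsGradedSubalgebra r s n (pluckerRing r s n) := by
  intro f hf i
  rw [pluckerRing, ← Subalgebra.mem_toSubmodule, Algebra.adjoin_eq_span] at hf
  induction hf using Submodule.span_induction with
  | mem x hx =>
    have hB : x ∈ pluckerRing r s n := by
      rw [pluckerRing, ← Subalgebra.mem_toSubmodule, Algebra.adjoin_eq_span]
      exact Submodule.subset_span hx
    have : ∃ k, x.IsHomogeneous (r * k) := by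
      clear hB
      induction hx using Submonoid.closure_induction with
      | mem x hx => obtain ⟨f, rfl⟩ := hx; exact ⟨1, by simpa using plucker_isHomogeneous f⟩
      | one => exact ⟨0, by simpa using isHomogeneous_one _ _⟩
      | mul x y _ _ hx hy =>
        obtain ⟨k, hk⟩ := hx
        obtain ⟨l, hl⟩ := hy
        exact ⟨k + l, by rw [mul_add]; exact hk.mul hl⟩
    obtain ⟨k, hk⟩ := this
    rw [homogeneousComponent_of_mem hk]
    split_ifs with h
    · exact ⟨hB, fun h' => absurd ⟨k, h⟩ h'⟩
    · exact ⟨zero_mem _, fun _ => rfl⟩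
  | zero => simp
  | add x y _ _ hx hy =>
    rw [map_add]
    exact ⟨add_mem hx.1 hy.1, fun h => by rw [hx.2 h, hy.2 h, add_zero]⟩
  | smul a x _ hx =>
    rw [map_smul]
    exact ⟨Subalgebra.smul_mem _ hx.1 a, fun h => by rw [hx.2 h, smul_zero]⟩

lemma isGradedSubalgebra_invariantRing (r s n : ℕ) :
    IsGradedSubalgebra r s n (invariantRing r s n) := by
  intro f hf i
  rw [mem_invariantRing] at hf
  have h := isGradedSubalgebra_pluckerRing r s n f hf.1 i
  refine ⟨mem_invariantRing.2 ⟨h.1, fun t => ?_⟩, h.2⟩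
  rw [← homogeneousComponent_colSubst, hf.2 t]

lemma pluckerGrading_gradedMonoid (r s n : ℕ) (B : Subalgebra ℂ (MatPoly r s n)) :
    SetLike.GradedMonoid (pluckerGrading r s n B) where
  one_mem := by
    rw [mem_pluckerGrading]; simpa using isHomogeneous_one _ _
  mul_mem i j a b ha hb := by
    rw [mem_pluckerGrading] at *
    rw [mul_add]; exact ha.mul hb

lemma pluckerGrading_isInternal {r s n : ℕ} [NeZero r] {B : Subalgebra ℂ (MatPoly r s n)}
    (hB : IsGradedSubalgebra r s n B) : DirectSum.IsInternal (pluckerGrading r s n B) := by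
  refine DirectSum.isInternal_submodule_of_iSupIndep_of_iSup_eq_top ?_ ?_
  · refine iSupIndep_of_dfinsupp_lsum_injective _ ?_
    have key : ∀ (v : Π₀ k, pluckerGrading r s n B k) (j : ℕ),
        homogeneousComponent (r * j)
          ((DFinsupp.lsum ℕ (fun k => (pluckerGrading r s n B k).subtype) v : B) : MatPoly r s n) =
        ((v j : B) : MatPoly r s n) := by
      intro v j
      induction v using DFinsupp.induction with
      | h0 => simp
      | ha k x v _ _ hv =>
        simp only [map_add, Subalgebra.coe_add, hv, DFinsupp.add_apply, Submodule.coe_add]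
        congr 1
        rw [DFinsupp.lsum_single, Submodule.subtype_apply,
          homogeneousComponent_of_mem (mem_pluckerGrading.1 x.2)]
        by_cases h : j = k
        · subst h; simp
        · rw [if_neg (fun h' => h (Nat.eq_of_mul_eq_mul_left (NeZero.pos r) h')),
            DFinsupp.single_eq_of_ne (by simpa using h)]
          rfl
    intro v w h
    ext j : 2
    apply Subtype.ext
    rw [← key v j, ← key w j, h]
  · rw [eq_top_iff]
    rintro ⟨f, hf⟩ -
    have : (⟨f, hf⟩ : B) = ∑ i ∈ Finset.range (f.totalDegree + 1),
        ⟨homogeneousComponent i f, (hB f hf i).1⟩ := by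
      apply Subtype.ext
      rw [AddSubmonoidClass.coe_finsetSum]
      exact (sum_homogeneousComponent f).symm
    rw [this]
    refine Submodule.sum_mem _ fun i _ => ?_
    by_cases h : r ∣ i
    · obtain ⟨k, rfl⟩ := h
      exact Submodule.mem_iSup_of_mem k (homogeneousComponent_isHomogeneous _ _)
    · have h0 := (hB f hf i).2 h
      simp only [h0]
      exact zero_mem _


/-- Such a subalgebra is graded by `pluckerGrading`. -/
abbrev gradedAlgebraOf {r s n : ℕ} [NeZero r] {B : Subalgebra ℂ (MatPoly r s n)}
    (hB : IsGradedSubalgebra r s n B) : GradedAlgebra (pluckerGrading r s n B) :=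
  { pluckerGrading_gradedMonoid r s n B with
    toDecomposition := (pluckerGrading_isInternal hB).chooseDecomposition }

instance instGradedPluckerRing (r s n : ℕ) [NeZero r] :
    GradedAlgebra (pluckerGrading r s n (pluckerRing r s n)) :=
  gradedAlgebraOf (isGradedSubalgebra_pluckerRing r s n)

instance instGradedInvariantRing (r s n : ℕ) [NeZero r] :
    GradedAlgebra (pluckerGrading r s n (invariantRing r s n)) :=
  gradedAlgebraOf (isGradedSubalgebra_invariantRing r s n)

lemma colSubst_X {r s n : ℕ} (g : Matrix (Col s n) (Col s n) ℂ) (i : Fin r) (j : Col s n) :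
    colSubst g (X (i, j) : MatPoly r s n) = ∑ k, C (g j k) * X (i, k) := aeval_X _ _

lemma colSubst_mul {r s n : ℕ} (g h : Matrix (Col s n) (Col s n) ℂ) (f : MatPoly r s n) :
    colSubst (g * h) f = colSubst h (colSubst g f) := by
  have key : (colSubst (g * h) : MatPoly r s n →ₐ[ℂ] MatPoly r s n) =
      (colSubst h).comp (colSubst g) := by
    refine algHom_ext fun p => ?_
    obtain ⟨i, j⟩ := p
    rw [AlgHom.comp_apply, colSubst_X, colSubst_X, map_sum]
    simp only [map_mul, algHom_C, colSubst_X, Matrix.mul_apply, map_sum, Finset.sum_mul,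
      Finset.mul_sum, algebraMap_eq]
    rw [Finset.sum_comm]
    simp only [mul_assoc]
  exact DFunLike.congr_fun key f

lemma colSubst_one {r s n : ℕ} (f : MatPoly r s n) : colSubst 1 f = f := by
  have : colSubst 1 = AlgHom.id ℂ (MatPoly r s n) := by
    refine algHom_ext fun p => ?_
    obtain ⟨i, j⟩ := p
    rw [colSubst_X]
    simp [Matrix.one_apply]
  rw [this]; rfl

lemma colSubst_plucker {r s n : ℕ} (g : Matrix (Col s n) (Col s n) ℂ) (f : Fin r → Col s n) :
    colSubst g (plucker f) =
      ∑ κ : Fin r → Col s n, (∏ i, g (f i) (κ i)) • (plucker κ : MatPoly r s n) := by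
  rw [plucker, AlgHom.map_det, ← Matrix.det_transpose]
  have h : (((colSubst g).mapMatrix
      ((Matrix.mvPolynomialX (Fin r) (Col s n) ℂ).submatrix id f)) : Matrix _ _ (MatPoly r s n)).transpose =
      fun i => ∑ k : Col s n, g (f i) k •
        (fun i' => (X (i', k) : MatPoly r s n)) := by
    funext i i'
    simp only [Matrix.transpose_apply, AlgHom.mapMatrix_apply, Matrix.map_apply,
      Matrix.submatrix_apply, id, Matrix.mvPolynomialX_apply, colSubst_X, Finset.sum_apply,
      Pi.smul_apply, smul_eq_C_mul]
  rw [h]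
  have h2 := MultilinearMap.map_sum
    ((Matrix.detRowAlternating (n := Fin r) (R := MatPoly r s n)).toMultilinearMap.restrictScalars ℂ)
    (fun (i : Fin r) (k : Col s n) => g (f i) k • (fun i' : Fin r => (X (i', k) : MatPoly r s n)))
  refine h2.trans (Finset.sum_congr rfl fun κ _ => ?_)
  rw [MultilinearMap.map_smul_univ]
  congr 1
  rw [plucker, ← Matrix.det_transpose]
  rfl

lemma colSubst_mem_pluckerRing {r s n : ℕ} (g : Matrix (Col s n) (Col s n) ℂ)
    {f : MatPoly r s n} (hf : f ∈ pluckerRing r s n) : colSubst g f ∈ pluckerRing r s n := by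
  have : pluckerRing r s n ≤ (pluckerRing r s n).comap (colSubst g) := by
    refine Algebra.adjoin_le ?_
    rintro _ ⟨f, rfl⟩
    change colSubst g (plucker f) ∈ pluckerRing r s n
    rw [colSubst_plucker]
    exact Subalgebra.sum_mem _ fun κ _ =>
      Subalgebra.smul_mem _ (Algebra.subset_adjoin (Set.mem_range_self κ)) _
  exact this hf

/-- The group `H = SL(s) × SL(n - s)`, the semisimple part of the centralizer of `λ`. -/
abbrev LeviSS (s n : ℕ) : Type :=
  Matrix.SpecialLinearGroup (Fin s) ℂ × Matrix.SpecialLinearGroup (Fin (n - s)) ℂ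

/-- The block diagonal matrix of an element of `H`. -/
def leviMatrix {s n : ℕ} (h : LeviSS s n) : Matrix (Col s n) (Col s n) ℂ :=
  Matrix.fromBlocks h.1.1 0 0 h.2.1

lemma leviMatrix_mul {s n : ℕ} (g h : LeviSS s n) :
    leviMatrix (g * h) = leviMatrix g * leviMatrix h := by
  simp [leviMatrix, Matrix.fromBlocks_multiply]

lemma leviMatrix_one {s n : ℕ} : leviMatrix (1 : LeviSS s n) = 1 := by
  simp [leviMatrix]

lemma leviMatrix_commute {s n : ℕ} (h : LeviSS s n) (t : ℂˣ) :
    leviMatrix h * oneParam s n t = oneParam s n t * leviMatrix h := by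
  ext (i | i) (j | j) <;>
    simp [leviMatrix, oneParam, Matrix.mul_diagonal, Matrix.diagonal_mul, mul_comm]

lemma colSubst_mem_invariantRing {r s n : ℕ} (h : LeviSS s n)
    {f : MatPoly r s n} (hf : f ∈ invariantRing r s n) :
    colSubst (leviMatrix h) f ∈ invariantRing r s n := by
  rw [mem_invariantRing] at hf ⊢
  refine ⟨colSubst_mem_pluckerRing _ hf.1, fun t => ?_⟩
  rw [← colSubst_mul, leviMatrix_commute, colSubst_mul, hf.2 t]

/-- The pullback of `λ`-invariant functions along `h ∈ H`. -/
def leviGradedHom {r s n : ℕ} (h : LeviSS s n) :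
    pluckerGrading r s n (invariantRing r s n) →+*ᵍ pluckerGrading r s n (invariantRing r s n) where
  toFun f := ⟨colSubst (leviMatrix h) f.1, colSubst_mem_invariantRing h f.2⟩
  map_one' := Subtype.ext (map_one _)
  map_zero' := Subtype.ext (map_zero _)
  map_add' f g := Subtype.ext (map_add _ f.1 g.1)
  map_mul' f g := Subtype.ext (map_mul _ f.1 g.1)
  map_mem hf := colSubst_isHomogeneous _ hf

lemma leviGradedHom_comp {r s n : ℕ} (g h : LeviSS s n) :
    leviGradedHom (r := r) (g * h) = (leviGradedHom h).comp (leviGradedHom g) := by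
  refine DFunLike.ext _ _ fun f => Subtype.ext ?_
  change colSubst (leviMatrix (g * h)) f.1 = colSubst (leviMatrix h) (colSubst (leviMatrix g) f.1)
  rw [leviMatrix_mul, colSubst_mul]

lemma leviGradedHom_one {r s n : ℕ} :
    leviGradedHom (r := r) (1 : LeviSS s n) = .id _ := by
  refine DFunLike.ext _ _ fun f => Subtype.ext ?_
  change colSubst (leviMatrix 1) f.1 = f.1
  rw [leviMatrix_one, colSubst_one]

lemma projMap_eq_id {A : Type} [CommRing A] [Algebra ℂ A] {𝒜 : ℕ → Submodule ℂ A}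
    [GradedAlgebra 𝒜] {f : 𝒜 →+*ᵍ 𝒜}
    (hf : HomogeneousIdeal.irrelevant 𝒜 ≤ (HomogeneousIdeal.irrelevant 𝒜).map f)
    (h : f = .id 𝒜) : Proj.map f hf = 𝟙 _ := by
  subst h; exact Proj.map_id

lemma projMap_eq_comp {A : Type} [CommRing A] [Algebra ℂ A] {𝒜 : ℕ → Submodule ℂ A}
    [GradedAlgebra 𝒜] {f g k : 𝒜 →+*ᵍ 𝒜}
    (hf : HomogeneousIdeal.irrelevant 𝒜 ≤ (HomogeneousIdeal.irrelevant 𝒜).map f)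
    (hg : HomogeneousIdeal.irrelevant 𝒜 ≤ (HomogeneousIdeal.irrelevant 𝒜).map g)
    (hk : HomogeneousIdeal.irrelevant 𝒜 ≤ (HomogeneousIdeal.irrelevant 𝒜).map k)
    (h : k = g.comp f) : Proj.map k hk = Proj.map g hg ≫ Proj.map f hf := by
  subst h; exact Proj.map_comp f g hf hg

section
variable (r s n : ℕ) [NeZero r]

/-- The ring of invariants with its Plücker grading. -/
abbrev invGrading : ℕ → Submodule ℂ (invariantRing r s n) :=
  pluckerGrading r s n (invariantRing r s n)

open HomogeneousIdeal in
lemma irrelevant_le_map_leviGradedHom (h : LeviSS s n) :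
    HomogeneousIdeal.irrelevant (invGrading r s n) ≤
      (HomogeneousIdeal.irrelevant (invGrading r s n)).map (leviGradedHom h) := by
  have h1 : (HomogeneousIdeal.irrelevant (invGrading r s n)).map (leviGradedHom h⁻¹) ≤
      HomogeneousIdeal.irrelevant (invGrading r s n) := by
    rw [map_le_iff_le_comap]
    rw [irrelevant_le]
    intro i hi f hf
    exact mem_irrelevant_of_mem _ hi ((leviGradedHom (r := r) h⁻¹).map_mem hf)
  have h2 := map_mono (leviGradedHom h) h1
  rwa [← map_comp, ← leviGradedHom_comp, inv_mul_cancel, leviGradedHom_one, HomogeneousIdeal.map_id] at h2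

/-- The GIT quotient `X = λ \\ G(r,n)^{ss}(𝓛(ϖᵣ)) = Proj ⨁ₖ H⁰(G(r,n), 𝓛(k ϖᵣ))^λ`. -/
abbrev GITQuotient : Scheme.{0} := Proj (invGrading r s n)

/-- The automorphism of `X` induced by `V ↦ h V` on the Grassmannian. -/
def leviMap (h : LeviSS s n) : GITQuotient r s n ⟶ GITQuotient r s n :=
  Proj.map (leviGradedHom h) (irrelevant_le_map_leviGradedHom r s n h)

lemma leviMap_one : leviMap r s n 1 = 𝟙 _ := projMap_eq_id _ leviGradedHom_one

lemma leviMap_mul (g h : LeviSS s n) : leviMap r s n (g * h) = leviMap r s n h ≫ leviMap r s n g :=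
  projMap_eq_comp _ _ _ (leviGradedHom_comp g h)

/-- The action of `H` on `X`. -/
def leviAct : LeviSS s n →* End (GITQuotient r s n) where
  toFun := leviMap r s n
  map_one' := leviMap_one r s n
  map_mul' := leviMap_mul r s n
end

section Varieties

/-- The base `Spec ℂ`. -/
abbrev SpecC : Scheme.{0} := Spec (CommRingCat.of ℂ)

/-- The structure morphism of `Proj` of a graded `ℂ`-algebra. -/
def projToSpec {A : Type} [CommRing A] [Algebra ℂ A] (𝒜 : ℕ → Submodule ℂ A) [GradedAlgebra 𝒜] :
    Proj 𝒜 ⟶ SpecC :=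
  Proj.toSpecZero 𝒜 ≫ Spec.map (CommRingCat.ofHom (algebraMap ℂ (𝒜 0)))

/-- The standard grading of `ℂ[x₀, …, x_N]`. -/
abbrev PGrading (N : ℕ) : ℕ → Submodule ℂ (MvPolynomial (Fin (N + 1)) ℂ) :=
  MvPolynomial.homogeneousSubmodule (Fin (N + 1)) ℂ

instance instGradedPGrading (N : ℕ) : GradedAlgebra (PGrading N) := MvPolynomial.gradedAlgebra

/-- Projective space `ℙᴺ` over `ℂ`. -/
abbrev PSpace (N : ℕ) : Scheme.{0} := Proj (PGrading N)

/-- A `ℂ`-scheme is projective if it is a closed subscheme of some `ℙᴺ`. -/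
def IsProjective {X : Scheme.{0}} (p : X ⟶ SpecC) : Prop :=
  ∃ (N : ℕ) (i : X ⟶ PSpace N), IsClosedImmersion i ∧ i ≫ projToSpec (PGrading N) = p

/-! In what follows a linear algebraic group is given by its group `G` of complex points and its
algebra `𝒪` of regular functions `G → ℂ`. -/

/-- Evaluation of regular functions at `g`. -/
def evalAt {G : Type} (𝒪 : Subalgebra ℂ (G → ℂ)) (g : G) : 𝒪 →ₐ[ℂ] ℂ :=
  (Pi.evalAlgHom ℂ (fun _ : G => ℂ) g).comp 𝒪.val

/-- The structure morphism of the affine variety with coordinate ring `𝒪`. -/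
def groupToSpec {G : Type} (𝒪 : Subalgebra ℂ (G → ℂ)) : Spec (CommRingCat.of 𝒪) ⟶ SpecC :=
  Spec.map (CommRingCat.ofHom (algebraMap ℂ 𝒪))

/-- The complex point of `Spec 𝒪` given by `g`. -/
def groupPoint {G : Type} (𝒪 : Subalgebra ℂ (G → ℂ)) (g : G) : SpecC ⟶ Spec (CommRingCat.of 𝒪) :=
  Spec.map (CommRingCat.ofHom (evalAt 𝒪 g).toRingHom)

lemma groupPoint_toSpec {G : Type} (𝒪 : Subalgebra ℂ (G → ℂ)) (g : G) :
    groupPoint 𝒪 g ≫ groupToSpec 𝒪 = 𝟙 SpecC := by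
  rw [groupPoint, groupToSpec, ← Spec.map_comp, ← CommRingCat.ofHom_comp]
  have : (evalAt 𝒪 g).toRingHom.comp (algebraMap ℂ 𝒪) = RingHom.id ℂ := by
    ext z; rfl
  rw [this, CommRingCat.ofHom_id, Spec.map_id]

/-- The morphism `x ↦ (g, x)` from `X` to `G × X`. -/
def slice {G : Type} (𝒪 : Subalgebra ℂ (G → ℂ)) {X : Scheme.{0}} (p : X ⟶ SpecC) (g : G) :
    X ⟶ Limits.pullback (groupToSpec 𝒪) p :=
  Limits.pullback.lift (p ≫ groupPoint 𝒪 g) (𝟙 X)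
    (by rw [Category.assoc, groupPoint_toSpec, Category.comp_id, Category.id_comp])

variable {G : Type} [Group G]

/-- The action of `G` on `X` is algebraic: it comes from a morphism `G × X ⟶ X` over `ℂ`. -/
def IsAlgebraicAction (𝒪 : Subalgebra ℂ (G → ℂ)) {X : Scheme.{0}} (p : X ⟶ SpecC)
    (act : G →* End X) : Prop :=
  ∃ σ : Limits.pullback (groupToSpec 𝒪) p ⟶ X,
    σ ≫ p = Limits.pullback.snd _ _ ≫ p ∧ ∀ g : G, slice 𝒪 p g ≫ σ = act g

/-- The point `g x`. -/
def movePoint {X : Scheme.{0}} (act : G →* End X) (g : G) (x : X) : X :=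
  (End.asHom (act g)) x

/-- The orbit of a point. For a closed point `x` this is a set of closed points, that is, of complex
points of the variety `X`. -/
def orbit {X : Scheme.{0}} (act : G →* End X) (x : X) : Set X :=
  Set.range fun g => movePoint act g x

/-- The set of all `G`-orbits of complex points of `X`. -/
def orbits {X : Scheme.{0}} (act : G →* End X) : Set (Set X) :=
  {O | ∃ x : X, IsClosed {x} ∧ O = orbit act x}

open Classical in
/-- The closed subsets `D i` through `x` are, near `x`, the zero loci of functions `f i` that
generate their (reduced) ideals and whose classes in the cotangent space `𝔪 / 𝔪²` at `x` are
linearly independent. On a smooth variety this says that the `D i` through `x` are divisors that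
are smooth at `x` and meet transversally there. -/
def IsNormalCrossingAt {X : Scheme.{0}} {k : ℕ} (D : Fin k → Closeds X) (x : X) : Prop :=
  ∃ (U : X.affineOpens) (hx : x ∈ U.1) (f : {i : Fin k // x ∈ D i} → Γ(X, U.1)),
    (∀ i, (Scheme.IdealSheafData.vanishingIdeal (D i.1)).ideal U = Ideal.span {f i}) ∧
    ∀ a : {i : Fin k // x ∈ D i} → X.presheaf.stalk x,
      ∑ i, a i * X.presheaf.germ U.1 x hx (f i) ∈
          IsLocalRing.maximalIdeal (X.presheaf.stalk x) ^ 2 →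
        ∀ i, a i ∈ IsLocalRing.maximalIdeal (X.presheaf.stalk x)

/-- `X` with the given action is a wonderful `G`-variety with boundary divisors `D 0, …, D (k-1)`;
its rank is the number `k` of boundary divisors. Here `G` is meant to be connected reductive. -/
structure IsWonderful (𝒪 : Subalgebra ℂ (G → ℂ)) {X : Scheme.{0}} (p : X ⟶ SpecC)
    (act : G →* End X) {k : ℕ} (D : Fin k → Closeds X) : Prop where
  integral : IsIntegral X
  smooth : Smooth p
  projective : IsProjective p
  algebraic : IsAlgebraicAction 𝒪 p act
  /-- There is a dense orbit, and it is the (open) complement of the boundary divisors. -/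
  open_orbit : ∃ x : X, IsClosed {x} ∧ Dense (orbit act x) ∧
    orbit act x = {y | IsClosed {y} ∧ ∀ i, y ∉ D i}
  irreducible : ∀ i, IsIrreducible (D i : Set X)
  stable : ∀ i g, ∀ x ∈ D i, movePoint act g x ∈ D i
  normal_crossing : ∀ x : X, IsClosed {x} → IsNormalCrossingAt D x
  /-- Every intersection of boundary divisors is an orbit closure. -/
  inter_eq : ∀ I : Finset (Fin k), ∃ x : X, IsClosed {x} ∧
    (⋂ i ∈ I, (D i : Set X)) = closure (orbit act x)
  /-- Every orbit closure is an intersection of boundary divisors. -/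
  closure_eq : ∀ x : X, IsClosed {x} → ∃ I : Finset (Fin k),
    closure (orbit act x) = ⋂ i ∈ I, (D i : Set X)

end Varieties

/-- The regular functions on `H = SL(s) × SL(n - s)`: polynomials in the matrix entries. -/
def leviCoord (s n : ℕ) : Subalgebra ℂ (LeviSS s n → ℂ) :=
  Algebra.adjoin ℂ
    (Set.range (fun (ij : Fin s × Fin s) (h : LeviSS s n) => h.1.1 ij.1 ij.2) ∪
      Set.range (fun (ij : Fin (n - s) × Fin (n - s)) (h : LeviSS s n) => h.2.1 ij.1 ij.2))

section Quotient

variable (r s n : ℕ) [NeZero r]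

/-- The structure morphism of the GIT quotient `X`. -/
def quotientToSpec : GITQuotient r s n ⟶ SpecC := projToSpec (invGrading r s n)

/-- The Grassmannian `G(r,n)` in its Plücker embedding. -/
abbrev Grassmannian : Scheme.{0} := Proj (pluckerGrading r s n (pluckerRing r s n))

/-- The inclusion of the ring of invariants in the Plücker coordinate ring. -/
def invIncl : invariantRing r s n →ₐ[ℂ] pluckerRing r s n :=
  Subalgebra.inclusion inf_le_left

/-- The open subset of the Grassmannian where `f` (homogeneous, `λ`-invariant) does not vanish. -/
def nonvanishing (f : invariantRing r s n) : (Grassmannian r s n).Opens :=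
  Proj.basicOpen _ (invIncl r s n f)

/-- The semistable locus: some `λ`-invariant section of some `𝓛(d ϖᵣ)`, `d > 0`, does not
vanish. -/
def semistable : Set (Grassmannian r s n) :=
  {y | ∃ d > 0, ∃ f ∈ invGrading r s n d, y ∈ nonvanishing r s n f}

/-- `𝓛(k ϖᵣ)` descends to the GIT quotient: near the fibre of the quotient map through any
semistable point, `𝓛(k ϖᵣ)` has a nowhere vanishing `λ`-invariant section. Such a section is locally
on the quotient a ratio `a / b` of invariant sections of `𝓛((d + k) ϖᵣ)` and `𝓛(d ϖᵣ)`. The descended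
line bundle on the quotient, whose sections are the `λ`-invariant sections of `𝓛(k ϖᵣ)`, is then
`descent r s n k`. -/
def Descends (k : ℕ) : Prop :=
  ∀ y ∈ semistable r s n, ∃ d, ∃ a ∈ invGrading r s n (d + k), ∃ b ∈ invGrading r s n d,
    y ∈ nonvanishing r s n a ∧ y ∈ nonvanishing r s n b

/-- The sheaf of `λ`-invariant sections of `𝓛(k ϖᵣ)` on the GIT quotient. On the affine open set
`f ≠ 0`, `f` an invariant section of some `𝓛(d ϖᵣ)`, these are the fractions `a / f ^ j` with `a` an
invariant section of `𝓛((j d + k) ϖᵣ)`, so that this is the sheaf `𝒪(k)` on `Proj`. -/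
def descent (k : ℕ) : (GITQuotient r s n).Modules := SerreTwist.twist (invGrading r s n) k

end Quotient

/-- The line bundle `𝒪(m)` on `ℙᴺ`. -/
def lineBundle (N m : ℕ) : (PSpace N).Modules := SerreTwist.twist (PGrading N) m

/-- The `j`-th standard basis index of `ℂⁿ`, for `0 ≤ j < n`. -/
def col (s n : ℕ) (j : Fin n) : Col s n :=
  if h : (j : ℕ) < s then .inl ⟨j, h⟩ else .inr ⟨j - s, by omega⟩

/-- The Plücker coordinates of `G(2,n)`; indices start at `0`, so that `coord 0 1` is `p₁₂`. -/
def coord {n : ℕ} (i j : Fin n) : MatPoly 2 2 n := plucker ![col 2 n i, col 2 n j]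

end PluckerGIT

end

/-! The invariants are found by counting weights. A monomial of degree `2k` in the matrix entries,
`w` of which lie in the first two columns, is multiplied by `t^(nw - 4k)` under `λ(t)`. So a product
of `a` copies of `p₁₂`, `b` mixed coordinates `p_{il}` and `c` coordinates `p_{jk}` of the last `n -
2` columns is invariant exactly when `n(2a + b) = 4(a + b + c)`, and such products span the
invariants (`mem_of_mem_invariantRing`). The Plücker relation puts `p₁₂ p_{jk}` into the square of
the span of the mixed coordinates and so removes `p₁₂` whenever `c ≥ a`.

For `n = 4` the weights force `c = a`, so the four mixed coordinates generate. They are independent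
because some matrix has them as free variables. For `n = 3` there is no `p_{jk}`, hence `b = 2a`,
and setting `p₁₂ = 1` identifies the invariants with the even part of `ℂ[x₀, x₁]`. Both isomorphisms
of `Proj`, with their line bundles, come from one construction: an algebra homomorphism that
multiplies degrees by `d` induces a morphism of `Proj` under which `𝒪(k)` corresponds to `𝒪(dk)` as
soon as the homomorphism is injective and onto the degrees divisible by `d` (`isIso_map`,
`isIso_twistHom`).

For `n ≥ 5`, the invariants of degree `nm` are spanned by products of `4m` mixed coordinates and `(n
- 4)m` coordinates `p_{jk}`. This gives finitely many generators in degree `n`, hence projectivity,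
and shows that such invariants only change by a scalar under `GL(2)` on the rows and independent
rescaling of the two column blocks (`evalMat_scale`). Where `p_{ik} p_{jk} ≠ 0` a matrix can
therefore be normalized: columns `j`, `k` form the unit matrix and the entry `(0, i)` is `1`. The
remaining entries are free coordinates, so these loci are affine spaces (`quotientChart`). They
cover `X` by a three-term Plücker relation (`exists_chart`), and smoothness follows.

Closed points are thus matrices up to normalization, and row reduction together with `SL(2) ×
SL(n-2)` leaves one orbit with `p₁₂ ≠ 0` and one with `p₁₂ = 0`. In a chart `p₁₂` is affine linear,
with coefficient `±1`, in one free entry. It therefore generates a prime ideal and has nonzero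
differential, so that `p₁₂ = 0` is a smooth irreducible divisor. The action is algebraic because
`Proj (𝒪 ⊗ A)` is the product of the group with `Proj A` (`ProjBaseChange.isPullback`), so a
coaction on `A` yields the action morphism. -/

noncomputable section

/-! ### Morphisms of `Proj` from homomorphisms that multiply degrees -/

namespace ProjScaled

open HomogeneousLocalization

variable {A B : Type} [CommRing A] [Algebra ℂ A] [CommRing B] [Algebra ℂ B]

/-- An algebra homomorphism that multiplies degrees by `d > 0` and through which no relevant
homogeneous prime pulls back to an irrelevant one. -/
structure ScaledHom (𝒜 : ℕ → Submodule ℂ A) (ℬ : ℕ → Submodule ℂ B) [GradedAlgebra 𝒜]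
    [GradedAlgebra ℬ] (d : ℕ) where
  hom : A →ₐ[ℂ] B
  pos : 0 < d
  map_mem : ∀ {i : ℕ} {a : A}, a ∈ 𝒜 i → hom a ∈ ℬ (d * i)
  relevant : ∀ p : ProjectiveSpectrum ℬ,
    ¬ (HomogeneousIdeal.irrelevant 𝒜).toIdeal ≤ p.asHomogeneousIdeal.toIdeal.comap hom

variable {𝒜 : ℕ → Submodule ℂ A} {ℬ : ℕ → Submodule ℂ B} [GradedAlgebra 𝒜] [GradedAlgebra ℬ]
  {d : ℕ} (φ : ScaledHom 𝒜 ℬ d)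

namespace ScaledHom

/-- Since `d > 0`, distinct degrees of `𝒜` land in distinct degrees of `ℬ`, so no two components can
mix. This is what makes preimages of homogeneous ideals homogeneous. -/
lemma decompose_hom (a : A) (i : ℕ) :
    (DirectSum.decompose ℬ (φ.hom a) (d * i) : B) = φ.hom (DirectSum.decompose 𝒜 a i) := by
  classical
  conv_lhs => rw [← DirectSum.sum_support_decompose 𝒜 a, map_sum, DirectSum.decompose_sum]
  rw [DFinsupp.finsetSum_apply, AddSubmonoidClass.coe_finsetSum]
  have h (j : ℕ) : (DirectSum.decompose ℬ (φ.hom (DirectSum.decompose 𝒜 a j : A)) (d * i) : B) =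
      if j = i then φ.hom (DirectSum.decompose 𝒜 a i) else 0 := by
    split_ifs with hj
    · subst hj
      exact DirectSum.decompose_of_mem_same ℬ (φ.map_mem (SetLike.coe_mem _))
    · exact DirectSum.decompose_of_mem_ne ℬ (φ.map_mem (SetLike.coe_mem _))
        (fun h => hj (Nat.eq_of_mul_eq_mul_left φ.pos h))
  rw [Finset.sum_congr rfl fun j _ => h j, Finset.sum_ite_eq']
  split_ifs with hi
  · rfl
  · rw [DFinsupp.notMem_support_iff.1 hi, ZeroMemClass.coe_zero, map_zero]

lemma isHomogeneous_comap {I : Ideal B} (hI : I.IsHomogeneous ℬ) :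
    (I.comap φ.hom).IsHomogeneous 𝒜 := by
  intro i a ha
  rw [Ideal.mem_comap, ← decompose_hom]
  exact hI _ ha

/-- The map on points induced by a scaled homomorphism. -/
def comapFun (p : ProjectiveSpectrum ℬ) : ProjectiveSpectrum 𝒜 where
  asHomogeneousIdeal := ⟨p.asHomogeneousIdeal.toIdeal.comap φ.hom,
    φ.isHomogeneous_comap p.asHomogeneousIdeal.isHomogeneous⟩
  isPrime := p.isPrime.comap φ.hom
  not_irrelevant_le h := φ.relevant p h

lemma mem_comapFun {p : ProjectiveSpectrum ℬ} {a : A} :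
    a ∈ (φ.comapFun p).asHomogeneousIdeal ↔ φ.hom a ∈ p.asHomogeneousIdeal := Iff.rfl

/-- The continuous map on points induced by a scaled homomorphism. -/
def comap : C(ProjectiveSpectrum ℬ, ProjectiveSpectrum 𝒜) where
  toFun := φ.comapFun
  continuous_toFun := by
    simp_rw [continuous_iff_isClosed, ProjectiveSpectrum.isClosed_iff_zeroLocus, exists_imp,
      forall_eq_apply_imp_iff]
    exact fun s => ⟨φ.hom '' s, by
      ext p; exact (Set.image_subset_iff (f := φ.hom) (t := p.asHomogeneousIdeal)).symm⟩

/-- The map on localizations induced by a scaled homomorphism. -/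
def locExt {P : Submonoid A} {Q : Submonoid B} (h : ∀ a ∈ P, φ.hom a ∈ Q) :
    Localization P →+* Localization Q :=
  IsLocalization.map (Localization Q) φ.hom.toRingHom (fun a ha => h a ha : P ≤ Q.comap φ.hom.toRingHom)

lemma locExt_mk {P : Submonoid A} {Q : Submonoid B} (h : ∀ a ∈ P, φ.hom a ∈ Q) (a : A) (s : P) :
    φ.locExt h (Localization.mk a s) = Localization.mk (φ.hom a) ⟨φ.hom s, h s s.2⟩ := by
  rw [Localization.mk_eq_mk', Localization.mk_eq_mk']
  exact IsLocalization.map_mk' _ _ _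

/-- The map on fractions of equal degree induced by a scaled homomorphism. -/
def numDenMap {P : Submonoid A} {Q : Submonoid B} (h : ∀ a ∈ P, φ.hom a ∈ Q)
    (x : NumDenSameDeg 𝒜 P) : NumDenSameDeg ℬ Q :=
  ⟨d * x.1, ⟨_, φ.map_mem x.2.2⟩, ⟨_, φ.map_mem x.3.2⟩, h _ x.4⟩

lemma val_mk_numDenMap {P : Submonoid A} {Q : Submonoid B} (h : ∀ a ∈ P, φ.hom a ∈ Q)
    (x : NumDenSameDeg 𝒜 P) :
    (HomogeneousLocalization.mk (φ.numDenMap h x)).val =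
      φ.locExt h (HomogeneousLocalization.mk x).val :=
  (φ.locExt_mk h x.2.1 ⟨x.3.1, x.4⟩).symm

/-- The map on homogeneous localizations induced by a scaled homomorphism, on sets. -/
def locFun {P : Submonoid A} {Q : Submonoid B} (h : ∀ a ∈ P, φ.hom a ∈ Q) :
    HomogeneousLocalization 𝒜 P → HomogeneousLocalization ℬ Q :=
  Quotient.map' (φ.numDenMap h) fun x y (e : x.embedding = y.embedding) =>
    (φ.val_mk_numDenMap h x).trans ((congrArg (φ.locExt h) e).trans (φ.val_mk_numDenMap h y).symm)

lemma val_locFun {P : Submonoid A} {Q : Submonoid B} (h : ∀ a ∈ P, φ.hom a ∈ Q)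
    (x : HomogeneousLocalization 𝒜 P) : (φ.locFun h x).val = φ.locExt h x.val := by
  obtain ⟨c, rfl⟩ := x.mk_surjective
  exact φ.val_mk_numDenMap h c

/-- The map on homogeneous localizations induced by a scaled homomorphism. -/
def locMap {P : Submonoid A} {Q : Submonoid B} (h : ∀ a ∈ P, φ.hom a ∈ Q) :
    HomogeneousLocalization 𝒜 P →+* HomogeneousLocalization ℬ Q where
  toFun := φ.locFun h
  map_add' x y := HomogeneousLocalization.val_injective _ (by
    simp only [HomogeneousLocalization.val_add, val_locFun, map_add])
  map_mul' x y := HomogeneousLocalization.val_injective _ (by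
    simp only [HomogeneousLocalization.val_mul, val_locFun, map_mul])
  map_zero' := HomogeneousLocalization.val_injective _ (by
    simp only [HomogeneousLocalization.val_zero, val_locFun, map_zero])
  map_one' := HomogeneousLocalization.val_injective _ (by
    simp only [HomogeneousLocalization.val_one, val_locFun, map_one])

lemma val_locMap {P : Submonoid A} {Q : Submonoid B} (h : ∀ a ∈ P, φ.hom a ∈ Q)
    (x : HomogeneousLocalization 𝒜 P) : (φ.locMap h x).val = φ.locExt h x.val := φ.val_locFun h x

/-- The map on local rings induced by a scaled homomorphism. -/
def stalkFun (p : ProjectiveSpectrum ℬ) :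
    AtPrime 𝒜 (φ.comapFun p).asHomogeneousIdeal.toIdeal →+*
      AtPrime ℬ p.asHomogeneousIdeal.toIdeal :=
  φ.locMap (fun _ h => h)

/-- A fraction is a unit at a prime exactly when its numerator avoids that prime, and the prime on
the `𝒜` side is by definition the preimage of the one on the `ℬ` side. -/
lemma isLocalHom_stalkFun (p : ProjectiveSpectrum ℬ) : IsLocalHom (φ.stalkFun p) where
  map_nonunit x hx := by
    obtain ⟨c, rfl⟩ := x.mk_surjective
    rw [← HomogeneousLocalization.isUnit_iff_isUnit_val] at hx ⊢
    have hx' : IsUnit (HomogeneousLocalization.mk (φ.numDenMap (fun _ h => h) c) :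
      AtPrime ℬ p.asHomogeneousIdeal.toIdeal).val := hx
    rw [val_mk, Localization.mk_eq_mk'] at hx' ⊢
    rw [IsLocalization.AtPrime.isUnit_mk'_iff _ p.asHomogeneousIdeal.toIdeal] at hx'
    rw [IsLocalization.AtPrime.isUnit_mk'_iff _ (φ.comapFun p).asHomogeneousIdeal.toIdeal]
    exact hx'

/-- The map on sections of the structure sheaves induced by a scaled homomorphism. -/
def sectionsFun {U : Opens (ProjectiveSpectrum 𝒜)} {V : Opens (ProjectiveSpectrum ℬ)}
    (hUV : ∀ p ∈ V, φ.comap p ∈ U)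
    (s : ∀ x : U, AtPrime 𝒜 x.1.1.1) (y : V) : AtPrime ℬ y.1.1.1 :=
  φ.stalkFun y.1 (s ⟨φ.comap y.1, hUV _ y.2⟩)

lemma isLocallyFraction_sectionsFun {U : Opens (ProjectiveSpectrum 𝒜)}
    {V : Opens (ProjectiveSpectrum ℬ)} (hUV : ∀ p ∈ V, φ.comap p ∈ U)
    (s : ∀ x : U, AtPrime 𝒜 x.1.1.1)
    (hs : (ProjectiveSpectrum.StructureSheaf.isLocallyFraction 𝒜).pred s) :
    (ProjectiveSpectrum.StructureSheaf.isLocallyFraction ℬ).pred (φ.sectionsFun hUV s) := by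
  rintro ⟨p, hpV⟩
  rcases hs ⟨φ.comap p, hUV _ hpV⟩ with ⟨W, m, iWU, i, a, b, hb, h_frac⟩
  refine ⟨W.comap φ.comap ⊓ V, ⟨m, hpV⟩, Opens.infLERight _ _, d * i,
    ⟨_, φ.map_mem a.2⟩, ⟨_, φ.map_mem b.2⟩, fun q => hb ⟨_, q.2.1⟩, fun q => ?_⟩
  exact congrArg (φ.stalkFun q.1) (h_frac ⟨_, q.2.1⟩)

/-- The ring homomorphism on sections of the structure sheaves induced by a scaled homomorphism. -/
def sectionsHom (U : Opens (ProjectiveSpectrum 𝒜)) (V : Opens (ProjectiveSpectrum ℬ))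
    (hUV : ∀ p ∈ V, φ.comap p ∈ U) :
    (ProjectiveSpectrum.Proj.structureSheaf 𝒜).1.obj (.op U) →+*
      (ProjectiveSpectrum.Proj.structureSheaf ℬ).1.obj (.op V) where
  toFun s := ⟨φ.sectionsFun hUV s.1, φ.isLocallyFraction_sectionsFun hUV _ s.2⟩
  map_one' := Subtype.ext <| funext fun _ => map_one (φ.stalkFun _)
  map_zero' := Subtype.ext <| funext fun _ => map_zero (φ.stalkFun _)
  map_add' _ _ := Subtype.ext <| funext fun _ => map_add (φ.stalkFun _) _ _
  map_mul' _ _ := Subtype.ext <| funext fun _ => map_mul (φ.stalkFun _) _ _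

/-- `sectionsHom` as a morphism of commutative rings. -/
def sectionsMap (U : Opens (ProjectiveSpectrum 𝒜)) :
    (ProjectiveSpectrum.Proj.structureSheaf 𝒜).1.obj (.op U) ⟶
      (ProjectiveSpectrum.Proj.structureSheaf ℬ).1.obj (.op (U.comap φ.comap)) :=
  CommRingCat.ofHom (φ.sectionsHom U (U.comap φ.comap) (fun _ h => h))

/-- The morphism of sheafed spaces induced by a scaled homomorphism. -/
def sheafedSpaceMap : Proj.toSheafedSpace ℬ ⟶ Proj.toSheafedSpace 𝒜 where
  hom :=
    { base := TopCat.ofHom φ.comap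
      c := { app U := φ.sectionsMap U.unop
             naturality := fun _ _ _ => rfl } }

/-- Identifies the abstract stalk map with the explicit `stalkFun`. It is checked on germs, and
locality of the stalk map then follows from that of `stalkFun`. -/
lemma stalkMap_comp_stalkToFiber (p : ProjectiveSpectrum ℬ) :
    φ.sheafedSpaceMap.hom.stalkMap p ≫ stalkToFiberRingHom ℬ p =
      stalkToFiberRingHom 𝒜 (φ.comap p) ≫ CommRingCat.ofHom (φ.stalkFun p) := by
  refine TopCat.Presheaf.stalk_hom_ext _ fun U hxU => ?_
  refine (PresheafedSpace.stalkMap_germ_assoc φ.sheafedSpaceMap.hom U p hxU _).trans ?_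
  have h1 := germ_comp_stalkToFiberRingHom ℬ
    ((Opens.map φ.sheafedSpaceMap.hom.base).obj U) p hxU
  have h2 := germ_comp_stalkToFiberRingHom 𝒜 U (φ.comap p) hxU
  refine (congrArg (φ.sheafedSpaceMap.hom.c.app (op U) ≫ ·) h1).trans ?_
  refine Eq.trans ?_ (congrArg (· ≫ CommRingCat.ofHom (φ.stalkFun p)) h2).symm
  rfl

lemma isLocalHom_stalkMap (p : ProjectiveSpectrum ℬ) :
    IsLocalHom (φ.sheafedSpaceMap.hom.stalkMap p).hom where
  map_nonunit z hz := by
    have h := φ.stalkMap_comp_stalkToFiber p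
    have h1 : IsUnit ((φ.sheafedSpaceMap.hom.stalkMap p ≫ stalkToFiberRingHom ℬ p).hom z) :=
      hz.map (stalkToFiberRingHom ℬ p).hom
    rw [h] at h1
    have h2 : IsUnit (φ.stalkFun p ((stalkToFiberRingHom 𝒜 (φ.comap p)).hom z)) := h1
    have h3 := (φ.isLocalHom_stalkFun p).map_nonunit _ h2
    have h4 := h3.map (Proj.stalkIso' 𝒜 (φ.comap p)).symm
    have h5 : (Proj.stalkIso' 𝒜 (φ.comap p)).symm
        ((stalkToFiberRingHom 𝒜 (φ.comap p)).hom z) = z :=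
      (Proj.stalkIso' 𝒜 (φ.comap p)).symm_apply_apply z
    exact (congrArg IsUnit h5).mp h4

/-- The morphism of projective spectra induced by a scaled homomorphism. -/
def map : Proj ℬ ⟶ Proj 𝒜 where
  __ := φ.sheafedSpaceMap.hom
  prop p := φ.isLocalHom_stalkMap p

lemma mem_powers_hom (s : A) : ∀ a ∈ Submonoid.powers s, φ.hom a ∈ Submonoid.powers (φ.hom s) := by
  rintro _ ⟨n, rfl⟩
  exact ⟨n, (map_pow _ _ _).symm⟩

lemma awayToSection_comp_app (s : A) :
    Proj.awayToSection 𝒜 s ≫ φ.map.app (Proj.basicOpen 𝒜 s) =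
      CommRingCat.ofHom (φ.locMap (φ.mem_powers_hom s)) ≫ Proj.awayToSection ℬ (φ.hom s) := by
  ext x
  obtain ⟨c, rfl⟩ := HomogeneousLocalization.mk_surjective x
  exact Subtype.ext <| funext fun p => HomogeneousLocalization.val_injective _ rfl

lemma locExt_injective (hφ : Function.Injective φ.hom) {P : Submonoid A} {Q : Submonoid B}
    (h : ∀ a ∈ P, φ.hom a ∈ Q) (h' : ∀ b ∈ Q, ∃ a ∈ P, φ.hom a = b) :
    Function.Injective (φ.locExt h) := by
  rw [injective_iff_map_eq_zero]
  intro x hx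
  induction x using Localization.induction_on with | H y => ?_
  obtain ⟨a, s⟩ := y
  rw [locExt_mk, Localization.mk_eq_mk', IsLocalization.mk'_eq_zero_iff] at hx
  rw [Localization.mk_eq_mk', IsLocalization.mk'_eq_zero_iff]
  obtain ⟨⟨t, ht⟩, hm⟩ := hx
  obtain ⟨u, hu, rfl⟩ := h' t ht
  exact ⟨⟨u, hu⟩, hφ (by rw [map_mul, map_zero]; exact hm)⟩

lemma locMap_away_injective (hφ : Function.Injective φ.hom) (s : A) :
    Function.Injective (φ.locMap (φ.mem_powers_hom s)) := by
  intro x y hxy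
  apply HomogeneousLocalization.val_injective
  have := congrArg HomogeneousLocalization.val hxy
  rw [val_locMap, val_locMap] at this
  refine φ.locExt_injective hφ _ ?_ this
  rintro _ ⟨n, rfl⟩
  exact ⟨s ^ n, ⟨n, rfl⟩, map_pow _ _ _⟩

/-- A fraction with denominator `φ(s)^n` has numerator of degree `d * n * i`, so surjectivity onto
the degrees divisible by `d` is enough. -/
lemma locMap_away_surjective (hφ : ∀ m, ∀ b ∈ ℬ (d * m), ∃ a ∈ 𝒜 m, φ.hom a = b) {i : ℕ} {s : A}
    (hs : s ∈ 𝒜 i) : Function.Surjective (φ.locMap (φ.mem_powers_hom s)) := by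
  intro y
  obtain ⟨n, b, hb, rfl⟩ := HomogeneousLocalization.Away.mk_surjective _ (φ.map_mem hs) y
  have hb' : b ∈ ℬ (d * (n • i)) := by
    rwa [smul_eq_mul, show d * (n * i) = n * (d * i) by ring]
  obtain ⟨a, ha, rfl⟩ := hφ _ b hb'
  refine ⟨HomogeneousLocalization.Away.mk 𝒜 hs n a ha, HomogeneousLocalization.val_injective _ ?_⟩
  rw [val_locMap, HomogeneousLocalization.Away.val_mk, HomogeneousLocalization.Away.val_mk,
    locExt_mk]
  congr 1
  exact Subtype.ext (map_pow _ _ _)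

end ScaledHom

section Affine

variable {X Y : Scheme.{0}} (f : X ⟶ Y) {ι : Type} (U : ι → Y.affineOpens)

lemma isClosedImmersion_of_app_surjective (hU : ⨆ i, (U i : Y.Opens) = ⊤)
    (haff : ∀ i, IsAffineOpen (f ⁻¹ᵁ (U i).1)) (hs : ∀ i, Function.Surjective (f.app (U i).1)) :
    IsClosedImmersion f := by
  refine @HasAffineProperty.of_iSup_eq_top _ _ IsClosedImmersion.hasAffineProperty _ _ f _ U hU
    fun i => ⟨haff i, ?_⟩
  -- The open set `(U i).ι ''ᵁ ⊤` agrees with `U i` only propositionally; quantifying over `V` lets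
  -- the hypothesis be transported.
  have key (V : Y.Opens) (hV : V = (U i).1) : Function.Surjective (f.app V) := hV ▸ hs i
  have h2 := morphismRestrict_appTop f (U i).1
  have h3 : Function.Surjective (f.app ((U i).1.ι ''ᵁ ⊤) ≫ X.presheaf.map
      (eqToHom (image_morphismRestrict_preimage f (U i).1 ⊤)).op).hom := by
    rw [CommRingCat.hom_comp]
    exact (ConcreteCategory.bijective_of_isIso (X.presheaf.map
      (eqToHom (image_morphismRestrict_preimage f (U i).1 ⊤)).op)).2.comp
        (key _ (Scheme.Opens.ι_image_top _))
  rw [h2]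
  exact h3

lemma isIso_of_app_isIso (hU : ⨆ i, (U i : Y.Opens) = ⊤)
    (haff : ∀ i, IsAffineOpen (f ⁻¹ᵁ (U i).1)) (hs : ∀ i, IsIso (f.app (U i).1)) :
    IsIso f := by
  refine @HasAffineProperty.of_iSup_eq_top _ _ instHasAffinePropertyIsomorphismsSchemeAndIsAffineIsIsoCommRingCatAppTop
    _ _ f _ U hU fun i => ⟨haff i, ?_⟩
  have key (V : Y.Opens) (hV : V = (U i).1) : IsIso (f.app V) := hV ▸ hs i
  have := key _ (Scheme.Opens.ι_image_top (U i).1)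
  have h3 : IsIso (f.app ((U i).1.ι ''ᵁ ⊤) ≫ X.presheaf.map
    (eqToHom (image_morphismRestrict_preimage f (U i).1 ⊤)).op) := inferInstance
  rw [morphismRestrict_appTop f (U i).1]
  exact h3

end Affine

section

variable (𝒜)

/-- The affine open subsets of `Proj` given by homogeneous elements of positive degree. -/
def basicAffine (s : Σ i : {i : ℕ // 0 < i}, 𝒜 i.1) : (Proj 𝒜).affineOpens :=
  ⟨Proj.basicOpen 𝒜 s.2.1, Proj.isAffineOpen_basicOpen 𝒜 s.2.1 s.2.2 s.1.2⟩

lemma iSup_basicAffine : ⨆ s, (basicAffine 𝒜 s).1 = ⊤ := by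
  classical
  refine Proj.iSup_basicOpen_eq_top 𝒜 (fun s : Σ i : {i : ℕ // 0 < i}, 𝒜 i.1 => s.2.1) fun z hz => ?_
  rw [← DirectSum.sum_support_decompose 𝒜 z]
  refine Ideal.sum_mem _ fun c hc => ?_
  by_cases hc0 : c = 0
  · subst hc0
    rw [show (DirectSum.decompose 𝒜 z 0 : A) = 0 from hz]
    exact zero_mem _
  · exact Ideal.subset_span ⟨⟨⟨c, Nat.pos_iff_ne_zero.mpr hc0⟩, _⟩, rfl⟩

end

namespace ScaledHom

/-- The map on sections over basic open sets. -/
def appBasic (s : A) : Γ(Proj 𝒜, Proj.basicOpen 𝒜 s) ⟶ Γ(Proj ℬ, Proj.basicOpen ℬ (φ.hom s)) :=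
  φ.map.app (Proj.basicOpen 𝒜 s)

lemma appBasic_eq {i : ℕ} (hi : 0 < i) {s : A} (hs : s ∈ 𝒜 i) :
    φ.appBasic s = (Proj.basicOpenIsoAway 𝒜 s hs hi).inv ≫
      CommRingCat.ofHom (φ.locMap (φ.mem_powers_hom s)) ≫
        (Proj.basicOpenIsoAway ℬ (φ.hom s) (φ.map_mem hs) (Nat.mul_pos φ.pos hi)).hom := by
  rw [Iso.eq_inv_comp]
  exact φ.awayToSection_comp_app s

/-- On each basic open set the map of sections is, up to isomorphisms, the map of degree zero
localizations, so the question is affine. -/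
lemma isClosedImmersion_map (hφ : ∀ m, ∀ b ∈ ℬ (d * m), ∃ a ∈ 𝒜 m, φ.hom a = b) :
    IsClosedImmersion φ.map := by
  refine isClosedImmersion_of_app_surjective φ.map (basicAffine 𝒜) (iSup_basicAffine 𝒜)
    (fun s => Proj.isAffineOpen_basicOpen ℬ _ (φ.map_mem s.2.2) (Nat.mul_pos φ.pos s.1.2)) fun s => ?_
  change Function.Surjective (φ.appBasic s.2.1).hom
  rw [φ.appBasic_eq s.1.2 s.2.2]
  simp only [CommRingCat.hom_comp, RingHom.coe_comp]
  exact ((ConcreteCategory.bijective_of_isIso (Proj.basicOpenIsoAway ℬ (φ.hom s.2.1) (φ.map_mem s.2.2)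
    (Nat.mul_pos φ.pos s.1.2)).hom).2.comp (φ.locMap_away_surjective hφ s.2.2)).comp
    (ConcreteCategory.bijective_of_isIso (Proj.basicOpenIsoAway 𝒜 s.2.1 s.2.2 s.1.2).inv).2

lemma isIso_map (hφ : ∀ m, ∀ b ∈ ℬ (d * m), ∃ a ∈ 𝒜 m, φ.hom a = b)
    (hφ' : Function.Injective φ.hom) : IsIso φ.map := by
  refine isIso_of_app_isIso φ.map (basicAffine 𝒜) (iSup_basicAffine 𝒜)
    (fun s => Proj.isAffineOpen_basicOpen ℬ _ (φ.map_mem s.2.2) (Nat.mul_pos φ.pos s.1.2)) fun s => ?_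
  change IsIso (φ.appBasic s.2.1)
  have : IsIso (CommRingCat.ofHom (φ.locMap (φ.mem_powers_hom s.2.1))) :=
    (ConcreteCategory.isIso_iff_bijective _).2
      ⟨φ.locMap_away_injective hφ' _, φ.locMap_away_surjective hφ s.2.2⟩
  rw [φ.appBasic_eq s.1.2 s.2.2]
  infer_instance

lemma awayι_comp_map {i : ℕ} (hi : 0 < i) {s : A} (hs : s ∈ 𝒜 i) :
    Proj.awayι ℬ (φ.hom s) (φ.map_mem hs) (Nat.mul_pos φ.pos hi) ≫ φ.map =
      Spec.map (CommRingCat.ofHom (φ.locMap (φ.mem_powers_hom s))) ≫ Proj.awayι 𝒜 s hs hi := by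
  have key : φ.map.resLE (Proj.basicOpen 𝒜 s) (Proj.basicOpen ℬ (φ.hom s)) le_rfl ≫
      (Proj.basicOpenIsoSpec 𝒜 s hs hi).hom =
      (Proj.basicOpenIsoSpec ℬ (φ.hom s) (φ.map_mem hs) (Nat.mul_pos φ.pos hi)).hom ≫
        Spec.map (CommRingCat.ofHom (φ.locMap (φ.mem_powers_hom s))) := by
    rw [Proj.basicOpenIsoSpec_hom, Proj.basicOpenIsoSpec_hom, Proj.basicOpenToSpec,
      Proj.basicOpenToSpec, Category.assoc, ← Spec.map_comp]
    have h := Scheme.Opens.toSpecΓ_SpecMap_appLE φ.map (Proj.basicOpen 𝒜 s)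
      (Proj.basicOpen ℬ (φ.hom s)) le_rfl
    rw [← Category.assoc]
    refine (congrArg (· ≫ Spec.map (Proj.awayToSection 𝒜 s)) h.symm).trans ?_
    rw [Category.assoc]
    refine congrArg (_ ≫ ·) ?_
    rw [← Spec.map_comp]
    refine congrArg Spec.map ?_
    refine Eq.trans ?_ (φ.awayToSection_comp_app s)
    exact congrArg (Proj.awayToSection 𝒜 s ≫ ·) (Scheme.Hom.app_eq_appLE _).symm
  rw [Proj.awayι, Proj.awayι, Category.assoc, Iso.inv_comp_eq, ← Category.assoc]
  refine Eq.trans ?_ (congrArg (· ≫ ((Proj.basicOpenIsoSpec 𝒜 s hs hi).inv ≫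
    (Proj.basicOpen 𝒜 s).ι)) key)
  rw [Category.assoc, Iso.hom_inv_id_assoc]
  exact (Scheme.Hom.resLE_comp_ι φ.map (U := Proj.basicOpen 𝒜 s)
    (V := Proj.basicOpen ℬ (φ.hom s)) le_rfl).symm

lemma isOpenCover_basicOpen_hom : IsOpenCover
    (fun s : Σ i : {i : ℕ // 0 < i}, 𝒜 i.1 => (Proj.basicOpen ℬ (φ.hom s.2.1) : (Proj ℬ).Opens)) := by
  refine top_le_iff.1 fun x _ => ?_
  have h : φ.map x ∈ ⨆ s, (basicAffine 𝒜 s).1 := by rw [iSup_basicAffine]; trivial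
  obtain ⟨s, hs⟩ := Opens.mem_iSup.1 h
  exact Opens.mem_iSup.2 ⟨s, hs⟩

/-- Tested on the cover of `Proj ℬ` by the basic open sets of the `φ(s)`, where both sides are
`Spec` of the map that sends a complex number to a constant. -/
lemma map_toSpec : φ.map ≫ PluckerGIT.projToSpec 𝒜 = PluckerGIT.projToSpec ℬ := by
  refine (Scheme.openCoverOfIsOpenCover _ _ φ.isOpenCover_basicOpen_hom).hom_ext _ _ fun s => ?_
  refine (cancel_epi (Proj.basicOpenIsoSpec ℬ (φ.hom s.2.1) (φ.map_mem s.2.2)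
    (Nat.mul_pos φ.pos s.1.2)).inv).1 ?_
  refine (Category.assoc _ _ _).symm.trans (Eq.trans ?_ (Category.assoc _ _ _))
  change Proj.awayι ℬ (φ.hom s.2.1) (φ.map_mem s.2.2) (Nat.mul_pos φ.pos s.1.2) ≫ _ =
    Proj.awayι ℬ (φ.hom s.2.1) (φ.map_mem s.2.2) (Nat.mul_pos φ.pos s.1.2) ≫ _
  rw [← Category.assoc, awayι_comp_map _ s.1.2 s.2.2, PluckerGIT.projToSpec, PluckerGIT.projToSpec,
    Category.assoc, Proj.awayι_toSpecZero_assoc, Proj.awayι_toSpecZero_assoc, ← Spec.map_comp, 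
    ← Spec.map_comp, ← Spec.map_comp]
  refine congrArg Spec.map (CommRingCat.hom_ext (RingHom.ext fun z =>
    HomogeneousLocalization.val_injective _ ?_))
  refine (φ.val_locMap (φ.mem_powers_hom s.2.1)
    (HomogeneousLocalization.fromZeroRingHom 𝒜 _ (algebraMap ℂ (𝒜 0) z))).trans ?_
  refine (φ.locExt_mk _ _ _).trans ?_
  change Localization.mk (φ.hom (algebraMap ℂ A z)) _ = Localization.mk (algebraMap ℂ B z) _
  rw [AlgHom.commutes]
  congr 1
  exact Subtype.ext (map_one φ.hom)

end ScaledHom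
end ProjScaled

/-! ### Twisting sheaves under degree-scaling morphisms -/

namespace ProjScaled.ScaledHom

variable {A B : Type} [CommRing A] [Algebra ℂ A] [CommRing B] [Algebra ℂ B]
  {𝒜 : ℕ → Submodule ℂ A} {ℬ : ℕ → Submodule ℂ B} [GradedAlgebra 𝒜] [GradedAlgebra ℬ]
  {d : ℕ} (φ : ScaledHom 𝒜 ℬ d)

/-- The map on full localizations at homogeneous primes. -/
def fullStalk (y : ProjectiveSpectrum ℬ) :
    SerreTwist.Loc 𝒜 (φ.comapFun y) →+* SerreTwist.Loc ℬ y :=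
  φ.locExt (fun _ h => h)

lemma fullStalk_mk (y : ProjectiveSpectrum ℬ) (a : A)
    (s : (φ.comapFun y).asHomogeneousIdeal.toIdeal.primeCompl) :
    φ.fullStalk y (Localization.mk a s) = Localization.mk (φ.hom a) ⟨φ.hom s, s.2⟩ :=
  φ.locExt_mk _ _ _

lemma twistFun_mem (k : ℕ) (U : Opens (ProjectiveSpectrum 𝒜))
    (s : ∀ x : U, SerreTwist.Loc 𝒜 x.1) (hs : (SerreTwist.isLocallyFraction 𝒜 k).pred s) :
    (SerreTwist.isLocallyFraction ℬ (d * k)).pred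
      (fun y : U.comap φ.comap => φ.fullStalk y.1 (s ⟨φ.comap y.1, y.2⟩)) := by
  rintro ⟨p, hpV⟩
  rcases hs ⟨φ.comap p, hpV⟩ with ⟨W, m, iWU, i, a, b, hb, h_frac⟩
  refine ⟨W.comap φ.comap, m, homOfLE fun y hy => leOfHom iWU hy, d * i,
    ⟨φ.hom a, by rw [← mul_add]; exact φ.map_mem a.2⟩, ⟨φ.hom b, φ.map_mem b.2⟩,
    fun q => hb ⟨_, q.2⟩, fun q => ?_⟩
  exact (congrArg (φ.fullStalk q.1) (h_frac ⟨_, q.2⟩)).trans (φ.fullStalk_mk _ _ _)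

/-- The map on sections of the twisting sheaves. -/
def twistFun (k : ℕ) (U : Opens (ProjectiveSpectrum 𝒜)) :
    (SerreTwist.sheafInType 𝒜 k).1.obj (op U) →+
      (SerreTwist.sheafInType ℬ (d * k)).1.obj (op (U.comap φ.comap)) where
  toFun s := ⟨_, φ.twistFun_mem k U s.1 s.2⟩
  map_zero' := Subtype.ext <| funext fun y => map_zero (φ.fullStalk y.1)
  map_add' _ _ := Subtype.ext <| funext fun y => map_add (φ.fullStalk y.1) _ _

/-- The map of twisting sheaves `𝒪(k) ⟶ f_* 𝒪(d k)` induced by a scaled homomorphism. -/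
def twistHom (k : ℕ) : SerreTwist.twist 𝒜 k ⟶
    (Scheme.Modules.pushforward φ.map).obj (SerreTwist.twist ℬ (d * k)) where
  val := PresheafOfModules.homMk
    { app := fun U => AddCommGrpCat.ofHom (φ.twistFun k U.unop)
      naturality := fun _ _ _ => rfl }
    (fun U r s => Subtype.ext <| funext fun y => by
      refine (map_mul (φ.fullStalk y.1) _ _).trans ?_
      refine congrArg (· * _) ?_
      exact (φ.val_locMap _ _).symm)

lemma fullStalk_injective [IsDomain B] (hφ : Function.Injective φ.hom)
    (y : ProjectiveSpectrum ℬ) : Function.Injective (φ.fullStalk y) := by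
  rw [injective_iff_map_eq_zero]
  intro x hx
  induction x using Localization.induction_on with | H z => ?_
  obtain ⟨a, s⟩ := z
  rw [fullStalk_mk, Localization.mk_eq_mk', IsLocalization.mk'_eq_zero_iff] at hx
  obtain ⟨⟨t, ht⟩, hm⟩ := hx
  have ht0 : t ≠ 0 := fun h => ht (h ▸ zero_mem _)
  have ha : φ.hom a = 0 := (mul_eq_zero.1 hm).resolve_left ht0
  rw [(map_eq_zero_iff _ hφ).1 ha]
  exact Localization.mk_zero _

lemma twistFun_injective [IsDomain B] (hφ : Function.Injective φ.hom)
    (hs : Function.Surjective φ.comap) (k : ℕ) (U : Opens (ProjectiveSpectrum 𝒜)) :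
    Function.Injective (φ.twistFun k U) := by
  intro s t hst
  refine Subtype.ext (funext fun x => ?_)
  obtain ⟨x, hx⟩ := x
  obtain ⟨y, rfl⟩ := hs x
  exact φ.fullStalk_injective hφ y (congrFun (congrArg Subtype.val hst) ⟨y, hx⟩)

/-- Rewriting `a / b` as `a b^(d-1) / b^d` moves numerator and denominator into the degrees `d(i +
k)` and `d i`, where they have preimages. -/
lemma exists_fraction (hφ : ∀ m, ∀ b ∈ ℬ (d * m), ∃ a ∈ 𝒜 m, φ.hom a = b) {k i : ℕ}
    (a : ℬ (i + d * k)) (b : ℬ i) : ∃ (a' : 𝒜 (i + k)) (b' : 𝒜 i),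
      φ.hom a' = a * b.1 ^ (d - 1) ∧ φ.hom b' = b.1 ^ d := by
  have hd : d = d - 1 + 1 := (Nat.sub_add_cancel φ.pos).symm
  have h1 : a.1 * b.1 ^ (d - 1) ∈ ℬ (d * (i + k)) := by
    have := SetLike.mul_mem_graded a.2 (SetLike.pow_mem_graded (d - 1) b.2)
    rw [smul_eq_mul] at this
    convert this using 2
    conv_lhs => rw [mul_add]; lhs; rw [hd]
    ring
  have h2 : b.1 ^ d ∈ ℬ (d * i) := SetLike.pow_mem_graded d b.2
  obtain ⟨a', ha', h⟩ := hφ _ _ h1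
  obtain ⟨b', hb', h'⟩ := hφ _ _ h2
  exact ⟨⟨a', ha'⟩, ⟨b', hb'⟩, h, h'⟩

lemma fullStalk_fraction {y : ProjectiveSpectrum ℬ} {a b : B} (hb : b ∉ y.asHomogeneousIdeal)
    {a' b' : A} (ha' : φ.hom a' = a * b ^ (d - 1)) (hb' : φ.hom b' = b ^ d)
    (hb'' : b' ∉ (φ.comapFun y).asHomogeneousIdeal) :
    φ.fullStalk y (Localization.mk a' ⟨b', hb''⟩) = Localization.mk a ⟨b, hb⟩ := by
  rw [fullStalk_mk, Localization.mk_eq_mk_iff, Localization.r_iff_exists]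
  refine ⟨1, ?_⟩
  change 1 * (b * φ.hom a') = 1 * (φ.hom b' * a)
  have hd : d = d - 1 + 1 := (Nat.sub_add_cancel φ.pos).symm
  rw [ha', hb']
  conv_rhs => rw [hd]
  ring

lemma notMem_comap_of_pow {y : ProjectiveSpectrum ℬ} {b : B} (hb : b ∉ y.asHomogeneousIdeal)
    {b' : A} (hb' : φ.hom b' = b ^ d) : b' ∉ (φ.comapFun y).asHomogeneousIdeal := by
  rw [mem_comapFun, hb']
  exact fun h => hb (y.isPrime.mem_of_pow_mem _ h)

/-- `fullStalk` at a point known only up to equality. -/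
def fullStalkOfEq {y : ProjectiveSpectrum ℬ} {x : ProjectiveSpectrum 𝒜} (h : φ.comap y = x) :
    SerreTwist.Loc 𝒜 x →+* SerreTwist.Loc ℬ y :=
  φ.locExt (fun _ ha => by subst h; exact ha)

lemma twistFun_surjective [IsDomain B] (hφ : ∀ m, ∀ b ∈ ℬ (d * m), ∃ a ∈ 𝒜 m, φ.hom a = b)
    (hφ' : Function.Injective φ.hom) (hinj : Function.Injective φ.comap)
    (hs : Function.Surjective φ.comap) (ho : IsOpenMap φ.comap)
    (k : ℕ) (U : Opens (ProjectiveSpectrum 𝒜)) :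
    Function.Surjective (φ.twistFun k U) := by
  intro t
  -- The value at `x` is read off from a preimage `y`. Quantifying over all `y` above `x` avoids
  -- transport along `φ.comap y = x`, and injectivity of `φ.comap` leaves only one such `y`.
  have key (x : U) : ∃ z : SerreTwist.Loc 𝒜 x.1, ∀ (y : ProjectiveSpectrum ℬ)
      (h : φ.comap y = x.1), φ.fullStalkOfEq h z = t.1 ⟨y, by
        change φ.comap y ∈ U; rw [h]; exact x.2⟩ := by
    obtain ⟨x, hx⟩ := x
    obtain ⟨y, rfl⟩ := hs x
    obtain ⟨V, hyV, iV, i, a, b, hb, hfr⟩ := t.2 ⟨y, hx⟩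
    obtain ⟨a', b', ha', hb'⟩ := φ.exists_fraction hφ a b
    have hb'' := φ.notMem_comap_of_pow (hb ⟨y, hyV⟩) hb'
    refine ⟨Localization.mk a'.1 ⟨b'.1, hb''⟩, fun y' h => ?_⟩
    obtain rfl : y' = y := hinj h
    exact (φ.fullStalk_fraction (hb ⟨y', hyV⟩) ha' hb' _).trans (hfr ⟨y', hyV⟩).symm
  choose s hs' using key
  have hs'' (y : ProjectiveSpectrum ℬ) (hy : φ.comap y ∈ U) :
      φ.fullStalk y (s ⟨φ.comap y, hy⟩) = t.1 ⟨y, hy⟩ := hs' ⟨φ.comap y, hy⟩ y rfl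
  refine ⟨⟨s, ?_⟩, Subtype.ext <| funext fun y => hs'' y.1 y.2⟩
  rintro ⟨x, hx⟩
  obtain ⟨y, rfl⟩ := hs x
  obtain ⟨V, hyV, iV, i, a, b, hb, hfr⟩ := t.2 ⟨y, hx⟩
  obtain ⟨a', b', ha', hb'⟩ := φ.exists_fraction hφ a b
  -- As `φ.comap` is open, the image of `V` is a neighbourhood on which the single fraction `a' /
  -- b'` represents the section. Equality is tested after the injective map `fullStalk`.
  refine ⟨⟨φ.comap '' V.1, ho _ V.2⟩, ⟨y, hyV, rfl⟩,
    homOfLE (by rintro _ ⟨y', hy', rfl⟩; exact leOfHom iV hy'), i, a', b', ?_, ?_⟩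
  · rintro ⟨_, y', hy', rfl⟩
    exact φ.notMem_comap_of_pow (hb ⟨y', hy'⟩) hb'
  · rintro ⟨_, y', hy', rfl⟩
    apply φ.fullStalk_injective hφ' y'
    refine Eq.trans ?_ (φ.fullStalk_fraction (hb ⟨y', hy'⟩) ha' hb' _).symm
    exact (hs'' y' (leOfHom iV hy')).trans (hfr ⟨y', hy'⟩)

lemma isIso_twistHom [IsDomain B] (hφ : ∀ m, ∀ b ∈ ℬ (d * m), ∃ a ∈ 𝒜 m, φ.hom a = b)
    (hφ' : Function.Injective φ.hom) (k : ℕ) : IsIso (φ.twistHom k) := by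
  have := φ.isIso_map hφ hφ'
  have h := (Scheme.Hom.isOpenEmbedding φ.map)
  have h2 : Function.Surjective φ.map := (Scheme.homeoOfIso (asIso φ.map)).surjective
  rw [Scheme.Modules.Hom.isIso_iff_isIso_app]
  intro U
  refine (ConcreteCategory.isIso_iff_bijective _).2 ⟨?_, ?_⟩
  · exact φ.twistFun_injective hφ' h2 k U
  · exact φ.twistFun_surjective hφ hφ' h.injective h2 h.isOpenMap k U

end ProjScaled.ScaledHom

/-! ### Sheaves of modules along isomorphisms of schemes -/

namespace AlgebraicGeometry.Scheme.Modules

/-- Pushforward along an isomorphism is an equivalence. -/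
def pushforwardEquivalence {X Y : Scheme.{0}} (e : X ≅ Y) : X.Modules ≌ Y.Modules :=
  CategoryTheory.Equivalence.mk (pushforward e.hom) (pushforward e.inv)
    ((pushforwardId X).symm ≪≫ pushforwardCongr e.hom_inv_id.symm ≪≫ (pushforwardComp _ _).symm)
    (pushforwardComp _ _ ≪≫ pushforwardCongr e.inv_hom_id ≪≫ pushforwardId Y)

/-- Along an isomorphism `f`, a sheaf whose pushforward is `N` is the pullback of `N`. -/
lemma nonempty_iso_pullback {X Y : Scheme.{0}} (e : X ≅ Y) (M : X.Modules) (N : Y.Modules)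
    (i : N ≅ (pushforward e.hom).obj M) : Nonempty (M ≅ (pullback e.hom).obj N) := by
  have h1 : (pushforward e.hom).IsEquivalence := (pushforwardEquivalence e).isEquivalence_functor
  have h2 : IsIso (pullbackPushforwardAdjunction e.hom).counit := inferInstance
  exact ⟨(asIso ((pullbackPushforwardAdjunction e.hom).counit.app M)).symm ≪≫
    (pullback e.hom).mapIso i.symm⟩

/-- Serves the case `n = 3`, in which the quotient and the projective line are both compared with a
third scheme, the `Proj` of the regraded invariants. -/
lemma nonempty_iso_pullback_trans {X Y Z : Scheme.{0}} (e : X ≅ Y) (e' : Z ≅ Y) (M : X.Modules)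
    (N : Y.Modules) (K : Z.Modules) (h : Nonempty (M ≅ (pullback e.hom).obj N))
    (h' : Nonempty (K ≅ (pullback e'.hom).obj N)) :
    Nonempty (M ≅ (pullback (e ≪≫ e'.symm).hom).obj K) := by
  obtain ⟨i⟩ := h
  obtain ⟨j⟩ := h'
  refine ⟨i ≪≫ ?_ ≪≫ ((pullback (e ≪≫ e'.symm).hom).mapIso j).symm⟩
  refine (pullbackCongr ?_).app N ≪≫ ((pullbackComp (e ≪≫ e'.symm).hom e'.hom).app N).symm
  simp

end AlgebraicGeometry.Scheme.Modules

/-! ### Base change of `Proj` and algebraic actions -/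

namespace ProjBaseChange

open HomogeneousLocalization TensorProduct

section
variable {A B σ τ : Type} [CommRing A] [CommRing B] [SetLike σ A] [AddSubgroupClass σ A]
  [SetLike τ B] [AddSubgroupClass τ B]
variable {𝒜 : ℕ → σ} {ℬ : ℕ → τ} [GradedRing 𝒜] [GradedRing ℬ]

lemma awayι_comp_map_toSpec {f : 𝒜 →+*ᵍ ℬ}
    (hf : HomogeneousIdeal.irrelevant ℬ ≤ (HomogeneousIdeal.irrelevant 𝒜).map f)
    {S T : Type} [CommRing S] [CommRing T] (c : S →+* 𝒜 0) (c' : T →+* ℬ 0) (e : S →+* T)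
    (h : ∀ x, f (c x) = c' (e x)) {i : ℕ} (hi : 0 < i) (s : A) (hs : s ∈ 𝒜 i) :
    Proj.awayι ℬ (f s) (f.2 hs) hi ≫
      Proj.map f hf ≫ Proj.toSpecZero 𝒜 ≫ Spec.map (CommRingCat.ofHom c) =
    Proj.awayι ℬ (f s) (f.2 hs) hi ≫
      Proj.toSpecZero ℬ ≫ Spec.map (CommRingCat.ofHom c') ≫ Spec.map (CommRingCat.ofHom e) := by
  rw [Proj.awayι_comp_map_assoc _ _ hi _ hs, Proj.awayι_toSpecZero_assoc,
    Proj.awayι_toSpecZero_assoc, ← Spec.map_comp, ← Spec.map_comp, ← Spec.map_comp, ← Spec.map_comp]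
  refine congrArg Spec.map (CommRingCat.hom_ext (RingHom.ext fun x => ?_))
  refine HomogeneousLocalization.val_injective _ ?_
  change Localization.mk (f (c x)) _ = Localization.mk (c' (e x)).1 _
  rw [h]
  congr 1
  exact Subtype.ext (map_one f)

/-- A graded homomorphism that is compatible with a map `e` of base rings induces a morphism of
`Proj` lying over `Spec e`; the charts reduce this to the hypothesis on constants. -/
lemma map_toSpec {f : 𝒜 →+*ᵍ ℬ}
    (hf : HomogeneousIdeal.irrelevant ℬ ≤ (HomogeneousIdeal.irrelevant 𝒜).map f)
    {S T : Type} [CommRing S] [CommRing T] (c : S →+* 𝒜 0) (c' : T →+* ℬ 0) (e : S →+* T)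
    (h : ∀ x, f (c x) = c' (e x)) :
    Proj.map f hf ≫ Proj.toSpecZero 𝒜 ≫ Spec.map (CommRingCat.ofHom c) =
      Proj.toSpecZero ℬ ≫ Spec.map (CommRingCat.ofHom c') ≫ Spec.map (CommRingCat.ofHom e) :=
  (Proj.mapAffineOpenCover f hf).openCover.hom_ext _ _ fun s =>
    awayι_comp_map_toSpec hf c c' e h s.1.2 s.2.1 s.2.2

lemma map_comp_eq_id {f : 𝒜 →+*ᵍ ℬ} {g : ℬ →+*ᵍ 𝒜}
    (hf : HomogeneousIdeal.irrelevant ℬ ≤ (HomogeneousIdeal.irrelevant 𝒜).map f)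
    (hg : HomogeneousIdeal.irrelevant 𝒜 ≤ (HomogeneousIdeal.irrelevant ℬ).map g)
    (h : g.comp f = .id 𝒜) : Proj.map g hg ≫ Proj.map f hf = 𝟙 _ := by
  rw [← Proj.map_comp f g hf hg, ← Proj.map_id]
  congr 1
end

variable {A : Type} [CommRing A] [Algebra ℂ A] (𝒜 : ℕ → Submodule ℂ A) [GradedAlgebra 𝒜]
  (S : Type) [CommRing S] [Algebra ℂ S]

/-- The grading of `S ⊗ A` induced by that of `A`. -/
abbrev grading (i : ℕ) : Submodule S (S ⊗[ℂ] A) := (𝒜 i).baseChange S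

/-- The inclusion `A → S ⊗ A`. -/
def incl : 𝒜 →+*ᵍ grading 𝒜 S where
  __ := (Algebra.TensorProduct.includeRight : A →ₐ[ℂ] S ⊗[ℂ] A).toRingHom
  map_mem h := Submodule.tmul_mem_baseChange_of_mem _ h

/-- The degree `i` part of `S ⊗ A` is generated over `S` by the elements `1 ⊗ a`, so only these need
to be tested. -/
lemma irrelevant_le_map {C τ : Type} [CommRing C] [SetLike τ C] [AddSubgroupClass τ C]
    {𝒞 : ℕ → τ} [GradedRing 𝒞] (f : 𝒞 →+*ᵍ grading 𝒜 S)
    (h : ∀ i, 0 < i → ∀ a ∈ 𝒜 i, 1 ⊗ₜ a ∈ ((HomogeneousIdeal.irrelevant 𝒞).map f).toIdeal) :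
    HomogeneousIdeal.irrelevant (grading 𝒜 S) ≤ (HomogeneousIdeal.irrelevant 𝒞).map f := by
  rw [HomogeneousIdeal.irrelevant_le]
  intro i hi x hx
  obtain ⟨y, rfl⟩ := Submodule.toBaseChange_surjective' _ _ hx
  induction y with
  | zero => rw [map_zero]; exact Ideal.zero_mem _
  | add y z hy hz =>
    rw [map_add]
    exact Ideal.add_mem _ (hy (SetLike.coe_mem _)) (hz (SetLike.coe_mem _))
  | tmul s a =>
    have : ((Submodule.toBaseChange S (𝒜 i)) (s ⊗ₜ a) : S ⊗[ℂ] A) =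
        (s ⊗ₜ 1) * (1 ⊗ₜ a.1) := by
      rw [Algebra.TensorProduct.tmul_mul_tmul, mul_one, one_mul]; rfl
    rw [this]
    exact Ideal.mul_mem_left _ _ (h i hi _ a.2)

lemma irrelevant_le_map_incl :
    HomogeneousIdeal.irrelevant (grading 𝒜 S) ≤ (HomogeneousIdeal.irrelevant 𝒜).map (incl 𝒜 S) :=
  irrelevant_le_map 𝒜 S _ fun _ hi _ ha =>
    Ideal.mem_map_of_mem (incl 𝒜 S) (HomogeneousIdeal.mem_irrelevant_of_mem 𝒜 hi ha)

lemma incl_apply (a : A) : incl 𝒜 S a = 1 ⊗ₜ a := rfl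

section Chart

/-- The algebra structure of the degree zero part of a localization. -/
abbrev awayAlgebra (s : A) : Algebra ℂ (Away 𝒜 s) :=
  ((fromZeroRingHom 𝒜 (Submonoid.powers s)).comp (algebraMap ℂ (𝒜 0))).toAlgebra

lemma exists_common_denom {i : ℕ} {s : A} (hs : s ∈ 𝒜 i) {ι : Type} (w : Finset ι) (z : ι → Away 𝒜 s) :
    ∃ (n : ℕ) (a : ι → A) (ha : ∀ j, a j ∈ 𝒜 (n • i)), ∀ j ∈ w, z j = Away.mk 𝒜 hs n (a j) (ha j) := by
  choose n a ha h using fun j => Away.mk_surjective 𝒜 hs (z j)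
  refine ⟨w.sup n, fun j => if n j ≤ w.sup n then s ^ (w.sup n - n j) * a j else 0, fun j => ?_,
    fun j hj => ?_⟩
  · dsimp only
    split_ifs with hn
    · have := SetLike.mul_mem_graded (SetLike.pow_mem_graded (w.sup n - n j) hs) (ha j)
      rwa [← add_smul, Nat.sub_add_cancel hn] at this
    · exact zero_mem _
  · have hn : n j ≤ w.sup n := Finset.le_sup hj
    refine HomogeneousLocalization.val_injective _ ?_
    simp only [← h j, Away.val_mk, if_pos hn]
    rw [Localization.mk_eq_mk_iff,
      Localization.r_iff_exists]
    refine ⟨1, ?_⟩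
    simp only [OneMemClass.coe_one, one_mul]
    rw [← mul_assoc, ← pow_add, Nat.add_sub_cancel' hn]


/-- The structure map of the degree zero part of a localization of `S ⊗ A`. -/
def awayInl (s : A) : S →+* Away (grading 𝒜 S) (incl 𝒜 S s) :=
  (fromZeroRingHom (grading 𝒜 S) _).comp (algebraMap S (grading 𝒜 S 0))

lemma awayMap_algebraMap (s : A) (z : ℂ) :
    Away.map (incl 𝒜 S) s ((fromZeroRingHom 𝒜 (Submonoid.powers s)) (algebraMap ℂ (𝒜 0) z)) =
      awayInl 𝒜 S s (algebraMap ℂ S z) := by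
  refine HomogeneousLocalization.val_injective _ ?_
  change Localization.mk ((1 : S) ⊗ₜ[ℂ] (algebraMap ℂ A z)) _ =
    Localization.mk ((algebraMap ℂ S z) ⊗ₜ[ℂ] (1 : A)) _
  congr 1
  · rw [Algebra.algebraMap_eq_smul_one, Algebra.algebraMap_eq_smul_one, TensorProduct.smul_tmul]

/-- The comparison map from the base change of a localization to the localization of the base
change. -/
def awayTensor (s : A) :
    letI := awayAlgebra 𝒜 s
    S ⊗[ℂ] Away 𝒜 s →+* Away (grading 𝒜 S) (incl 𝒜 S s) :=
  letI := awayAlgebra 𝒜 s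
  letI : Algebra ℂ (Away (grading 𝒜 S) (incl 𝒜 S s)) :=
    ((awayInl 𝒜 S s).comp (algebraMap ℂ S)).toAlgebra
  (Algebra.TensorProduct.lift (A := S) (S := ℂ) ({ awayInl 𝒜 S s with commutes' := fun _ => rfl } : S →ₐ[ℂ] _)
    ({ Away.map (incl 𝒜 S) s with commutes' := awayMap_algebraMap 𝒜 S s } : Away 𝒜 s →ₐ[ℂ] _)
    (fun _ _ => Commute.all _ _)).toRingHom

lemma awayTensor_tmul (s : A) (t : S) (z : Away 𝒜 s) :
    letI := awayAlgebra 𝒜 s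
    awayTensor 𝒜 S s (t ⊗ₜ z) = awayInl 𝒜 S s t * Away.map (incl 𝒜 S) s z := rfl

lemma val_awayTensor_tmul {i : ℕ} {s : A} (hs : s ∈ 𝒜 i) (t : S) {n : ℕ} {a : A}
    (ha : a ∈ 𝒜 (n • i)) :
    letI := awayAlgebra 𝒜 s
    (awayTensor 𝒜 S s (t ⊗ₜ Away.mk 𝒜 hs n a ha)).val =
      Localization.mk (t ⊗ₜ a) (⟨incl 𝒜 S s ^ n, n, rfl⟩ : Submonoid.powers (incl 𝒜 S s)) := by
  rw [awayTensor_tmul, HomogeneousLocalization.val_mul, Away.map_mk, Away.val_mk]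
  refine (Localization.mk_mul (t ⊗ₜ[ℂ] (1 : A)) _ 1 _).trans ?_
  rw [one_mul]
  congr 1
  exact (Algebra.TensorProduct.tmul_mul_tmul t 1 (1 : A) a).trans (by rw [mul_one, one_mul])

lemma val_awayTensor_sum {i : ℕ} {s : A} (hs : s ∈ 𝒜 i) {ι : Type} (w : Finset ι) (t : ι → S) {n : ℕ}
    {a : ι → A} (ha : ∀ j, a j ∈ 𝒜 (n • i)) :
    letI := awayAlgebra 𝒜 s
    (awayTensor 𝒜 S s (∑ j ∈ w, t j ⊗ₜ Away.mk 𝒜 hs n (a j) (ha j))).val =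
      Localization.mk (∑ j ∈ w, t j ⊗ₜ a j) (⟨incl 𝒜 S s ^ n, n, rfl⟩ : Submonoid.powers (incl 𝒜 S s)) := by
  classical
  let := awayAlgebra 𝒜 s
  rw [map_sum]
  induction w using Finset.induction_on with
  | empty => simp only [Finset.sum_empty, HomogeneousLocalization.val_zero, Localization.mk_zero]
  | insert j w hj ih =>
    rw [Finset.sum_insert hj, Finset.sum_insert hj, HomogeneousLocalization.val_add, ih,
      val_awayTensor_tmul, Localization.add_mk_self]

/-- Expand `x` in a basis `β` of `S` over `ℂ` and clear denominators. Vanishing of the image means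
`s^k ∑ β_j ⊗ a_j = 0` for some `k`, and independence of the basis gives `s^k a_j = 0` for each `j`,
so each coefficient is already zero in the localization. -/
lemma awayTensor_injective {i : ℕ} {s : A} (hs : s ∈ 𝒜 i) :
    Function.Injective (awayTensor 𝒜 S s) := by
  classical
  let := awayAlgebra 𝒜 s
  rw [injective_iff_map_eq_zero]
  intro x hx
  let β := Module.Basis.ofVectorSpace ℂ S
  obtain ⟨c, rfl⟩ := TensorProduct.eq_repr_basis_left β x
  obtain ⟨n, a, ha, hc⟩ := exists_common_denom 𝒜 hs c.support c
  have h1 : (c.sum fun j m => β j ⊗ₜ[ℂ] m) =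
      ∑ j ∈ c.support, β j ⊗ₜ Away.mk 𝒜 hs n (a j) (ha j) :=
    Finset.sum_congr rfl fun j hj => by rw [hc j hj]
  have h2 := val_awayTensor_sum 𝒜 S hs c.support β ha
  rw [← h1, hx, HomogeneousLocalization.val_zero, ← Localization.mk_zero 1,
    Localization.mk_eq_mk_iff, Localization.r_iff_exists] at h2
  obtain ⟨⟨_, k, rfl⟩, hk⟩ := h2
  have h3 : ∑ j ∈ c.support, β j ⊗ₜ[ℂ] (s ^ k * a j) = 0 := by
    have h4 : (incl 𝒜 S s ^ k) * ∑ j ∈ c.support, β j ⊗ₜ[ℂ] a j = 0 := by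
      simpa using hk.symm
    rw [Finset.mul_sum] at h4
    rw [← h4]
    refine Finset.sum_congr rfl fun j _ => ?_
    rw [incl_apply, Algebra.TensorProduct.tmul_pow, one_pow, Algebra.TensorProduct.tmul_mul_tmul,
      one_mul]
  let c' : _ →₀ A := Finsupp.onFinset c.support (fun j => if j ∈ c.support then s ^ k * a j else 0)
    (fun j hj => by by_contra h; exact hj (if_neg h))
  have h5 : c' = 0 := by
    refine TensorProduct.sum_tmul_basis_left_eq_zero β c' ?_
    rw [Finsupp.onFinset_sum _ (fun _ => TensorProduct.tmul_zero _ _), ← h3]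
    exact Finset.sum_congr rfl fun j hj => by rw [if_pos hj]
  have h6 : c = 0 := by
    ext1 j
    by_cases hj : j ∈ c.support
    · have h7 := DFunLike.congr_fun h5 j
      have h8 : s ^ k * a j = 0 := by
        rw [Finsupp.onFinset_apply, if_pos hj] at h7; exact h7
      rw [hc j hj]
      refine HomogeneousLocalization.val_injective _ ?_
      rw [Away.val_mk, Finsupp.coe_zero, Pi.zero_apply, HomogeneousLocalization.val_zero,
        ← Localization.mk_zero 1, Localization.mk_eq_mk_iff, Localization.r_iff_exists]
      exact ⟨⟨s ^ k, k, rfl⟩, by simpa using h8⟩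
    · exact Finsupp.notMem_support_iff.1 hj
  rw [h6, Finsupp.sum_zero_index]

lemma awayTensor_surjective {i : ℕ} {s : A} (hs : s ∈ 𝒜 i) :
    Function.Surjective (awayTensor 𝒜 S s) := by
  let := awayAlgebra 𝒜 s
  intro y
  obtain ⟨n, b, hb, rfl⟩ := Away.mk_surjective (grading 𝒜 S) ((incl 𝒜 S).map_mem hs) y
  obtain ⟨z, hz⟩ := Submodule.toBaseChange_surjective' _ _ hb
  have key : ∃ x, (awayTensor 𝒜 S s x).val = Localization.mk
      (Submodule.toBaseChange S (𝒜 (n • i)) z : S ⊗[ℂ] A)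
        (⟨incl 𝒜 S s ^ n, n, rfl⟩ : Submonoid.powers (incl 𝒜 S s)) := by
    clear hz
    induction z with
    | zero => exact ⟨0, by simp only [map_zero, HomogeneousLocalization.val_zero,
        ZeroMemClass.coe_zero, Localization.mk_zero]⟩
    | add z z' hz hz' =>
      obtain ⟨x, hx⟩ := hz
      obtain ⟨x', hx'⟩ := hz'
      exact ⟨x + x', by rw [map_add, map_add, HomogeneousLocalization.val_add, hx, hx',
        Localization.add_mk_self, Submodule.coe_add]⟩
    | tmul t a => exact ⟨t ⊗ₜ Away.mk 𝒜 hs n a.1 a.2, val_awayTensor_tmul 𝒜 S hs t a.2⟩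
  obtain ⟨x, hx⟩ := key
  refine ⟨x, HomogeneousLocalization.val_injective _ (hx.trans ?_)⟩
  rw [Away.val_mk, hz]
  rfl

lemma isPushout_away {i : ℕ} {s : A} (hs : s ∈ 𝒜 i) :
    IsPushout (CommRingCat.ofHom (algebraMap ℂ S))
      (CommRingCat.ofHom ((fromZeroRingHom 𝒜 (Submonoid.powers s)).comp (algebraMap ℂ (𝒜 0))))
      (CommRingCat.ofHom (awayInl 𝒜 S s)) (CommRingCat.ofHom (Away.map (incl 𝒜 S) s)) := by
  let := awayAlgebra 𝒜 s
  let e : S ⊗[ℂ] Away 𝒜 s ≃+* Away (grading 𝒜 S) (incl 𝒜 S s) :=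
    RingEquiv.ofBijective (awayTensor 𝒜 S s)
      ⟨awayTensor_injective 𝒜 S hs, awayTensor_surjective 𝒜 S hs⟩
  refine (CommRingCat.isPushout_tensorProduct ℂ S (Away 𝒜 s)).of_iso (Iso.refl _) (Iso.refl _)
    (Iso.refl _) e.toCommRingCatIso ?_ ?_ ?_ ?_
  · exact (Category.comp_id _).trans (Category.id_comp _).symm
  · exact (Category.comp_id _).trans (Category.id_comp _).symm
  · refine CommRingCat.hom_ext (RingHom.ext fun t => ?_)
    refine (awayTensor_tmul 𝒜 S s t 1).trans ?_
    rw [map_one, mul_one]; rfl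
  · refine CommRingCat.hom_ext (RingHom.ext fun z => ?_)
    refine (awayTensor_tmul 𝒜 S s 1 z).trans ?_
    rw [map_one, one_mul]; rfl

end Chart

/-- The projection `Proj (S ⊗ A) → Spec S`. -/
def toSpec : Proj (grading 𝒜 S) ⟶ Spec (CommRingCat.of S) :=
  Proj.toSpecZero (grading 𝒜 S) ≫
    Spec.map (CommRingCat.ofHom (algebraMap S (grading 𝒜 S 0)))

/-- The projection `Proj (S ⊗ A) → Proj A`. -/
def proj : Proj (grading 𝒜 S) ⟶ Proj 𝒜 := Proj.map (incl 𝒜 S) (irrelevant_le_map_incl 𝒜 S)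

/-- The basic open set of `1 ⊗ s` is the preimage of the basic open set of `s`. -/
lemma isPullback_awayι {i : ℕ} (hi : 0 < i) {s : A} (hs : s ∈ 𝒜 i) :
    IsPullback (Spec.map (CommRingCat.ofHom (Away.map (incl 𝒜 S) s)))
      (Proj.awayι (grading 𝒜 S) (incl 𝒜 S s) ((incl 𝒜 S).2 hs) hi)
      (Proj.awayι 𝒜 s hs hi) (proj 𝒜 S) := by
  refine IsOpenImmersion.isPullback _ _ _ _ (Proj.awayι_comp_map _ _ hi _ hs) ?_
  rw [Proj.opensRange_awayι, Proj.opensRange_awayι]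
  rfl

lemma awayι_toSpec {i : ℕ} (hi : 0 < i) {s : A} (hs : s ∈ 𝒜 i) :
    Proj.awayι (grading 𝒜 S) (incl 𝒜 S s) ((incl 𝒜 S).2 hs) hi ≫ toSpec 𝒜 S =
      Spec.map (CommRingCat.ofHom (awayInl 𝒜 S s)) := by
  rw [toSpec, Proj.awayι_toSpecZero_assoc, ← Spec.map_comp]
  rfl

lemma awayι_projToSpec {i : ℕ} (hi : 0 < i) {s : A} (hs : s ∈ 𝒜 i) :
    Proj.awayι 𝒜 s hs hi ≫ PluckerGIT.projToSpec 𝒜 =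
      Spec.map (CommRingCat.ofHom ((fromZeroRingHom 𝒜 (Submonoid.powers s)).comp
        (algebraMap ℂ (𝒜 0)))) := by
  rw [PluckerGIT.projToSpec, Proj.awayι_toSpecZero_assoc, ← Spec.map_comp]
  rfl

lemma isPullback_chart {i : ℕ} (hi : 0 < i) {s : A} (hs : s ∈ 𝒜 i) :
    IsPullback (Limits.pullback.snd (proj 𝒜 S) (Proj.awayι 𝒜 s hs hi))
      (Limits.pullback.fst (proj 𝒜 S) (Proj.awayι 𝒜 s hs hi) ≫ toSpec 𝒜 S)
      (Proj.awayι 𝒜 s hs hi ≫ PluckerGIT.projToSpec 𝒜)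
      (Spec.map (CommRingCat.ofHom (algebraMap ℂ S))) := by
  have hc := (isPullback_SpecMap_of_isPushout _ _ _ _ (isPushout_away 𝒜 S hs)).flip
  have hp := (isPullback_awayι 𝒜 S hi hs).flip
  refine IsPullback.of_iso hc hp.isoPullback (Iso.refl _) (Iso.refl _) (Iso.refl _) ?_ ?_ ?_ ?_
  · exact (Category.comp_id _).trans hp.isoPullback_hom_snd.symm
  · refine (Category.comp_id _).trans (Eq.trans ?_ (Category.assoc _ _ _))
    exact (awayι_toSpec 𝒜 S hi hs).symm.trans (congrArg (· ≫ toSpec 𝒜 S) hp.isoPullback_hom_fst.symm)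
  · exact (Category.comp_id _).trans
      ((awayι_projToSpec 𝒜 hi hs).symm.trans (Category.id_comp _).symm)
  · exact (Category.comp_id _).trans (Category.id_comp _).symm

/-- `Proj (S ⊗ A)` is the product of `Spec S` and `Proj A`. Being a pullback is local on `Proj A`,
and over a chart it is the statement that localization commutes with base change. -/
lemma isPullback : IsPullback (proj 𝒜 S) (toSpec 𝒜 S) (PluckerGIT.projToSpec 𝒜)
    (Spec.map (CommRingCat.ofHom (algebraMap ℂ S))) :=
  Scheme.isPullback_of_openCover _ _ _ _ (Proj.affineOpenCover 𝒜).openCover fun j =>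
    isPullback_chart 𝒜 S j.1.2 j.2.2

variable {S} in
/-- Evaluation `S ⊗ A → A` along a complex point of `S`. -/
def eval (ev : S →ₐ[ℂ] ℂ) : grading 𝒜 S →+*ᵍ 𝒜 where
  __ := (Algebra.TensorProduct.lift ((Algebra.ofId ℂ A).comp ev) (AlgHom.id ℂ A)
      (fun _ _ => Commute.all _ _)).toRingHom
  map_mem {i x} h := by
    obtain ⟨z, rfl⟩ := Submodule.toBaseChange_surjective' _ _ h
    clear h
    induction z with
    | zero => rw [map_zero, ZeroMemClass.coe_zero]; exact zero_mem _
    | add x y hx hy => 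
      rw [map_add, Submodule.coe_add]
      change Algebra.TensorProduct.lift ((Algebra.ofId ℂ A).comp ev) (AlgHom.id ℂ A)
        (fun _ _ => Commute.all _ _) _ ∈ _
      rw [map_add]
      exact add_mem hx hy
    | tmul t a =>
      change algebraMap ℂ A (ev t) * a.1 ∈ 𝒜 i
      rw [← Algebra.smul_def]
      exact Submodule.smul_mem _ _ a.2

variable {S}

lemma eval_tmul (ev : S →ₐ[ℂ] ℂ) (t : S) (a : A) : eval 𝒜 ev (t ⊗ₜ a) = ev t • a :=
  (Algebra.smul_def _ _).symm

lemma irrelevant_le_map_eval (ev : S →ₐ[ℂ] ℂ) :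
    HomogeneousIdeal.irrelevant 𝒜 ≤
      (HomogeneousIdeal.irrelevant (grading 𝒜 S)).map (eval 𝒜 ev) := by
  rw [HomogeneousIdeal.irrelevant_le]
  intro i hi a ha
  have : a = eval 𝒜 ev (1 ⊗ₜ a) := by rw [eval_tmul, map_one, one_smul]
  rw [this]
  exact Ideal.mem_map_of_mem (eval 𝒜 ev) (HomogeneousIdeal.mem_irrelevant_of_mem _ hi
    (Submodule.tmul_mem_baseChange_of_mem _ ha))

/-- A coaction of the coordinate ring defines an algebraic action on `Proj`. -/
lemma isAlgebraicAction {G : Type} [Group G] (𝒪 : Subalgebra ℂ (G → ℂ)) (act : G →* End (Proj 𝒜))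
    (f : G → (𝒜 →+*ᵍ 𝒜))
    (hf : ∀ g, HomogeneousIdeal.irrelevant 𝒜 ≤ (HomogeneousIdeal.irrelevant 𝒜).map (f g))
    (hact : ∀ g, act g = Proj.map (f g) (hf g)) (ρ : 𝒜 →+*ᵍ grading 𝒜 𝒪)
    (hρ : HomogeneousIdeal.irrelevant (grading 𝒜 𝒪) ≤ (HomogeneousIdeal.irrelevant 𝒜).map ρ)
    (hc : ∀ z : ℂ, ρ (algebraMap ℂ A z) = algebraMap ℂ 𝒪 z ⊗ₜ 1)
    (hev : ∀ g, (eval 𝒜 (PluckerGIT.evalAt 𝒪 g)).comp ρ = f g) :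
    PluckerGIT.IsAlgebraicAction 𝒪 (PluckerGIT.projToSpec 𝒜) act := by
  have hp : IsPullback (toSpec 𝒜 𝒪) (proj 𝒜 𝒪) (PluckerGIT.groupToSpec 𝒪)
    (PluckerGIT.projToSpec 𝒜) := (isPullback 𝒜 𝒪).flip
  have h1 : Proj.map ρ hρ ≫ PluckerGIT.projToSpec 𝒜 = proj 𝒜 𝒪 ≫ PluckerGIT.projToSpec 𝒜 :=
    (map_toSpec hρ (algebraMap ℂ (𝒜 0)) (algebraMap 𝒪 (grading 𝒜 𝒪 0)) (algebraMap ℂ 𝒪)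
      hc).trans ((Category.assoc _ _ _).symm.trans hp.w)
  refine ⟨hp.isoPullback.inv ≫ Proj.map ρ hρ, ?_, fun g => ?_⟩
  · rw [Category.assoc, h1, hp.isoPullback_inv_snd_assoc]
  -- Under the identification of the product with `Proj (𝒪 ⊗ A)`, the slice `x ↦ (g, x)` is induced
  -- by evaluating coefficients at `g`: both have the same two projections.
  · have h2 : PluckerGIT.slice 𝒪 (PluckerGIT.projToSpec 𝒜) g =
        Proj.map (eval 𝒜 (PluckerGIT.evalAt 𝒪 g)) (irrelevant_le_map_eval 𝒜 _) ≫
          hp.isoPullback.hom := by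
      refine Limits.pullback.hom_ext ?_ ?_
      · rw [Category.assoc, hp.isoPullback_hom_fst, PluckerGIT.slice, Limits.pullback.lift_fst]
        refine (Category.assoc _ _ _).trans (map_toSpec (irrelevant_le_map_eval 𝒜 _)
          (algebraMap 𝒪 (grading 𝒜 𝒪 0)) (algebraMap ℂ (𝒜 0))
          (PluckerGIT.evalAt 𝒪 g).toRingHom fun t => ?_).symm
        refine (eval_tmul 𝒜 (PluckerGIT.evalAt 𝒪 g) t 1).trans ?_
        exact (Algebra.algebraMap_eq_smul_one _).symm
      · rw [Category.assoc, hp.isoPullback_hom_snd, PluckerGIT.slice, Limits.pullback.lift_snd]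
        have h3 : (eval 𝒜 (PluckerGIT.evalAt 𝒪 g)).comp (incl 𝒜 𝒪) = .id 𝒜 :=
          DFunLike.ext _ _ fun a => (eval_tmul 𝒜 (PluckerGIT.evalAt 𝒪 g) 1 a).trans
            (by rw [map_one, one_smul]; rfl)
        exact (map_comp_eq_id (irrelevant_le_map_incl 𝒜 𝒪) (irrelevant_le_map_eval 𝒜 _) h3).symm
    rw [h2, Category.assoc, Iso.hom_inv_id_assoc, hact]
    refine (Proj.map_comp _ _ hρ (irrelevant_le_map_eval 𝒜 _)).symm.trans ?_
    congr 1
    exact hev g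

end ProjBaseChange

/-! ### Coactions from families of graded automorphisms -/

namespace ProjBaseChange

open TensorProduct

section Joint

variable {G : Type} (𝒪 : Subalgebra ℂ (G → ℂ)) {M : Type} [AddCommGroup M] [Module ℂ M]

/-- Evaluation of the coefficients at `g`. -/
def evalLin (g : G) : 𝒪 ⊗[ℂ] M →ₗ[ℂ] M :=
  TensorProduct.lift ((LinearMap.lsmul ℂ M).comp (PluckerGIT.evalAt 𝒪 g).toLinearMap)

lemma evalLin_tmul (g : G) (t : 𝒪) (m : M) : evalLin 𝒪 g (t ⊗ₜ m) = t.1 g • m := rfl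

/-- In a basis of `M` the coefficients of `x` are functions on `G`, and they vanish at every point.
Identities in `𝒪 ⊗ M` can therefore be checked pointwise. -/
lemma eq_zero_of_evalLin {x : 𝒪 ⊗[ℂ] M} (h : ∀ g, evalLin 𝒪 g x = 0) : x = 0 := by
  let β := Module.Basis.ofVectorSpace ℂ M
  obtain ⟨b, rfl⟩ := TensorProduct.eq_repr_basis_right β x
  suffices b = 0 by rw [this, Finsupp.sum_zero_index]
  have h2 (g : G) := h g
  simp only [Finsupp.sum, map_sum, evalLin_tmul] at h2
  ext j g
  by_cases hj : j ∈ b.support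
  · exact linearIndependent_iff'.1 β.linearIndependent b.support (fun j => (b j).1 g) (h2 g) j hj
  · rw [Finsupp.notMem_support_iff.1 hj]; rfl

lemma ext_evalLin {x y : 𝒪 ⊗[ℂ] M} (h : ∀ g, evalLin 𝒪 g x = evalLin 𝒪 g y) : x = y :=
  letI : AddCommGroup (𝒪 ⊗[ℂ] M) := TensorProduct.addCommGroup
  sub_eq_zero.1 (eq_zero_of_evalLin 𝒪 fun g => by rw [map_sub, h, sub_self])

lemma evalLin_lTensor {N : Type} [AddCommGroup N] [Module ℂ N] (p : M →ₗ[ℂ] N) (g : G)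
    (x : 𝒪 ⊗[ℂ] M) : evalLin 𝒪 g (p.lTensor 𝒪 x) = p (evalLin 𝒪 g x) := by
  induction x with
  | zero => simp
  | add x y hx hy => simp only [map_add, hx, hy]
  | tmul t m => rw [LinearMap.lTensor_tmul, evalLin_tmul, evalLin_tmul, map_smul]

lemma evalLin_mul {A : Type} [CommRing A] [Algebra ℂ A] (g : G) (x y : 𝒪 ⊗[ℂ] A) :
    evalLin 𝒪 g (x * y) = evalLin 𝒪 g x * evalLin 𝒪 g y := by
  induction x with
  | zero => simp only [map_zero, zero_mul]
  | add x x' hx hx' => simp only [map_add, add_mul, hx, hx']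
  | tmul t a =>
    induction y with
    | zero => simp only [map_zero, mul_zero]
    | add x x' hx hx' => simp only [map_add, mul_add, hx, hx']
    | tmul u b =>
      rw [Algebra.TensorProduct.tmul_mul_tmul, evalLin_tmul, evalLin_tmul, evalLin_tmul,
        smul_mul_smul_comm]
      rfl

lemma exists_evalLin_of_X {σ : Type} {A : Type} [CommRing A] [Algebra ℂ A]
    (φ : G → MvPolynomial σ ℂ →ₐ[ℂ] A)
    (h : ∀ p, ∃ x : 𝒪 ⊗[ℂ] A, ∀ g, evalLin 𝒪 g x = φ g (MvPolynomial.X p))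
    (b : MvPolynomial σ ℂ) : ∃ x : 𝒪 ⊗[ℂ] A, ∀ g, evalLin 𝒪 g x = φ g b := by
  induction b using MvPolynomial.induction_on with
  | C z =>
    refine ⟨1 ⊗ₜ algebraMap ℂ A z, fun g => ?_⟩
    rw [evalLin_tmul, MvPolynomial.algHom_C]
    exact one_smul ℂ _
  | add b b' hb hb' =>
    obtain ⟨x, hx⟩ := hb
    obtain ⟨x', hx'⟩ := hb'
    exact ⟨x + x', fun g => by rw [map_add, map_add, hx, hx']⟩
  | mul_X b p hb =>
    obtain ⟨x, hx⟩ := hb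
    obtain ⟨x', hx'⟩ := h p
    exact ⟨x * x', fun g => by rw [evalLin_mul, map_mul, hx, hx']⟩

end Joint

variable {A : Type} [CommRing A] [Algebra ℂ A] (𝒜 : ℕ → Submodule ℂ A) [GradedAlgebra 𝒜]
  {G : Type} (𝒪 : Subalgebra ℂ (G → ℂ))

lemma eval_eq_evalLin (g : G) (x : 𝒪 ⊗[ℂ] A) :
    eval 𝒜 (PluckerGIT.evalAt 𝒪 g) x = evalLin 𝒪 g x := by
  induction x with
  | zero => rw [map_zero, map_zero]
  | add x y hx hy => rw [map_add, map_add, hx, hy]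
  | tmul t m => exact eval_tmul 𝒜 (PluckerGIT.evalAt 𝒪 g) t m

/-- A linear retraction `p` of `A` onto `𝒜 i` fixes every value of `x`, hence fixes `x` itself,
which puts `x` in the image of `𝒪 ⊗ 𝒜 i`. -/
lemma mem_grading_of_evalLin {i : ℕ} {x : 𝒪 ⊗[ℂ] A} (h : ∀ g, evalLin 𝒪 g x ∈ 𝒜 i) :
    x ∈ grading 𝒜 𝒪 i := by
  obtain ⟨p, hp⟩ := (𝒜 i).subtype.exists_leftInverse_of_injective (Submodule.ker_subtype _)
  have h1 : x = ((𝒜 i).subtype.comp p).lTensor 𝒪 x := by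
    refine ext_evalLin 𝒪 fun g => ?_
    rw [evalLin_lTensor]
    exact congrArg Subtype.val (LinearMap.congr_fun hp ⟨_, h g⟩).symm
  rw [h1, LinearMap.lTensor_comp]
  generalize (LinearMap.lTensor 𝒪 p) = q
  change (LinearMap.lTensor 𝒪 (𝒜 i).subtype) (q x) ∈ _
  generalize q x = y
  induction y with
  | zero => rw [map_zero]; exact zero_mem _
  | add y z hy hz => rw [map_add]; exact add_mem hy hz
  | tmul t a => exact Submodule.tmul_mem_baseChange_of_mem _ a.2

variable {𝒜} in
/-- The coaction defined by functions on `G × X`. -/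
def coaction (f : G → (𝒜 →+*ᵍ 𝒜)) (hx : ∀ a, ∃ x : 𝒪 ⊗[ℂ] A, ∀ g, evalLin 𝒪 g x = f g a) :
    𝒜 →+*ᵍ grading 𝒜 𝒪 where
  toFun a := (hx a).choose
  map_one' := ext_evalLin 𝒪 fun g => by
    rw [(hx 1).choose_spec, map_one, ← eval_eq_evalLin 𝒜, map_one]
  map_mul' a b := ext_evalLin 𝒪 fun g => by
    rw [evalLin_mul, (hx _).choose_spec, (hx _).choose_spec, (hx _).choose_spec, map_mul]
  map_zero' := ext_evalLin 𝒪 fun g => by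
    rw [(hx _).choose_spec, map_zero, map_zero]
  map_add' a b := ext_evalLin 𝒪 fun g => by
    rw [map_add, (hx _).choose_spec, (hx _).choose_spec, (hx _).choose_spec, map_add]
  map_mem {i a} ha := mem_grading_of_evalLin 𝒜 𝒪 fun g => by
    have h := (hx a).choose_spec g
    exact h.symm ▸ (f g).map_mem ha

variable {f : G → (𝒜 →+*ᵍ 𝒜)} (hx : ∀ a, ∃ x : 𝒪 ⊗[ℂ] A, ∀ g, evalLin 𝒪 g x = f g a)

lemma evalLin_coaction (g : G) (a : A) : evalLin 𝒪 g (coaction 𝒪 f hx a) = f g a :=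
  (hx a).choose_spec g

/-- If the regular functions are stable under `g ↦ g⁻¹`, a coaction pulls no relevant prime back to
an irrelevant one. -/
lemma irrelevant_le_map_coaction [Group G] (hinv : ∀ t ∈ 𝒪, (fun g => t g⁻¹) ∈ 𝒪)
    (hlin : ∀ g (z : ℂ) a, f g (z • a) = z • f g a) (hone : ∀ a, f 1 a = a)
    (hmul : ∀ g h a, f (g * h) a = f h (f g a)) :
    HomogeneousIdeal.irrelevant (grading 𝒜 𝒪) ≤
      (HomogeneousIdeal.irrelevant 𝒜).map (coaction 𝒪 f hx) := by
  refine irrelevant_le_map 𝒜 𝒪 _ fun i hi a ha => ?_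
  -- Apply the coaction to the second factor of `z` and inversion to the first. For `z` equal to the
  -- coaction of `a`, the resulting `y` has value `f g (f g⁻¹ a) = a` at every `g`, so `1 ⊗ a = y`
  -- lies in the ideal.
  have key (z : 𝒪 ⊗[ℂ] 𝒜 i) : ∃ y ∈ ((HomogeneousIdeal.irrelevant 𝒜).map (coaction 𝒪 f hx)).toIdeal,
      ∀ g, evalLin 𝒪 g y = f g (evalLin 𝒪 g⁻¹ ((𝒜 i).subtype.lTensor 𝒪 z)) := by
    induction z with
    | zero => exact ⟨0, Ideal.zero_mem _, fun g => by simp only [map_zero]⟩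
    | add z z' hz hz' =>
      obtain ⟨y, hy, h⟩ := hz
      obtain ⟨y', hy', h'⟩ := hz'
      exact ⟨y + y', Ideal.add_mem _ hy hy', fun g => by simp only [map_add, h, h']⟩
    | tmul t b =>
      refine ⟨(⟨_, hinv t t.2⟩ ⊗ₜ 1) * coaction 𝒪 f hx b.1, Ideal.mul_mem_left _ _ ?_, fun g => ?_⟩
      · exact Ideal.mem_map_of_mem (coaction 𝒪 f hx)
          (HomogeneousIdeal.mem_irrelevant_of_mem 𝒜 hi b.2)
      · rw [evalLin_mul, evalLin_coaction, evalLin_tmul, LinearMap.lTensor_tmul, evalLin_tmul,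
          hlin, smul_mul_assoc, one_mul]
        rfl
  obtain ⟨z, hz⟩ := Submodule.toBaseChange_surjective' _ _ ((coaction 𝒪 f hx).map_mem ha)
  obtain ⟨y, hy, h⟩ := key z
  have hz' : (𝒜 i).subtype.lTensor 𝒪 z = coaction 𝒪 f hx a := hz
  rw [hz'] at h
  suffices 1 ⊗ₜ a = y by rw [this]; exact hy
  refine ext_evalLin 𝒪 fun g => ?_
  rw [h, evalLin_coaction, ← hmul, inv_mul_cancel, hone, evalLin_tmul]
  exact one_smul ℂ a

lemma isAlgebraicAction_of_forall_exists [Group G]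
    (hx : ∀ a, ∃ x : 𝒪 ⊗[ℂ] A, ∀ g, evalLin 𝒪 g x = f g a) (act : G →* End (Proj 𝒜))
    (hf : ∀ g, HomogeneousIdeal.irrelevant 𝒜 ≤ (HomogeneousIdeal.irrelevant 𝒜).map (f g))
    (hact : ∀ g, act g = Proj.map (f g) (hf g))
    (hinv : ∀ t ∈ 𝒪, (fun g => t g⁻¹) ∈ 𝒪)
    (hlin : ∀ g (z : ℂ) a, f g (z • a) = z • f g a) (hone : ∀ a, f 1 a = a)
    (hmul : ∀ g h a, f (g * h) a = f h (f g a)) :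
    PluckerGIT.IsAlgebraicAction 𝒪 (PluckerGIT.projToSpec 𝒜) act := by
  refine isAlgebraicAction 𝒜 𝒪 act f hf hact (coaction 𝒪 f hx)
    (irrelevant_le_map_coaction 𝒜 𝒪 hx hinv hlin hone hmul) (fun z => ?_) fun g => ?_
  · refine ext_evalLin 𝒪 fun g => ?_
    rw [evalLin_coaction, evalLin_tmul, Algebra.algebraMap_eq_smul_one, hlin, map_one]
    rfl
  · refine DFunLike.ext _ _ fun a => ?_
    exact (eval_eq_evalLin 𝒜 𝒪 g _).trans (evalLin_coaction 𝒜 𝒪 hx g a)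

end ProjBaseChange

/-! ### Algebraicity of the action of `H` -/

namespace PluckerGIT

open MvPolynomial TensorProduct

variable {s n : ℕ}

lemma fst_mem_leviCoord (i j : Fin s) :
    (fun h : LeviSS s n => h.1.1 i j) ∈ leviCoord s n :=
  Algebra.subset_adjoin (Or.inl ⟨(i, j), rfl⟩)

lemma snd_mem_leviCoord (i j : Fin (n - s)) :
    (fun h : LeviSS s n => h.2.1 i j) ∈ leviCoord s n :=
  Algebra.subset_adjoin (Or.inr ⟨(i, j), rfl⟩)

/-- Form the adjugate over the ring `𝒪` and evaluate. For determinant one the adjugate is the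
inverse, so this makes inversion on `H` regular. -/
lemma adjugate_mem {G m : Type} [Fintype m] [DecidableEq m] (𝒪 : Subalgebra ℂ (G → ℂ)) (M : G → Matrix m m ℂ)
    (h : ∀ i j, (fun g => M g i j) ∈ 𝒪) (i j : m) : (fun g => (M g).adjugate i j) ∈ 𝒪 := by
  let H : Matrix m m 𝒪 := Matrix.of fun i j => ⟨_, h i j⟩
  have : (fun g => (M g).adjugate i j) = (H.adjugate i j : 𝒪).1 := by
    funext g
    have h1 := congrFun (congrFun (RingHom.map_adjugate (evalAt 𝒪 g).toRingHom H) i) j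
    exact h1.symm
  rw [this]
  exact (H.adjugate i j).2

lemma inv_mem_leviCoord : ∀ t ∈ leviCoord s n, (fun h => t h⁻¹) ∈ leviCoord s n := by
  intro t ht
  let inv : (LeviSS s n → ℂ) →ₐ[ℂ] (LeviSS s n → ℂ) :=
    AlgHom.pi fun h => Pi.evalAlgHom ℂ _ h⁻¹
  have : leviCoord s n ≤ (leviCoord s n).comap inv := by
    refine Algebra.adjoin_le ?_
    rintro _ (⟨ij, rfl⟩ | ⟨ij, rfl⟩)
    · change (fun h : LeviSS s n => (h⁻¹).1.1 ij.1 ij.2) ∈ leviCoord s n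
      simp only [Prod.fst_inv, Matrix.SpecialLinearGroup.coe_inv]
      exact adjugate_mem _ _ fst_mem_leviCoord _ _
    · change (fun h : LeviSS s n => (h⁻¹).2.1 ij.1 ij.2) ∈ leviCoord s n
      simp only [Prod.snd_inv, Matrix.SpecialLinearGroup.coe_inv]
      exact adjugate_mem _ _ snd_mem_leviCoord _ _
  exact this ht

lemma leviMatrix_mem_leviCoord (i j : Col s n) :
    (fun h : LeviSS s n => leviMatrix h i j) ∈ leviCoord s n := by
  rcases i with i | i <;> rcases j with j | j
  · exact fst_mem_leviCoord i j
  · exact zero_mem (leviCoord s n)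
  · exact zero_mem (leviCoord s n)
  · exact snd_mem_leviCoord i j

lemma exists_evalLin_eq_leviGradedHom (r s n : ℕ) (a : invariantRing r s n) :
    ∃ x : leviCoord s n ⊗[ℂ] invariantRing r s n, ∀ h,
      ProjBaseChange.evalLin (leviCoord s n) h x = leviGradedHom h a := by
  obtain ⟨x, hx⟩ := ProjBaseChange.exists_evalLin_of_X (leviCoord s n)
    (fun h => (colSubst (leviMatrix h) : MatPoly r s n →ₐ[ℂ] MatPoly r s n)) (fun p => by
      refine ⟨∑ k, (⟨_, leviMatrix_mem_leviCoord p.2 k⟩ : leviCoord s n) ⊗ₜ X (p.1, k), fun h => ?_⟩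
      rw [map_sum, colSubst_X]
      refine Finset.sum_congr rfl fun k _ => ?_
      rw [ProjBaseChange.evalLin_tmul, smul_eq_C_mul]) a.1
  -- The element found above has coefficients in all polynomials; a linear retraction onto the
  -- invariants moves it to the right module without changing its values, which are invariant
  -- already.
  obtain ⟨p, hp⟩ := (Subalgebra.toSubmodule (invariantRing r s n)).subtype.exists_leftInverse_of_injective
    (Submodule.ker_subtype _)
  refine ⟨p.lTensor _ x, fun h => ?_⟩
  refine (ProjBaseChange.evalLin_lTensor _ p h _).trans ?_
  rw [hx]
  exact LinearMap.congr_fun hp (leviGradedHom h a)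

lemma isAlgebraicAction_leviAct (r s n : ℕ) [NeZero r] :
    IsAlgebraicAction (leviCoord s n) (quotientToSpec r s n) (leviAct r s n) :=
  ProjBaseChange.isAlgebraicAction_of_forall_exists _ _ (exists_evalLin_eq_leviGradedHom r s n) _
    (irrelevant_le_map_leviGradedHom r s n) (fun _ => rfl) inv_mem_leviCoord
    (fun h z a => Subtype.ext (map_smul (colSubst (leviMatrix h)) z a.1))
    (fun a => DFunLike.congr_fun leviGradedHom_one a)
    (fun g h a => DFunLike.congr_fun (leviGradedHom_comp g h) a)

end PluckerGIT

/-! ### Weights of Plücker coordinates and the span of the invariants -/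

namespace PluckerGIT

open MvPolynomial

variable (n : ℕ)

/-- The Plücker coordinate `p₁₂`. -/
def topP : MatPoly 2 2 n := plucker ![.inl 0, .inl 1]

variable {n}

/-- The Plücker coordinates with one index in `{1, 2}`. -/
def mixP (i : Fin 2) (l : Fin (n - 2)) : MatPoly 2 2 n := plucker ![.inl i, .inr l]

/-- The Plücker coordinates with no index in `{1, 2}`. -/
def botP (j k : Fin (n - 2)) : MatPoly 2 2 n := plucker ![.inr j, .inr k]

lemma plucker_two (c d : Col 2 n) :
    (plucker ![c, d] : MatPoly 2 2 n) = X (0, c) * X (1, d) - X (0, d) * X (1, c) := by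
  rw [plucker, Matrix.det_fin_two]
  rfl

/-- The Plücker relation that trades `p₁₂` against mixed coordinates. -/
lemma topP_mul_botP (j k : Fin (n - 2)) :
    topP n * botP j k = mixP 0 j * mixP 1 k - mixP 0 k * mixP 1 j := by
  simp only [topP, botP, mixP, plucker_two]
  ring

variable (n)

/-- The span of `p₁₂`. -/
def topSpan : Submodule ℂ (MatPoly 2 2 n) := Submodule.span ℂ {topP n}

/-- The span of the mixed Plücker coordinates. -/
def mixSpan : Submodule ℂ (MatPoly 2 2 n) :=
  Submodule.span ℂ (Set.range fun p : Fin 2 × Fin (n - 2) => mixP p.1 p.2)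

/-- The span of the Plücker coordinates with no index in `{1, 2}`. -/
def botSpan : Submodule ℂ (MatPoly 2 2 n) :=
  Submodule.span ℂ (Set.range fun p : Fin (n - 2) × Fin (n - 2) => botP p.1 p.2)

variable {n}

lemma mixP_mem (i : Fin 2) (l : Fin (n - 2)) : mixP i l ∈ mixSpan n :=
  Submodule.subset_span ⟨(i, l), rfl⟩

lemma botP_mem (j k : Fin (n - 2)) : botP j k ∈ botSpan n :=
  Submodule.subset_span ⟨(j, k), rfl⟩

lemma topP_mem : topP n ∈ topSpan n := Submodule.subset_span rfl

lemma topSpan_mul_botSpan_le : topSpan n * botSpan n ≤ mixSpan n ^ 2 := by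
  rw [topSpan, botSpan, Submodule.span_mul_span, Submodule.span_le]
  rintro _ ⟨_, rfl, _, ⟨p, rfl⟩, rfl⟩
  change topP n * botP p.1 p.2 ∈ _
  rw [topP_mul_botP, pow_two]
  exact sub_mem (Submodule.mul_mem_mul (mixP_mem _ _) (mixP_mem _ _))
    (Submodule.mul_mem_mul (mixP_mem _ _) (mixP_mem _ _))

lemma plucker_mem_span (f : Fin 2 → Col 2 n) :
    (plucker f : MatPoly 2 2 n) ∈ topSpan n ∨ plucker f ∈ mixSpan n ∨ plucker f ∈ botSpan n := by
  have hf : f = ![f 0, f 1] := by ext i; fin_cases i <;> rfl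
  rw [hf]
  have hswap (c d : Col 2 n) : (plucker ![c, d] : MatPoly 2 2 n) = - plucker ![d, c] := by
    rw [plucker_two, plucker_two]; ring
  have hself (c : Col 2 n) : (plucker ![c, c] : MatPoly 2 2 n) = 0 := by
    rw [plucker_two]; ring
  rcases f 0 with i | i <;> rcases f 1 with j | j
  · left
    fin_cases i <;> fin_cases j
    · exact (hself _).symm ▸ zero_mem _
    · exact topP_mem
    · exact (hswap _ _).symm ▸ neg_mem topP_mem
    · exact (hself _).symm ▸ zero_mem _
  · exact Or.inr (Or.inl (mixP_mem i j))
  · exact Or.inr (Or.inl ((hswap _ _).symm ▸ neg_mem (mixP_mem j i)))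
  · exact Or.inr (Or.inr (botP_mem i j))

lemma mem_pluckerRing_induction {V : Submodule ℂ (MatPoly 2 2 n)}
    (h : ∀ a b c, topSpan n ^ a * mixSpan n ^ b * botSpan n ^ c ≤ V) {f : MatPoly 2 2 n}
    (hf : f ∈ pluckerRing 2 2 n) : f ∈ V := by
  rw [pluckerRing, ← Subalgebra.mem_toSubmodule, Algebra.adjoin_eq_span] at hf
  refine Submodule.span_le.2 ?_ hf
  intro x hx
  suffices ∃ a b c, x ∈ topSpan n ^ a * mixSpan n ^ b * botSpan n ^ c by
    obtain ⟨a, b, c, hx⟩ := this; exact h a b c hx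
  induction hx using Submonoid.closure_induction with
  | mem x hx =>
    obtain ⟨f, rfl⟩ := hx
    rcases plucker_mem_span f with h | h | h
    · exact ⟨1, 0, 0, by simpa using h⟩
    · exact ⟨0, 1, 0, by simpa using h⟩
    · exact ⟨0, 0, 1, by simpa using h⟩
  | one => exact ⟨0, 0, 0, by simp [Submodule.one_le.1 le_rfl]⟩
  | mul x y _ _ hx hy =>
    obtain ⟨a, b, c, hx⟩ := hx
    obtain ⟨a', b', c', hy⟩ := hy
    refine ⟨a + a', b + b', c + c', ?_⟩
    have := Submodule.mul_mem_mul hx hy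
    rwa [mul_mul_mul_comm, mul_mul_mul_comm (topSpan n ^ a), ← pow_add, ← pow_add, ← pow_add] at this

/-- The weights that count variables in the first two columns. -/
def topWeight (p : Fin 2 × Col 2 n) : ℕ := Sum.elim (fun _ => 1) (fun _ => 0) p.2

lemma pow_le_homogeneous {V : Submodule ℂ (MatPoly 2 2 n)} {w : Fin 2 × Col 2 n → ℕ} {d : ℕ}
    (h : V ≤ weightedHomogeneousSubmodule ℂ w d) (a : ℕ) :
    V ^ a ≤ weightedHomogeneousSubmodule ℂ w (d * a) := by
  induction a with
  | zero =>
    rw [pow_zero, Submodule.one_le]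
    exact isWeightedHomogeneous_one _ _
  | succ a ih =>
    rw [pow_succ, mul_add, mul_one]
    exact (mul_le_mul' ih h).trans (weightedHomogeneousSubmodule_mul _ _ _)

lemma isWeightedHomogeneous_plucker_two (w : Fin 2 × Col 2 n → ℕ) (c d : Col 2 n) {e : ℕ}
    (h : w (0, c) + w (1, d) = e) (h' : w (0, d) + w (1, c) = e) :
    IsWeightedHomogeneous w (plucker ![c, d] : MatPoly 2 2 n) e := by
  rw [plucker_two]
  have h1 := (isWeightedHomogeneous_X ℂ w (0, c)).mul (isWeightedHomogeneous_X ℂ w (1, d))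
  have h2 := (isWeightedHomogeneous_X ℂ w (0, d)).mul (isWeightedHomogeneous_X ℂ w (1, c))
  rw [h] at h1
  rw [h'] at h2
  exact (weightedHomogeneousSubmodule ℂ w e).sub_mem h1 h2

/-- The weight is left general because two are needed: `topWeight` and the total degree. -/
lemma span_le_weightedHomogeneous {w : Fin 2 × Col 2 n → ℕ} {a b c : ℕ}
    (ht : ∀ r r', w (r, .inl 0) + w (r', .inl 1) = a)
    (hm : ∀ r r' i l, w (r, .inl i) + w (r', .inr l) = b)
    (hb : ∀ r r' j k, w (r, .inr j) + w (r', .inr k) = c) (x y z : ℕ) :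
    topSpan n ^ x * mixSpan n ^ y * botSpan n ^ z ≤
      weightedHomogeneousSubmodule ℂ w (a * x + b * y + c * z) := by
  have h1 : topSpan n ≤ weightedHomogeneousSubmodule ℂ w a := by
    rw [topSpan, Submodule.span_le, Set.singleton_subset_iff]
    exact isWeightedHomogeneous_plucker_two w _ _ (ht _ _) ((add_comm _ _).trans (ht _ _))
  have h2 : mixSpan n ≤ weightedHomogeneousSubmodule ℂ w b := by
    rw [mixSpan, Submodule.span_le]
    rintro _ ⟨p, rfl⟩
    exact isWeightedHomogeneous_plucker_two w _ _ (hm _ _ _ _) ((add_comm _ _).trans (hm _ _ _ _))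
  have h3 : botSpan n ≤ weightedHomogeneousSubmodule ℂ w c := by
    rw [botSpan, Submodule.span_le]
    rintro _ ⟨p, rfl⟩
    exact isWeightedHomogeneous_plucker_two w _ _ (hb _ _ _ _) (hb _ _ _ _)
  exact (mul_le_mul' ((mul_le_mul' (pow_le_homogeneous h1 x) (pow_le_homogeneous h2 y)).trans
    (weightedHomogeneousSubmodule_mul _ _ _)) (pow_le_homogeneous h3 z)).trans
    (weightedHomogeneousSubmodule_mul _ _ _)

lemma span_le_topWeight (a b c : ℕ) :
    topSpan n ^ a * mixSpan n ^ b * botSpan n ^ c ≤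
      weightedHomogeneousSubmodule ℂ topWeight (2 * a + b) := by
  have := span_le_weightedHomogeneous (n := n) (w := topWeight) (a := 2) (b := 1) (c := 0)
    (fun _ _ => rfl) (fun _ _ _ _ => rfl) (fun _ _ _ _ => rfl) a b c
  rwa [one_mul, zero_mul, add_zero] at this

lemma span_le_homogeneous (a b c : ℕ) :
    topSpan n ^ a * mixSpan n ^ b * botSpan n ^ c ≤
      homogeneousSubmodule (Fin 2 × Col 2 n) ℂ (2 * (a + b + c)) := by
  have := span_le_weightedHomogeneous (n := n) (w := 1) (a := 2) (b := 2) (c := 2)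
    (fun _ _ => rfl) (fun _ _ _ _ => rfl) (fun _ _ _ _ => rfl) a b c
  rwa [← mul_add, ← mul_add] at this

lemma colSubst_diagonal_monomial (v : Col 2 n → ℂ) (e : Fin 2 × Col 2 n →₀ ℕ) (z : ℂ) :
    colSubst (Matrix.diagonal v) (monomial e z : MatPoly 2 2 n) =
      monomial e ((e.prod fun p i => v p.2 ^ i) * z) := by
  have h (p : Fin 2 × Col 2 n) : colSubst (Matrix.diagonal v) (X p : MatPoly 2 2 n) = C (v p.2) * X p := by
    rw [colSubst, aeval_X, Finset.sum_eq_single p.2]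
    · rw [Matrix.diagonal_apply_eq]
    · intro k _ hk
      rw [Matrix.diagonal_apply_ne _ hk.symm, C_0, zero_mul]
    · intro h; exact absurd (Finset.mem_univ _) h
  rw [monomial_eq, map_mul, algHom_C, algebraMap_eq, Finsupp.prod, map_prod, monomial_eq, C_mul,
    mul_comm (C _) (C z), mul_assoc]
  congr 1
  rw [Finsupp.prod, Finsupp.prod, map_prod, ← Finset.prod_mul_distrib]
  refine Finset.prod_congr rfl fun p _ => ?_
  rw [map_pow, h, mul_pow, C_pow]

lemma coeff_colSubst_diagonal (v : Col 2 n → ℂ) (f : MatPoly 2 2 n) (e : Fin 2 × Col 2 n →₀ ℕ) :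
    coeff e (colSubst (Matrix.diagonal v) f) = (e.prod fun p i => v p.2 ^ i) * coeff e f := by
  induction f using MvPolynomial.induction_on' with
  | monomial e' z =>
    rw [colSubst_diagonal_monomial, coeff_monomial, coeff_monomial]
    split_ifs with h
    · rw [h]
    · rw [mul_zero]
  | add f g hf hg => rw [map_add, coeff_add, coeff_add, hf, hg, mul_add]

lemma prod_oneParam (e : Fin 2 × Col 2 n →₀ ℕ) (x y : ℂ) :
    (e.prod fun p i => (Sum.elim (fun _ => x) (fun _ => y) p.2 : ℂ) ^ i) =
      x ^ (Finsupp.weight topWeight e) * y ^ (e.degree - Finsupp.weight topWeight e) := by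
  have h1 : Finsupp.weight topWeight e = ∑ p ∈ e.support, e p * topWeight p := by
    rw [Finsupp.weight_apply]; rfl
  have h2 : e.degree - Finsupp.weight topWeight e = ∑ p ∈ e.support, e p * (1 - topWeight p) := by
    have h3 : ∑ p ∈ e.support, e p * (1 - topWeight p) + ∑ p ∈ e.support, e p * topWeight p =
        e.degree := by
      rw [← Finset.sum_add_distrib, Finsupp.degree]
      refine Finset.sum_congr rfl fun p _ => ?_
      rcases p with ⟨r, i | i⟩ <;> simp [topWeight]
    rw [h1, ← h3, Nat.add_sub_cancel]
  rw [h2, h1, ← Finset.prod_pow_eq_pow_sum, ← Finset.prod_pow_eq_pow_sum, ← Finset.prod_mul_distrib]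
  refine Finset.prod_congr rfl fun p _ => ?_
  rcases p with ⟨r, i | i⟩ <;> simp [topWeight]

lemma topWeight_le_degree (e : Fin 2 × Col 2 n →₀ ℕ) : Finsupp.weight topWeight e ≤ e.degree := by
  rw [Finsupp.weight_apply, Finsupp.degree]
  refine Finset.sum_le_sum fun p _ => ?_
  rcases p with ⟨r, i | i⟩ <;> simp [topWeight]

lemma oneParam_eq (t : ℂˣ) : oneParam 2 n t =
    Matrix.diagonal (Sum.elim (fun _ => (t : ℂ) ^ (n - 2)) (fun _ => (t : ℂ)⁻¹ ^ 2)) := by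
  rw [oneParam]
  congr 1
  ext (i | i) <;> simp

/-- The one-parameter subgroup acts diagonally on monomials, by `t^(n w - 4 k)` on a monomial of
degree `2 k` with `w` variables from the first two columns; invariance forces this exponent to
vanish. -/
lemma weight_of_mem_support (hn : 2 ≤ n) {k : ℕ} {f : MatPoly 2 2 n} (hf : f ∈ invariantRing 2 2 n)
    (hk : f.IsHomogeneous (2 * k)) {e : Fin 2 × Col 2 n →₀ ℕ} (he : coeff e f ≠ 0) :
    n * Finsupp.weight topWeight e = 4 * k := by
  -- The single value `t = 2` suffices, because `2` has infinite order in `ℂˣ`.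
  have h1 := (mem_invariantRing.1 hf).2 (Units.mk0 (2 : ℂ) two_ne_zero)
  have h2 := congrArg (coeff e) h1
  rw [oneParam_eq, coeff_colSubst_diagonal, prod_oneParam] at h2
  have h3 : e.degree = 2 * k := by
    have := hk he
    rwa [Finsupp.degree_eq_weight_one]
  have h4 := mul_right_cancel₀ he (h2.trans (one_mul _).symm)
  have h5 := topWeight_le_degree e
  rw [h3] at h4 h5
  rw [Units.val_mk0, ← pow_mul, ← pow_mul, inv_pow, ← div_eq_mul_inv, div_eq_one_iff_eq (pow_ne_zero _ two_ne_zero)] at h4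
  have h6 : (n - 2) * Finsupp.weight topWeight e = 2 * (2 * k - Finsupp.weight topWeight e) := by
    refine Nat.pow_right_injective (le_refl 2) ?_
    exact_mod_cast h4
  obtain ⟨m, rfl⟩ := Nat.exists_eq_add_of_le hn
  rw [Nat.add_sub_cancel_left] at h6
  rw [add_mul]
  omega

/-- To show that a homogeneous invariant lies in `V`, it suffices to consider the products of Plücker
coordinates that are invariant. -/
lemma mem_of_mem_invariantRing (hn : 2 ≤ n) {k : ℕ} {V : Submodule ℂ (MatPoly 2 2 n)}
    (h : ∀ a b c, a + b + c = k → n * (2 * a + b) = 4 * k →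
      topSpan n ^ a * mixSpan n ^ b * botSpan n ^ c ≤ V)
    {f : MatPoly 2 2 n} (hf : f ∈ invariantRing 2 2 n) (hk : f.IsHomogeneous (2 * k)) : f ∈ V := by
  by_cases hα : ∃ α, n * α = 4 * k
  · obtain ⟨α, hα⟩ := hα
    -- `P` projects onto total degree `2k` and top weight `α`. It fixes `f`, and it sends an element
    -- of a product of spans to itself or to zero, itself only when the exponents satisfy the two
    -- equations of `h`.
    let P : MatPoly 2 2 n →ₗ[ℂ] MatPoly 2 2 n :=
      (weightedHomogeneousComponent topWeight α).comp (homogeneousComponent (2 * k))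
    have h1 : f ∈ V.comap P := by
      refine mem_pluckerRing_induction (fun a b c x hx => ?_) (mem_invariantRing.1 hf).1
      have hx1 : x.IsHomogeneous (2 * (a + b + c)) := span_le_homogeneous a b c hx
      have hx2 : IsWeightedHomogeneous topWeight x (2 * a + b) := span_le_topWeight a b c hx
      change weightedHomogeneousComponent topWeight α (homogeneousComponent (2 * k) x) ∈ V
      rw [homogeneousComponent_of_mem hx1]
      split_ifs with hd
      · by_cases hd2 : 2 * a + b = α
        · subst hd2
          have hx3 : weightedHomogeneousComponent topWeight (2 * a + b) x = x :=
            IsWeightedHomogeneous.weightedHomogeneousComponent_same hx2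
          rw [hx3]
          exact h a b c (Nat.eq_of_mul_eq_mul_left two_pos hd.symm) hα hx
        · have hx3 : weightedHomogeneousComponent topWeight α x = 0 :=
            IsWeightedHomogeneous.weightedHomogeneousComponent_ne _ hx2 (Ne.symm hd2)
          rw [hx3]
          exact zero_mem _
      · rw [map_zero]; exact zero_mem _
    have h2 : P f = f := by
      change weightedHomogeneousComponent topWeight α (homogeneousComponent (2 * k) f) = f
      rw [homogeneousComponent_of_mem hk, if_pos rfl]
      refine IsWeightedHomogeneous.weightedHomogeneousComponent_same fun e he => ?_
      have := weight_of_mem_support hn hf hk he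
      exact Nat.eq_of_mul_eq_mul_left (by omega) (this.trans hα.symm)
    rw [← h2]
    exact h1
  -- If `4k` is not a multiple of `n`, no monomial has an admissible weight.
  · have : f = 0 := by
      ext e
      by_contra he
      exact hα ⟨_, weight_of_mem_support hn hf hk he⟩
    rw [this]
    exact zero_mem _

/-- Products of Plücker coordinates of the right weight are invariant. -/
lemma span_le_invariantRing (hn : 2 ≤ n) {a b c : ℕ} (h : n * (2 * a + b) = 4 * (a + b + c)) :
    topSpan n ^ a * mixSpan n ^ b * botSpan n ^ c ≤
      Subalgebra.toSubmodule (invariantRing 2 2 n) := by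
  intro f hf
  rw [Subalgebra.mem_toSubmodule, mem_invariantRing]
  constructor
  · have ht : topSpan n ≤ Subalgebra.toSubmodule (pluckerRing 2 2 n) := by
      rw [topSpan, Submodule.span_le, Set.singleton_subset_iff]
      exact Algebra.subset_adjoin ⟨_, rfl⟩
    have hm : mixSpan n ≤ Subalgebra.toSubmodule (pluckerRing 2 2 n) := by
      rw [mixSpan, Submodule.span_le]
      rintro _ ⟨p, rfl⟩
      exact Algebra.subset_adjoin ⟨_, rfl⟩
    have hb : botSpan n ≤ Subalgebra.toSubmodule (pluckerRing 2 2 n) := by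
      rw [botSpan, Submodule.span_le]
      rintro _ ⟨p, rfl⟩
      exact Algebra.subset_adjoin ⟨_, rfl⟩
    have hpow {V : Submodule ℂ (MatPoly 2 2 n)} (hV : V ≤ Subalgebra.toSubmodule (pluckerRing 2 2 n))
        (i : ℕ) : V ^ i ≤ Subalgebra.toSubmodule (pluckerRing 2 2 n) := by
      induction i with
      | zero => rw [pow_zero, Submodule.one_le]; exact one_mem (pluckerRing 2 2 n)
      | succ i ih =>
        rw [pow_succ, Submodule.mul_le]
        exact fun x hx y hy => mul_mem (S := Subalgebra ℂ (MatPoly 2 2 n)) (ih hx) (hV hy)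
    have : topSpan n ^ a * mixSpan n ^ b * botSpan n ^ c ≤ Subalgebra.toSubmodule (pluckerRing 2 2 n) := by
      rw [Submodule.mul_le]
      intro x hx y hy
      refine mul_mem (S := Subalgebra ℂ (MatPoly 2 2 n)) ?_ (hpow hb c hy)
      refine (Submodule.mul_le.2 fun x hx y hy => ?_ : _ ≤ Subalgebra.toSubmodule (pluckerRing 2 2 n)) hx
      exact mul_mem (S := Subalgebra ℂ (MatPoly 2 2 n)) (hpow ht a hx) (hpow hm b hy)
    exact this hf
  · intro t
    ext e
    rw [oneParam_eq, coeff_colSubst_diagonal, prod_oneParam]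
    by_cases he : coeff e f = 0
    · rw [he, mul_zero]
    have h1 : Finsupp.weight topWeight e = 2 * a + b := span_le_topWeight a b c hf he
    have h2 : e.degree = 2 * (a + b + c) := by
      have := span_le_homogeneous a b c hf he
      rwa [Finsupp.degree_eq_weight_one]
    rw [h1, h2, ← pow_mul, ← pow_mul, inv_pow, ← div_eq_mul_inv]
    have h3 : (n - 2) * (2 * a + b) = 2 * (2 * (a + b + c) - (2 * a + b)) := by
      obtain ⟨m, rfl⟩ := Nat.exists_eq_add_of_le hn
      rw [Nat.add_sub_cancel_left]
      rw [add_mul] at h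
      omega
    rw [h3, div_self (pow_ne_zero _ t.ne_zero), one_mul]

/-- In degree `n m` the weight equation reads `2a + b = 4m`, whence `c = a + (n - 4) m`. Every
factor `p₁₂` can thus be paired with some `p_{jk}` and replaced by two mixed coordinates. -/
lemma mem_span_of_mem_invGrading (hn : 4 ≤ n) {m : ℕ} {f : MatPoly 2 2 n}
    (hf : f ∈ invariantRing 2 2 n) (hk : f.IsHomogeneous (2 * (n * m))) :
    f ∈ (mixSpan n ^ 4 * botSpan n ^ (n - 4)) ^ m := by
  refine mem_of_mem_invariantRing (by omega) (fun a b c h1 h2 => ?_) hf hk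
  obtain ⟨l, rfl⟩ := Nat.exists_eq_add_of_le hn
  have h3 : 2 * a + b = 4 * m :=
    Nat.eq_of_mul_eq_mul_left (by omega : 0 < 4 + l) (h2.trans (by ring))
  have h4 : c = a + l * m := by
    rw [add_mul] at h1; omega
  rw [h4, pow_add, Nat.add_sub_cancel_left, mul_pow, ← pow_mul, ← pow_mul, ← mul_assoc]
  refine mul_le_mul' ?_ le_rfl
  calc topSpan (4 + l) ^ a * mixSpan (4 + l) ^ b * botSpan (4 + l) ^ a
      = (topSpan (4 + l) * botSpan (4 + l)) ^ a * mixSpan (4 + l) ^ b := by rw [mul_pow]; ring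
    _ ≤ (mixSpan (4 + l) ^ 2) ^ a * mixSpan (4 + l) ^ b :=
        mul_le_mul' (pow_le_pow_left' topSpan_mul_botSpan_le a) le_rfl
    _ = mixSpan (4 + l) ^ (4 * m) := by rw [← pow_mul, ← pow_add, h3]

/-- For `n = 4` the weights give `c = a` in every degree, so all factors other than the mixed ones
cancel in pairs. -/
lemma mem_mixSpan_pow {m : ℕ} {f : MatPoly 2 2 4} (hf : f ∈ invariantRing 2 2 4)
    (hk : f.IsHomogeneous (2 * m)) : f ∈ mixSpan 4 ^ m := by
  refine mem_of_mem_invariantRing (by omega) (fun a b c h1 h2 => ?_) hf hk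
  have h3 : c = a := by omega
  have h4 : m = 2 * a + b := by omega
  rw [h3, h4]
  calc topSpan 4 ^ a * mixSpan 4 ^ b * botSpan 4 ^ a
      = (topSpan 4 * botSpan 4) ^ a * mixSpan 4 ^ b := by rw [mul_pow]; ring
    _ ≤ (mixSpan 4 ^ 2) ^ a * mixSpan 4 ^ b :=
        mul_le_mul' (pow_le_pow_left' topSpan_mul_botSpan_le a) le_rfl
    _ = mixSpan 4 ^ (2 * a + b) := by rw [← pow_mul, ← pow_add]

lemma botSpan_three : botSpan 3 = ⊥ := by
  rw [botSpan, Submodule.span_eq_bot]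
  rintro _ ⟨p, rfl⟩
  have : p.1 = p.2 := Subsingleton.elim (α := Fin 1) _ _
  simp only [botP, plucker_two, this]
  ring

/-- With one column left there is no nonzero `p_{jk}`, so `c = 0` and `b = 2a`. Keeping `V`
arbitrary makes the lemma also yield `f = 0`, through `V = ⊥`, when `3` does not divide `k`. -/
lemma mem_span_three {k : ℕ} {V : Submodule ℂ (MatPoly 2 2 3)} {f : MatPoly 2 2 3}
    (hf : f ∈ invariantRing 2 2 3) (hk : f.IsHomogeneous (2 * k))
    (hV : ∀ m, k = 3 * m → (topSpan 3 * mixSpan 3 ^ 2) ^ m ≤ V) : f ∈ V := by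
  refine mem_of_mem_invariantRing (by omega) (fun a b c h1 h2 => ?_) hf hk
  rcases Nat.eq_zero_or_pos c with rfl | hc
  · have h3 : b = 2 * a := by omega
    rw [pow_zero, mul_one, h3, pow_mul, ← mul_pow]
    exact hV a (by omega)
  · rw [botSpan_three, ← Submodule.zero_eq_bot, zero_pow hc.ne', mul_zero]
    exact bot_le

section Eval

variable {K : Type} [CommRing K] [Algebra ℂ K]

/-- Evaluation of polynomial functions at a matrix. -/
def evalMat (N : Matrix (Fin 2) (Col 2 n) K) : MatPoly 2 2 n →ₐ[ℂ] K := aeval fun p => N p.1 p.2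

lemma evalMat_plucker (N : Matrix (Fin 2) (Col 2 n) K) (c d : Col 2 n) :
    evalMat N (plucker ![c, d]) = N 0 c * N 1 d - N 0 d * N 1 c := by
  rw [plucker_two, map_sub, map_mul, map_mul]
  simp only [evalMat, aeval_X]

lemma evalMat_map {L : Type} [CommRing L] [Algebra ℂ L] (φ : K →ₐ[ℂ] L)
    (N : Matrix (Fin 2) (Col 2 n) K) (f : MatPoly 2 2 n) :
    evalMat (N.map φ) f = φ (evalMat N f) :=
  DFunLike.congr_fun (algHom_ext (fun p => by simp [evalMat]) :
    evalMat (N.map φ) = φ.comp (evalMat N)) f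

lemma evalMat_colSubst (M : Matrix (Fin 2) (Col 2 n) ℂ) (g : Matrix (Col 2 n) (Col 2 n) ℂ)
    (f : MatPoly 2 2 n) : evalMat M (colSubst g f) = evalMat (M * g.transpose) f := by
  refine DFunLike.congr_fun (algHom_ext (fun p => ?_) :
    (evalMat M).comp (colSubst g) = evalMat (M * g.transpose)) f
  rw [AlgHom.comp_apply, colSubst, aeval_X, map_sum]
  simp only [evalMat, map_mul, aeval_X, algHom_C, Matrix.mul_apply, Matrix.transpose_apply]
  exact Finset.sum_congr rfl fun k _ => mul_comm _ _

lemma scale_pow {φ ψ : MatPoly 2 2 n →ₐ[ℂ] K} {V : Submodule ℂ (MatPoly 2 2 n)} {c : K}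
    (h : ∀ x ∈ V, φ x = c * ψ x) (m : ℕ) : ∀ x ∈ V ^ m, φ x = c ^ m * ψ x := by
  intro x hx
  induction hx using Submodule.pow_induction_on_left' with
  | algebraMap r => rw [AlgHom.commutes, AlgHom.commutes, pow_zero, one_mul]
  | add x y i _ _ hx hy => rw [map_add, map_add, hx, hy, mul_add]
  | mem_mul v hv i x _ hx => rw [map_mul, map_mul, h v hv, hx, pow_succ]; ring

lemma scale_mul {φ ψ : MatPoly 2 2 n →ₐ[ℂ] K} {V W : Submodule ℂ (MatPoly 2 2 n)} {c d : K}
    (h : ∀ x ∈ V, φ x = c * ψ x) (h' : ∀ x ∈ W, φ x = d * ψ x) :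
    ∀ x ∈ V * W, φ x = c * d * ψ x := by
  intro x hx
  induction hx using Submodule.mul_induction_on' with
  | mem_mul_mem v hv w hw => rw [map_mul, map_mul, h v hv, h' w hw]; ring
  | add x _ y _ hx hy => rw [map_add, map_add, hx, hy, mul_add]

variable (n) in
/-- Rescaling the columns in the two blocks. -/
def blockScale (s t : K) : Matrix (Col 2 n) (Col 2 n) K :=
  Matrix.diagonal (Sum.elim (fun _ => s) (fun _ => t))

lemma mul_blockScale_apply (g : Matrix (Fin 2) (Fin 2) K) (N : Matrix (Fin 2) (Col 2 n) K) (s t : K)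
    (i : Fin 2) (c : Col 2 n) : (g * N * blockScale n s t) i c =
      (g i 0 * N 0 c + g i 1 * N 1 c) * Sum.elim (fun _ => s) (fun _ => t) c := by
  rw [blockScale, Matrix.mul_diagonal, Matrix.mul_apply, Fin.sum_univ_two]

/-- An invariant of degree `n m` is multiplied by a scalar under the action of `GL(2)` on the rows and
of the centre of the centralizer of `λ` on the columns. -/
lemma evalMat_scale (hn : 4 ≤ n) (g : Matrix (Fin 2) (Fin 2) K) (N : Matrix (Fin 2) (Col 2 n) K)
    (s t : K) {m : ℕ} {f : MatPoly 2 2 n} (hf : f ∈ invariantRing 2 2 n)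
    (hk : f.IsHomogeneous (2 * (n * m))) :
    evalMat (g * N * blockScale n s t) f =
      ((g.det * s * t) ^ 4 * (g.det * t ^ 2) ^ (n - 4)) ^ m * evalMat N f := by
  refine scale_pow (scale_mul (scale_pow ?_ 4) (scale_pow ?_ (n - 4))) m f
    (mem_span_of_mem_invGrading hn hf hk)
  · refine fun x hx => LinearMap.eqOn_span (f := (evalMat (g * N * blockScale n s t)).toLinearMap)
      (g := (LinearMap.mulLeft ℂ (g.det * s * t)).comp (evalMat N).toLinearMap) ?_ hx
    rintro _ ⟨p, rfl⟩
    change evalMat (g * N * blockScale n s t) (mixP p.1 p.2) = (g.det * s * t) * evalMat N (mixP p.1 p.2)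
    simp only [mixP, evalMat_plucker, mul_blockScale_apply, Sum.elim_inl, Sum.elim_inr,
      Matrix.det_fin_two]
    ring
  · refine fun x hx => LinearMap.eqOn_span (f := (evalMat (g * N * blockScale n s t)).toLinearMap)
      (g := (LinearMap.mulLeft ℂ (g.det * t ^ 2)).comp (evalMat N).toLinearMap) ?_ hx
    rintro _ ⟨p, rfl⟩
    change evalMat (g * N * blockScale n s t) (botP p.1 p.2) = (g.det * t ^ 2) * evalMat N (botP p.1 p.2)
    simp only [botP, evalMat_plucker, mul_blockScale_apply, Sum.elim_inr, Matrix.det_fin_two]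
    ring

end Eval

end PluckerGIT

/-! ### Homogeneous generators and morphisms from `Proj` to projective space -/

section Generators

open MvPolynomial

variable {ι B : Type} [CommRing B] [Algebra ℂ B]

lemma MvPolynomial.exists_isHomogeneous_aeval_eq (y : ι → B) (m : ℕ) :
    ∀ x ∈ Submodule.span ℂ (Set.range y) ^ m, ∃ P : MvPolynomial ι ℂ, P.IsHomogeneous m ∧ aeval y P = x := by
  intro x hx
  induction hx using Submodule.pow_induction_on_left' with
  | algebraMap r => exact ⟨C r, isHomogeneous_C _ _, algHom_C _ _⟩
  | add x z i _ _ hx hz =>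
    obtain ⟨P, hP, rfl⟩ := hx
    obtain ⟨Q, hQ, rfl⟩ := hz
    exact ⟨P + Q, hP.add hQ, map_add _ _ _⟩
  | mem_mul v hv i x _ hx =>
    obtain ⟨P, hP, rfl⟩ := hx
    obtain ⟨Q, hQ, rfl⟩ : ∃ Q : MvPolynomial ι ℂ, Q.IsHomogeneous 1 ∧ aeval y Q = v := by
      induction hv using Submodule.span_induction with
      | mem v hv => obtain ⟨j, rfl⟩ := hv; exact ⟨X j, isHomogeneous_X _ _, aeval_X _ _⟩
      | zero => exact ⟨0, isHomogeneous_zero _ _ _, map_zero _⟩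
      | add v w _ _ hv hw =>
        obtain ⟨Q, hQ, rfl⟩ := hv
        obtain ⟨Q', hQ', rfl⟩ := hw
        exact ⟨Q + Q', hQ.add hQ', map_add _ _ _⟩
      | smul c v _ hv =>
        obtain ⟨Q, hQ, rfl⟩ := hv
        exact ⟨c • Q, (homogeneousSubmodule ι ℂ 1).smul_mem c hQ, map_smul _ _ _⟩
    refine ⟨Q * P, ?_, map_mul _ _ _⟩
    rw [Nat.succ_eq_add_one, add_comm]
    exact hQ.mul hP

lemma MvPolynomial.aeval_mem_of_isHomogeneous {y : ι → B} {I : Ideal B} (hy : ∀ i, y i ∈ I) {m : ℕ}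
    (hm : 0 < m) {P : MvPolynomial ι ℂ} (hP : P.IsHomogeneous m) : aeval y P ∈ I := by
  have h : ((Ideal.Quotient.mkₐ ℂ I).comp (aeval y) : MvPolynomial ι ℂ →ₐ[ℂ] B ⧸ I) = aeval 0 :=
    algHom_ext fun i => by
      rw [AlgHom.comp_apply, aeval_X, aeval_X]
      exact Ideal.Quotient.eq_zero_iff_mem.2 (hy i)
  refine Ideal.Quotient.eq_zero_iff_mem.1 ((DFunLike.congr_fun h P).trans ?_)
  have h0 : constantCoeff P = 0 := by
    rw [constantCoeff_eq]
    by_contra h0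
    have := hP h0
    rw [map_zero] at this
    omega
  rw [aeval_zero, h0, map_zero]

variable {A : Type} [CommRing A] [Algebra ℂ A] {𝒜 : ℕ → Submodule ℂ A} [GradedAlgebra 𝒜]

lemma aeval_mem_graded {y : ι → A} {d : ℕ} (hy : ∀ i, y i ∈ 𝒜 d) {m : ℕ} {P : MvPolynomial ι ℂ}
    (hP : P ∈ homogeneousSubmodule ι ℂ m) : aeval y P ∈ 𝒜 (d * m) := by
  rw [← homogeneousSubmodule_one_pow] at hP
  induction hP using Submodule.pow_induction_on_left' with
  | algebraMap r =>
    rw [AlgHom.commutes, mul_zero]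
    exact SetLike.algebraMap_mem_graded 𝒜 r
  | add P Q i _ _ hP hQ => rw [map_add]; exact add_mem hP hQ
  | mem_mul Q hQ i P _ hP =>
    rw [map_mul, Nat.succ_eq_add_one, add_comm i, mul_add, mul_one]
    refine SetLike.mul_mem_graded ?_ hP
    rw [homogeneousSubmodule_one_eq_span_X] at hQ
    have : Submodule.span ℂ (Set.range X) ≤ (𝒜 d).comap (aeval y : MvPolynomial ι ℂ →ₐ[ℂ] A).toLinearMap := by
      rw [Submodule.span_le]
      rintro _ ⟨i, rfl⟩
      change aeval y (X i) ∈ 𝒜 d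
      rw [aeval_X]
      exact hy i
    exact this hQ

/-- The scaled homomorphism from a polynomial ring given by generators of degree `d`. -/
def ProjScaled.ScaledHom.ofGenerators {N d : ℕ} (y : Fin (N + 1) → A) (hd : 0 < d) (hy : ∀ i, y i ∈ 𝒜 d)
    (h : ∀ m, ∀ a ∈ 𝒜 (d * m), ∃ P ∈ PluckerGIT.PGrading N m, aeval y P = a) :
    ProjScaled.ScaledHom (PluckerGIT.PGrading N) 𝒜 d where
  hom := aeval y
  pos := hd
  map_mem {i P} hP := aeval_mem_graded hy hP
  relevant p hp := by
    refine p.not_irrelevant_le ?_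
    rw [HomogeneousIdeal.irrelevant_le]
    intro i hi a ha
    -- Only degrees divisible by `d` are expressed through the generators, so `a` is replaced by `a
    -- ^ d`.
    refine p.isPrime.mem_of_pow_mem d ?_
    have h1 : a ^ d ∈ 𝒜 (d * i) := SetLike.pow_mem_graded (A := 𝒜) d ha
    obtain ⟨P, hP, hPa⟩ := h i _ h1
    rw [← hPa]
    refine aeval_mem_of_isHomogeneous (fun j => ?_) hi hP
    have h2 := hp (HomogeneousIdeal.mem_irrelevant_of_mem (PluckerGIT.PGrading N) one_pos
      (isHomogeneous_X ℂ j))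
    rw [Ideal.mem_comap, aeval_X] at h2
    exact h2

end Generators

namespace PluckerGIT

open MvPolynomial

/-- Elements that generate the invariants of degrees divisible by `d` have no common zero on the semistable locus. -/
lemma exists_mem_nonvanishing {r s n d : ℕ} [NeZero r] {ι : Type} {y : ι → invariantRing r s n}
    (h : ∀ m, ∀ a ∈ invGrading r s n (d * m), ∃ P : MvPolynomial ι ℂ, P.IsHomogeneous m ∧ aeval y P = a)
    {x : Grassmannian r s n} (hx : x ∈ semistable r s n) : ∃ i, x ∈ nonvanishing r s n (y i) := by
  obtain ⟨e, he, f, hf, hxf⟩ := hx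
  by_contra! hy
  have h1 : f ^ d ∈ invGrading r s n (d * e) := SetLike.pow_mem_graded (A := invGrading r s n) d hf
  obtain ⟨P, hP, hPf⟩ := h e _ h1
  let I : Ideal (invariantRing r s n) := x.asHomogeneousIdeal.toIdeal.comap (invIncl r s n)
  have h2 : aeval y P ∈ I := aeval_mem_of_isHomogeneous (fun i => by
    have := hy i
    exact not_not.1 this) he hP
  rw [hPf] at h2
  refine hxf (x.isPrime.mem_of_pow_mem d ?_)
  have h3 : invIncl r s n (f ^ d) ∈ x.asHomogeneousIdeal.toIdeal := h2
  rwa [map_pow] at h3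

lemma mem_of_forall_isHomogeneous {r s n : ℕ} {V : Submodule ℂ (MatPoly r s n)}
    (h : ∀ k, ∀ f ∈ invariantRing r s n, f.IsHomogeneous (r * k) → f ∈ V)
    {f : MatPoly r s n} (hf : f ∈ invariantRing r s n) : f ∈ V := by
  rw [← sum_homogeneousComponent f]
  refine sum_mem fun i _ => ?_
  obtain ⟨h1, h2⟩ := isGradedSubalgebra_invariantRing r s n f hf i
  by_cases hi : r ∣ i
  · obtain ⟨k, rfl⟩ := hi
    exact h k _ h1 (homogeneousComponent_isHomogeneous _ _)
  · rw [h2 hi]; exact zero_mem _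

/-! ### The case `n = 4` -/

section Four

variable {n : ℕ}

lemma mixP_mem_invariantRing_four (i : Fin 2) (l : Fin (4 - 2)) :
    (mixP i l : MatPoly 2 2 4) ∈ invariantRing 2 2 4 := by
  refine span_le_invariantRing (a := 0) (b := 1) (c := 0) (by norm_num) (by norm_num) ?_
  rw [pow_zero, pow_zero, one_mul, mul_one, pow_one]
  exact mixP_mem i l

/-- The generators of the invariants for `n = 4`. -/
def genFour : Fin 4 → invariantRing 2 2 4 :=
  ![⟨mixP 0 0, mixP_mem_invariantRing_four 0 0⟩, ⟨mixP 0 1, mixP_mem_invariantRing_four 0 1⟩,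
    ⟨mixP 1 0, mixP_mem_invariantRing_four 1 0⟩, ⟨mixP 1 1, mixP_mem_invariantRing_four 1 1⟩]

lemma coe_genFour : (fun i => (genFour i : MatPoly 2 2 4)) =
    ![coord 0 2, coord 0 3, coord 1 2, coord 1 3] := by
  funext i
  fin_cases i <;> rfl

lemma genFour_mem (i : Fin 4) : genFour i ∈ invGrading 2 2 4 1 := by
  fin_cases i <;> exact plucker_isHomogeneous _

lemma mixSpan_four_le : mixSpan 4 ≤ Submodule.span ℂ (Set.range
    ![(coord 0 2 : MatPoly 2 2 4), coord 0 3, coord 1 2, coord 1 3]) := by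
  rw [mixSpan, Submodule.span_le]
  have h : ∀ i : Fin 2, ∀ l : Fin 2, (mixP (n := 4) i l : MatPoly 2 2 4) ∈
      Set.range ![(coord 0 2 : MatPoly 2 2 4), coord 0 3, coord 1 2, coord 1 3] := by
    rw [Fin.forall_fin_two, Fin.forall_fin_two, Fin.forall_fin_two]
    exact ⟨⟨⟨0, rfl⟩, ⟨1, rfl⟩⟩, ⟨⟨2, rfl⟩, ⟨3, rfl⟩⟩⟩
  rintro _ ⟨p, rfl⟩
  exact Submodule.subset_span (h p.1 p.2)

lemma exists_aeval_genFour (m : ℕ) (a : invariantRing 2 2 4) (ha : a ∈ invGrading 2 2 4 (1 * m)) :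
    ∃ P : MvPolynomial (Fin 4) ℂ, P.IsHomogeneous m ∧ aeval genFour P = a := by
  rw [one_mul] at ha
  have h := pow_le_pow_left' mixSpan_four_le m (mem_mixSpan_pow a.2 ha)
  obtain ⟨P, hP, h⟩ := exists_isHomogeneous_aeval_eq _ m _ h
  refine ⟨P, hP, Subtype.ext ?_⟩
  rw [← h, ← coe_genFour]
  exact DFunLike.congr_fun (algHom_ext (fun i => by simp) :
    (invariantRing 2 2 4).val.comp (aeval genFour) = aeval fun i => (genFour i : MatPoly 2 2 4)) P

/-- The mixed minors of the matrix `N` below are the four variables, so evaluation at `N` is a left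
inverse of the substitution map. -/
lemma algebraicIndependent_four : AlgebraicIndependent ℂ
    ![(coord 0 2 : MatPoly 2 2 4), coord 0 3, coord 1 2, coord 1 3] := by
  let N : Matrix (Fin 2) (Col 2 4) (MvPolynomial (Fin 4) ℂ) :=
    Matrix.of ![Sum.elim ![X 1, X 3] ![1, 0], Sum.elim ![-X 0, -X 2] ![0, 1]]
  have h : (evalMat N).comp (aeval ![(coord 0 2 : MatPoly 2 2 4), coord 0 3, coord 1 2, coord 1 3]) =
      AlgHom.id ℂ _ := by
    refine algHom_ext fun i => ?_
    rw [AlgHom.comp_apply, aeval_X]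
    fin_cases i
    · refine (evalMat_plucker N (.inl 0) (.inr 0)).trans ?_
      simp [N]
    · refine (evalMat_plucker N (.inl 0) (.inr 1)).trans ?_
      simp [N]
    · refine (evalMat_plucker N (.inl 1) (.inr 0)).trans ?_
      simp [N]
    · refine (evalMat_plucker N (.inl 1) (.inr 1)).trans ?_
      simp [N]
  exact Function.LeftInverse.injective (g := evalMat N) fun P => DFunLike.congr_fun h P

lemma coord_relation_four : (coord 0 1 * coord 2 3 : MatPoly 2 2 4) =
    coord 0 2 * coord 1 3 - coord 0 3 * coord 1 2 := by
  simp only [coord, plucker_two]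
  ring

/-- The isomorphism of the graded ring of invariants for `n = 4` with a polynomial ring. -/
def scaledHomFour : ProjScaled.ScaledHom (PGrading 3) (invGrading 2 2 4) 1 :=
  .ofGenerators genFour one_pos genFour_mem exists_aeval_genFour

lemma scaledHomFour_injective : Function.Injective scaledHomFour.hom := by
  intro P Q h
  refine algebraicIndependent_four ?_
  rw [← coe_genFour]
  have h2 : (invariantRing 2 2 4).val.comp (aeval genFour) =
      aeval fun i => (genFour i : MatPoly 2 2 4) := algHom_ext (fun i => by simp)
  rw [← h2]
  exact congrArg Subtype.val h

lemma set_four_eq_range {α : Type*} (a b c d : α) :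
    ({a, b, c, d} : Set α) = Set.range ![a, b, c, d] := by
  ext x
  simp only [Set.mem_insert_iff, Set.mem_singleton_iff, Set.mem_range, Fin.exists_fin_succ,
    eq_comm (a := x)]
  simp

lemma set_three_eq_range {α : Type*} (a b c : α) :
    ({a, b, c} : Set α) = Set.range ![a, b, c] := by
  ext x
  simp only [Set.mem_insert_iff, Set.mem_singleton_iff, Set.mem_range, Fin.exists_fin_succ,
    eq_comm (a := x)]
  simp

lemma invariantRing_four : invariantRing 2 2 4 =
    Algebra.adjoin ℂ {coord 0 2, coord 0 3, coord 1 2, coord 1 3} := by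
  have hset : ({coord 0 2, coord 0 3, coord 1 2, coord 1 3} : Set (MatPoly 2 2 4)) =
      Set.range fun i => (genFour i : MatPoly 2 2 4) := by
    rw [coe_genFour, set_four_eq_range]
  apply le_antisymm
  · intro f hf
    refine mem_of_forall_isHomogeneous (V := Subalgebra.toSubmodule (Algebra.adjoin ℂ
      {coord 0 2, coord 0 3, coord 1 2, coord 1 3})) (fun k f hf hk => ?_) hf
    obtain ⟨P, -, hP⟩ := exists_aeval_genFour k ⟨f, hf⟩ ((one_mul k).symm ▸ hk)
    have h2 : (invariantRing 2 2 4).val.comp (aeval genFour) =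
      aeval fun i => (genFour i : MatPoly 2 2 4) := algHom_ext (fun i => by simp)
    rw [Subalgebra.mem_toSubmodule, hset, Algebra.adjoin_range_eq_range_aeval, ← h2]
    exact ⟨P, congrArg Subtype.val hP⟩
  · rw [hset]
    refine Algebra.adjoin_le ?_
    rintro _ ⟨i, rfl⟩
    exact (genFour i).2

lemma descends_four (k : ℕ) : Descends 2 2 4 k := by
  intro x hx
  obtain ⟨i, hi⟩ := exists_mem_nonvanishing exists_aeval_genFour hx
  -- Some generator of degree one is nonzero at `x`; its `k`-th power, as a fraction with
  -- denominator `1`, trivializes the `k`-th power of the bundle.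
  refine ⟨0, genFour i ^ k, ?_, 1, SetLike.GradedOne.one_mem, ?_, ?_⟩
  · have := SetLike.pow_mem_graded (A := invGrading 2 2 4) k (genFour_mem i)
    rw [zero_add]; rwa [smul_eq_mul, mul_one] at this
  · intro h
    have h3 : invIncl 2 2 4 (genFour i ^ k) ∈ x.asHomogeneousIdeal.toIdeal := h
    rw [map_pow] at h3
    exact hi (x.isPrime.mem_of_pow_mem k h3)
  · intro h
    have h3 : invIncl 2 2 4 1 ∈ x.asHomogeneousIdeal.toIdeal := h
    rw [map_one] at h3
    exact x.isPrime.ne_top ((Ideal.eq_top_iff_one _).2 h3)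

lemma exists_iso_four : ∃ e : GITQuotient 2 2 4 ≅ PSpace 3,
    e.hom ≫ projToSpec (PGrading 3) = quotientToSpec 2 2 4 ∧
    Nonempty (descent 2 2 4 1 ≅ (Scheme.Modules.pullback e.hom).obj (lineBundle 3 1)) ∧
    Nonempty (descent 2 2 4 2 ≅ (Scheme.Modules.pullback e.hom).obj (lineBundle 3 2)) := by
  have h1 := scaledHomFour.isIso_map exists_aeval_genFour scaledHomFour_injective
  have h2 (k : ℕ) : Nonempty (descent 2 2 4 (1 * k) ≅
      (Scheme.Modules.pullback scaledHomFour.map).obj (lineBundle 3 k)) := by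
    have := scaledHomFour.isIso_twistHom exists_aeval_genFour scaledHomFour_injective k
    exact Scheme.Modules.nonempty_iso_pullback (asIso scaledHomFour.map) _ _
      (@asIso _ _ _ _ _ this)
  exact ⟨asIso scaledHomFour.map, scaledHomFour.map_toSpec, h2 1, h2 2⟩

end Four

/-! ### The case `n = 3` -/

section Three

lemma top_mul_mix_mem {i j : Fin 2} {l l' : Fin (3 - 2)} :
    (topP 3 * mixP i l * mixP j l' : MatPoly 2 2 3) ∈ invariantRing 2 2 3 := by
  refine span_le_invariantRing (a := 1) (b := 2) (c := 0) (by norm_num) (by norm_num) ?_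
  rw [pow_zero, pow_one, mul_one, pow_two, mul_assoc]
  exact Submodule.mul_mem_mul topP_mem (Submodule.mul_mem_mul (mixP_mem _ _) (mixP_mem _ _))

lemma top_mul_mix_isHomogeneous {i j : Fin 2} {l l' : Fin (3 - 2)} :
    (topP 3 * mixP i l * mixP j l' : MatPoly 2 2 3).IsHomogeneous (2 * 3) :=
  ((plucker_isHomogeneous _).mul (plucker_isHomogeneous _)).mul (plucker_isHomogeneous _)

/-- The generators of the invariants for `n = 3`. -/
def genThree : Fin 3 → invariantRing 2 2 3 :=
  ![⟨topP 3 * mixP 0 0 * mixP 0 0, top_mul_mix_mem⟩, ⟨topP 3 * mixP 0 0 * mixP 1 0, top_mul_mix_mem⟩,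
    ⟨topP 3 * mixP 1 0 * mixP 1 0, top_mul_mix_mem⟩]

lemma coe_genThree : (fun i => (genThree i : MatPoly 2 2 3)) =
    ![coord 0 1 * coord 0 2 ^ 2, coord 0 1 * coord 0 2 * coord 1 2, coord 0 1 * coord 1 2 ^ 2] := by
  funext i
  fin_cases i
  · exact (mul_assoc _ _ _).trans (congrArg (_ * ·) (pow_two _).symm)
  · rfl
  · exact (mul_assoc _ _ _).trans (congrArg (_ * ·) (pow_two _).symm)

lemma genThree_mem (i : Fin 3) : genThree i ∈ invGrading 2 2 3 3 := by
  fin_cases i <;> exact top_mul_mix_isHomogeneous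

lemma mixSpan_three : mixSpan 3 = Submodule.span ℂ (Set.range
    ![(mixP 0 0 : MatPoly 2 2 3), mixP 1 0]) := by
  apply le_antisymm
  · rw [mixSpan, Submodule.span_le]
    have h : ∀ i : Fin 2, ∀ l : Fin 1, (mixP (n := 3) i l : MatPoly 2 2 3) ∈
        Set.range ![(mixP 0 0 : MatPoly 2 2 3), mixP 1 0] := by
      rw [Fin.forall_fin_two, Fin.forall_fin_one, Fin.forall_fin_one]
      exact ⟨⟨0, rfl⟩, ⟨1, rfl⟩⟩
    rintro _ ⟨p, rfl⟩
    exact Submodule.subset_span (h p.1 p.2)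
  · rw [Submodule.span_le]
    rintro _ ⟨i, rfl⟩
    fin_cases i
    · exact mixP_mem 0 0
    · exact mixP_mem 1 0

lemma topSpan_mul_mixSpan_three_le : topSpan 3 * mixSpan 3 ^ 2 ≤ Submodule.span ℂ (Set.range
    fun i => (genThree i : MatPoly 2 2 3)) := by
  rw [mixSpan_three, pow_two, topSpan, Submodule.span_mul_span, Submodule.span_mul_span,
    Submodule.span_le]
  rintro _ ⟨_, rfl, _, ⟨_, ⟨i, rfl⟩, _, ⟨j, rfl⟩, rfl⟩, rfl⟩
  refine Submodule.subset_span ?_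
  fin_cases i <;> fin_cases j
  · exact ⟨0, mul_assoc _ _ _⟩
  · exact ⟨1, mul_assoc _ _ _⟩
  · exact ⟨1, (mul_assoc _ _ _).trans (congrArg (_ * ·) (mul_comm _ _))⟩
  · exact ⟨2, mul_assoc _ _ _⟩

lemma val_comp_aeval_genThree : (invariantRing 2 2 3).val.comp (aeval genThree) =
    aeval fun i => (genThree i : MatPoly 2 2 3) := algHom_ext (fun i => by simp)

lemma exists_aeval_genThree (m : ℕ) (a : invariantRing 2 2 3) (ha : a ∈ invGrading 2 2 3 (3 * m)) :
    ∃ P : MvPolynomial (Fin 3) ℂ, P.IsHomogeneous m ∧ aeval genThree P = a := by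
  have h : (a : MatPoly 2 2 3) ∈ (Submodule.span ℂ (Set.range
      fun i => (genThree i : MatPoly 2 2 3))) ^ m :=
    mem_span_three a.2 ha fun m' hm => by
      obtain rfl : m = m' := by omega
      exact pow_le_pow_left' topSpan_mul_mixSpan_three_le m
  obtain ⟨P, hP, h⟩ := exists_isHomogeneous_aeval_eq _ m _ h
  refine ⟨P, hP, Subtype.ext ?_⟩
  rw [← h, ← val_comp_aeval_genThree]
  rfl

lemma invGrading_three_eq_zero {k : ℕ} (hk : ¬ 3 ∣ k) {a : invariantRing 2 2 3}
    (ha : a ∈ invGrading 2 2 3 k) : a = 0 := by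
  have : (a : MatPoly 2 2 3) ∈ (⊥ : Submodule ℂ (MatPoly 2 2 3)) :=
    mem_span_three a.2 ha fun m hm => absurd ⟨m, hm⟩ hk
  exact Subtype.ext ((Submodule.mem_bot ℂ).1 this)

lemma invariantRing_three : invariantRing 2 2 3 = Algebra.adjoin ℂ
    {coord 0 1 * coord 0 2 ^ 2, coord 0 1 * coord 0 2 * coord 1 2, coord 0 1 * coord 1 2 ^ 2} := by
  have hset : ({coord 0 1 * coord 0 2 ^ 2, coord 0 1 * coord 0 2 * coord 1 2,
      coord 0 1 * coord 1 2 ^ 2} : Set (MatPoly 2 2 3)) =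
      Set.range fun i => (genThree i : MatPoly 2 2 3) := by
    rw [coe_genThree, set_three_eq_range]
  rw [hset]
  apply le_antisymm
  · intro f hf
    refine mem_of_forall_isHomogeneous (V := Subalgebra.toSubmodule (Algebra.adjoin ℂ _))
      (fun k f hf hk => ?_) hf
    by_cases h3 : 3 ∣ k
    · obtain ⟨m, rfl⟩ := h3
      obtain ⟨P, -, hP⟩ := exists_aeval_genThree m ⟨f, hf⟩ hk
      rw [Subalgebra.mem_toSubmodule, Algebra.adjoin_range_eq_range_aeval, ← val_comp_aeval_genThree]
      exact ⟨P, congrArg Subtype.val hP⟩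
    · have := congrArg Subtype.val (invGrading_three_eq_zero h3 (a := ⟨f, hf⟩) hk)
      rw [show f = 0 from this]
      exact zero_mem _
  · refine Algebra.adjoin_le ?_
    rintro _ ⟨i, rfl⟩
    exact (genThree i).2

lemma descends_three : Descends 2 2 3 3 := by
  intro x hx
  obtain ⟨i, hi⟩ := exists_mem_nonvanishing exists_aeval_genThree hx
  refine ⟨0, genThree i, genThree_mem i, 1, SetLike.GradedOne.one_mem, hi, fun h => ?_⟩
  have h3 : invIncl 2 2 3 1 ∈ x.asHomogeneousIdeal.toIdeal := h
  rw [map_one] at h3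
  exact x.isPrime.ne_top ((Ideal.eq_top_iff_one _).2 h3)

/-- A matrix whose minors are `1`, `x₀` and `x₁`. -/
def matThree : Matrix (Fin 2) (Col 2 3) (MvPolynomial (Fin 2) ℂ) :=
  Matrix.of ![Sum.elim ![1, 0] ![-X 1], Sum.elim ![0, 1] ![X 0]]

lemma evalMat_matThree_topP : evalMat matThree (topP 3) = 1 := by
  refine (evalMat_plucker _ _ _).trans ?_
  simp [matThree]

lemma evalMat_matThree_mixP (i : Fin 2) : evalMat matThree (mixP i 0) = X i := by
  refine (evalMat_plucker _ _ _).trans ?_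
  fin_cases i <;> simp [matThree]

/-- The linear section of the Veronese map on monomials. -/
def veroneseSection : MvPolynomial (Fin 2) ℂ →ₗ[ℂ] MvPolynomial (Fin 3) ℂ :=
  (basisMonomials (Fin 2) ℂ).constr ℂ fun e => X 0 ^ (e 0 / 2) * X 1 ^ (e 0 % 2) * X 2 ^ (e 1 / 2)

lemma veroneseSection_X_pow (a b : ℕ) : veroneseSection (X 0 ^ a * X 1 ^ b) =
    X 0 ^ (a / 2) * X 1 ^ (a % 2) * X 2 ^ (b / 2) := by
  have h : (X 0 ^ a * X 1 ^ b : MvPolynomial (Fin 2) ℂ) =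
      basisMonomials (Fin 2) ℂ (Finsupp.single 0 a + Finsupp.single 1 b) := by
    rw [coe_basisMonomials]
    change _ = monomial _ 1
    rw [← mul_one (1 : ℂ), ← monomial_mul, ← X_pow_eq_monomial,
      ← X_pow_eq_monomial]
  rw [h, veroneseSection, Module.Basis.constr_basis]
  simp

/-- The ideal of relations of the Veronese conic. -/
lemma ker_veronese_le : RingHom.ker (aeval ![X 0 ^ 2, X 0 * X 1, X 1 ^ 2] :
    MvPolynomial (Fin 3) ℂ →ₐ[ℂ] MvPolynomial (Fin 2) ℂ) ≤ Ideal.span {X 1 ^ 2 - X 0 * X 2} := by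
  -- Modulo `X₁² - X₀X₂` each monomial reduces to one with exponent `0` or `1` at `X₁`, and that
  -- normal form is recovered from its Veronese image by `veroneseSection`. If the image is zero, so
  -- is the normal form.
  have key (F : MvPolynomial (Fin 3) ℂ) :
      F - veroneseSection (aeval ![X 0 ^ 2, X 0 * X 1, X 1 ^ 2] F) ∈
        Ideal.span {(X 1 ^ 2 - X 0 * X 2 : MvPolynomial (Fin 3) ℂ)} := by
    induction F using MvPolynomial.induction_on' with
    | add F G hF hG =>
      rw [map_add, map_add, add_sub_add_comm]
      exact add_mem hF hG
    | monomial e z =>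
      have h1 : (monomial e z : MvPolynomial (Fin 3) ℂ) = z • (X 0 ^ e 0 * X 1 ^ e 1 * X 2 ^ e 2) := by
        rw [monomial_eq, Finsupp.prod_fintype _ _ (fun _ => pow_zero _), Fin.prod_univ_three,
          smul_eq_C_mul]
      rw [h1, map_smul, map_smul, ← smul_sub, smul_eq_C_mul]
      refine Ideal.mul_mem_left _ _ ?_
      have h2 : aeval ![X 0 ^ 2, X 0 * X 1, X 1 ^ 2]
          (X 0 ^ e 0 * X 1 ^ e 1 * X 2 ^ e 2 : MvPolynomial (Fin 3) ℂ) =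
          (X 0 ^ (2 * e 0 + e 1) * X 1 ^ (e 1 + 2 * e 2) : MvPolynomial (Fin 2) ℂ) := by
        simp only [map_mul, map_pow, aeval_X]
        change (X 0 ^ 2) ^ e 0 * (X 0 * X 1) ^ e 1 * (X 1 ^ 2) ^ e 2 = _
        ring
      have h3 : (2 * e 0 + e 1) / 2 = e 0 + e 1 / 2 := by omega
      have h4 : (2 * e 0 + e 1) % 2 = e 1 % 2 := by omega
      have h5 : (e 1 + 2 * e 2) / 2 = e 2 + e 1 / 2 := by omega
      rw [h2, veroneseSection_X_pow, h3, h4, h5]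
      have h6 : (X 1 ^ e 1 : MvPolynomial (Fin 3) ℂ) = (X 1 ^ 2) ^ (e 1 / 2) * X 1 ^ (e 1 % 2) := by
        rw [← pow_mul, ← pow_add, Nat.div_add_mod]
      have h7 : (X 0 ^ e 0 * X 1 ^ e 1 * X 2 ^ e 2 -
          X 0 ^ (e 0 + e 1 / 2) * X 1 ^ (e 1 % 2) * X 2 ^ (e 2 + e 1 / 2) : MvPolynomial (Fin 3) ℂ) =
          X 0 ^ e 0 * X 1 ^ (e 1 % 2) * X 2 ^ e 2 * ((X 1 ^ 2) ^ (e 1 / 2) - (X 0 * X 2) ^ (e 1 / 2)) := by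
        rw [h6]; ring
      rw [h7]
      exact Ideal.mul_mem_left _ _ (Ideal.mem_span_singleton.2 (sub_dvd_pow_sub_pow _ _ _))
  intro F hF
  have := key F
  rwa [(RingHom.mem_ker).1 hF, map_zero, sub_zero] at this

lemma evalMat_matThree_comp : (evalMat matThree).comp (aeval fun i => (genThree i : MatPoly 2 2 3)) =
    aeval ![X 0 ^ 2, X 0 * X 1, X 1 ^ 2] := by
  refine algHom_ext fun i => ?_
  rw [AlgHom.comp_apply, aeval_X, aeval_X]
  fin_cases i
  · change evalMat matThree (topP 3 * mixP 0 0 * mixP 0 0) = X 0 ^ 2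
    rw [map_mul, map_mul, evalMat_matThree_topP, evalMat_matThree_mixP]; ring
  · change evalMat matThree (topP 3 * mixP 0 0 * mixP 1 0) = X 0 * X 1
    rw [map_mul, map_mul, evalMat_matThree_topP, evalMat_matThree_mixP, evalMat_matThree_mixP]; ring
  · change evalMat matThree (topP 3 * mixP 1 0 * mixP 1 0) = X 1 ^ 2
    rw [map_mul, map_mul, evalMat_matThree_topP, evalMat_matThree_mixP]; ring

lemma genThree_relation : (genThree 1 ^ 2 : MatPoly 2 2 3) = genThree 0 * genThree 2 := by
  change (topP 3 * mixP 0 0 * mixP 1 0) ^ 2 = (topP 3 * mixP 0 0 * mixP 0 0) * (topP 3 * mixP 1 0 * mixP 1 0)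
  ring

/-- Evaluation at `matThree` sets `p₁₂ = 1` and turns the generators into `x₀²`, `x₀x₁`, `x₁²`, so
any relation between them is one of the Veronese conic. -/
lemma ker_three : RingHom.ker (aeval ![coord 0 1 * coord 0 2 ^ 2, coord 0 1 * coord 0 2 * coord 1 2,
    coord 0 1 * coord 1 2 ^ 2] : MvPolynomial (Fin 3) ℂ →ₐ[ℂ] MatPoly 2 2 3) =
    Ideal.span {(X 1 ^ 2 - X 0 * X 2 : MvPolynomial (Fin 3) ℂ)} := by
  rw [← coe_genThree]
  apply le_antisymm
  · intro F hF
    refine ker_veronese_le ?_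
    rw [← evalMat_matThree_comp, RingHom.mem_ker]
    rw [RingHom.mem_ker] at hF
    exact (congrArg (evalMat matThree) hF).trans (map_zero _)
  · rw [Ideal.span_singleton_le_iff_mem, RingHom.mem_ker, map_sub, map_mul, map_pow, aeval_X, aeval_X,
      aeval_X, sub_eq_zero]
    exact genThree_relation

lemma genThree_surjective (a : invariantRing 2 2 3) :
    ∃ P : MvPolynomial (Fin 3) ℂ, aeval genThree P = a := by
  have h : (aeval genThree : MvPolynomial (Fin 3) ℂ →ₐ[ℂ] invariantRing 2 2 3).range = ⊤ := by
    rw [eq_top_iff]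
    intro a _
    have ha := a.2
    have h2 : invariantRing 2 2 3 ≤
        ((aeval genThree : MvPolynomial (Fin 3) ℂ →ₐ[ℂ] invariantRing 2 2 3).range).map
          (invariantRing 2 2 3).val := by
      conv_lhs => rw [invariantRing_three]
      refine Algebra.adjoin_le ?_
      have hc (i : Fin 3) : (genThree i : MatPoly 2 2 3) ∈
          ((aeval genThree : MvPolynomial (Fin 3) ℂ →ₐ[ℂ] invariantRing 2 2 3).range).map
          (invariantRing 2 2 3).val := ⟨genThree i, ⟨X i, aeval_X _ _⟩, rfl⟩
      have hc' (i : Fin 3) := congrFun coe_genThree i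
      rintro x (rfl | rfl | rfl)
      · rw [← show _ = coord 0 1 * coord 0 2 ^ 2 from hc' 0]; exact hc 0
      · rw [← show _ = coord 0 1 * coord 0 2 * coord 1 2 from hc' 1]; exact hc 1
      · rw [← show _ = coord 0 1 * coord 1 2 ^ 2 from hc' 2]; exact hc 2
    obtain ⟨b, hb, hba⟩ := h2 ha
    rwa [← Subtype.ext hba]
  have ha : a ∈ (⊤ : Subalgebra ℂ _) := Algebra.mem_top
  rw [← h] at ha
  exact ha

/-- The invariants for `n = 3`, with the degree divided by `3`. -/
abbrev gradingThree (m : ℕ) : Submodule ℂ (invariantRing 2 2 3) := invGrading 2 2 3 (3 * m)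

/-- The pieces of degree not divisible by `3` are zero, so dividing degrees by `3` loses nothing. -/
instance instGradedAlgebraGradingThree : GradedAlgebra gradingThree :=
  have hmon : SetLike.GradedMonoid gradingThree :=
    { one_mem := SetLike.GradedOne.one_mem (A := invGrading 2 2 3)
      mul_mem := fun i j a b ha hb => by
        have := SetLike.mul_mem_graded (A := invGrading 2 2 3) ha hb
        rwa [← mul_add] at this }
  have hint : DirectSum.IsInternal gradingThree := by
    refine DirectSum.isInternal_submodule_of_iSupIndep_of_iSup_eq_top ?_ ?_
    · exact (DirectSum.Decomposition.isInternal (invGrading 2 2 3)).submodule_iSupIndep.comp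
        (mul_right_injective₀ (by norm_num : (3 : ℕ) ≠ 0))
    · rw [eq_top_iff, ← (DirectSum.Decomposition.isInternal (invGrading 2 2 3)).submodule_iSup_eq_top]
      refine iSup_le fun k a ha => ?_
      by_cases hk : 3 ∣ k
      · obtain ⟨m, rfl⟩ := hk
        exact Submodule.mem_iSup_of_mem m ha
      · rw [invGrading_three_eq_zero hk ha]
        exact zero_mem _
  { hmon with toDecomposition := hint.chooseDecomposition }

/-- The Veronese rescaling of the grading for `n = 3`. -/
def scaledHomThree : ProjScaled.ScaledHom gradingThree (invGrading 2 2 3) 3 where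
  hom := AlgHom.id ℂ _
  pos := by norm_num
  map_mem h := h
  relevant p hp := by
    refine p.not_irrelevant_le ?_
    rw [HomogeneousIdeal.irrelevant_le]
    intro i hi a ha
    by_cases hk : 3 ∣ i
    · obtain ⟨m, rfl⟩ := hk
      exact hp (HomogeneousIdeal.mem_irrelevant_of_mem gradingThree (by omega) ha)
    · rw [invGrading_three_eq_zero hk ha]
      exact Ideal.zero_mem _

/-- The embedding of the invariants for `n = 3` as the even part of a polynomial ring. -/
def scaledHomVeronese : ProjScaled.ScaledHom gradingThree (PGrading 1) 2 where
  hom := (evalMat matThree).comp (invariantRing 2 2 3).val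
  pos := by norm_num
  map_mem {m a} ha := by
    obtain ⟨P, hP, rfl⟩ := exists_aeval_genThree m a ha
    have h := DFunLike.congr_fun evalMat_matThree_comp P
    rw [← val_comp_aeval_genThree] at h
    change evalMat matThree ((invariantRing 2 2 3).val (aeval genThree P)) ∈ _
    refine (show evalMat matThree ((invariantRing 2 2 3).val (aeval genThree P)) = _ from h) ▸ ?_
    refine aeval_mem_graded (𝒜 := PGrading 1) (fun i => ?_) hP
    fin_cases i
    · exact (isHomogeneous_X ℂ 0).pow 2
    · exact (isHomogeneous_X ℂ 0).mul (isHomogeneous_X ℂ 1)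
    · exact (isHomogeneous_X ℂ 1).pow 2
  relevant p hp := by
    refine p.not_irrelevant_le ?_
    have h (i : Fin 3) : aeval ![X 0 ^ 2, X 0 * X 1, X 1 ^ 2] (X i : MvPolynomial (Fin 3) ℂ) ∈
        p.asHomogeneousIdeal.toIdeal := by
      rw [← evalMat_matThree_comp, ← val_comp_aeval_genThree]
      have := hp (HomogeneousIdeal.mem_irrelevant_of_mem gradingThree one_pos (genThree_mem i))
      rw [AlgHom.comp_apply, AlgHom.comp_apply, aeval_X]
      exact this
    have hX (i : Fin 2) : (X i : MvPolynomial (Fin 2) ℂ) ∈ p.asHomogeneousIdeal.toIdeal := by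
      fin_cases i
      · have := h 0
        rw [aeval_X] at this
        exact p.isPrime.mem_of_pow_mem 2 this
      · have := h 2
        rw [aeval_X] at this
        exact p.isPrime.mem_of_pow_mem 2 this
    rw [HomogeneousIdeal.irrelevant_le]
    intro i hi a ha
    have := aeval_mem_of_isHomogeneous hX hi ha
    rwa [aeval_X_left, AlgHom.id_apply] at this

lemma scaledHomVeronese_surjective (m : ℕ) (b : MvPolynomial (Fin 2) ℂ) (hb : b ∈ PGrading 1 (2 * m)) :
    ∃ a ∈ gradingThree m, scaledHomVeronese.hom a = b := by
  have h1 : homogeneousSubmodule (Fin 2) ℂ (2 * m) ≤ (Submodule.span ℂ (Set.range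
      ![X 0 ^ 2, X 0 * X 1, X 1 ^ 2])) ^ m := by
    rw [← homogeneousSubmodule_one_pow, pow_mul]
    refine pow_le_pow_left' ?_ m
    rw [pow_two, homogeneousSubmodule_one_eq_span_X, Submodule.span_mul_span, Submodule.span_le]
    rintro _ ⟨_, ⟨i, rfl⟩, _, ⟨j, rfl⟩, rfl⟩
    refine Submodule.subset_span ?_
    fin_cases i <;> fin_cases j
    · exact ⟨0, pow_two _⟩
    · exact ⟨1, rfl⟩
    · exact ⟨1, mul_comm _ _⟩
    · exact ⟨2, pow_two _⟩
  obtain ⟨P, hP, rfl⟩ := exists_isHomogeneous_aeval_eq _ m _ (h1 hb)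
  refine ⟨aeval genThree P, aeval_mem_graded (𝒜 := invGrading 2 2 3) genThree_mem hP, ?_⟩
  rw [← evalMat_matThree_comp, ← val_comp_aeval_genThree]
  rfl

lemma scaledHomVeronese_injective : Function.Injective scaledHomVeronese.hom := by
  rw [injective_iff_map_eq_zero]
  intro a ha
  obtain ⟨P, rfl⟩ := genThree_surjective a
  have h1 : P ∈ RingHom.ker (aeval ![X 0 ^ 2, X 0 * X 1, X 1 ^ 2] :
      MvPolynomial (Fin 3) ℂ →ₐ[ℂ] MvPolynomial (Fin 2) ℂ) := by
    rw [RingHom.mem_ker, ← evalMat_matThree_comp, ← val_comp_aeval_genThree]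
    exact ha
  have h2 := ker_veronese_le h1
  rw [← ker_three, ← coe_genThree, RingHom.mem_ker, ← val_comp_aeval_genThree] at h2
  exact Subtype.ext h2

/-- The `Proj` of the regraded ring receives isomorphisms from `X`, scaling degrees by `3`, and from
the projective line, scaling degrees by `2`. Its `𝒪(1)` corresponds to the third Plücker power on
`X` and to `𝒪(2)` on the line. -/
lemma exists_iso_three : ∃ e : GITQuotient 2 2 3 ≅ PSpace 1,
    e.hom ≫ projToSpec (PGrading 1) = quotientToSpec 2 2 3 ∧
    Nonempty (descent 2 2 3 3 ≅ (Scheme.Modules.pullback e.hom).obj (lineBundle 1 2)) := by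
  have hs : ∀ m, ∀ b ∈ invGrading 2 2 3 (3 * m), ∃ a ∈ gradingThree m, scaledHomThree.hom a = b :=
    fun m b hb => ⟨b, hb, rfl⟩
  have hi : Function.Injective scaledHomThree.hom := fun _ _ h => h
  have h1 := scaledHomThree.isIso_map hs hi
  have h2 := scaledHomVeronese.isIso_map scaledHomVeronese_surjective scaledHomVeronese_injective
  have h3 : Nonempty (descent 2 2 3 3 ≅
      (Scheme.Modules.pullback scaledHomThree.map).obj (SerreTwist.twist gradingThree 1)) := by
    have := scaledHomThree.isIso_twistHom hs hi 1
    exact Scheme.Modules.nonempty_iso_pullback (asIso scaledHomThree.map) _ _ (@asIso _ _ _ _ _ this)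
  have h4 : Nonempty (lineBundle 1 2 ≅
      (Scheme.Modules.pullback scaledHomVeronese.map).obj (SerreTwist.twist gradingThree 1)) := by
    have := scaledHomVeronese.isIso_twistHom scaledHomVeronese_surjective
      scaledHomVeronese_injective 1
    exact Scheme.Modules.nonempty_iso_pullback (asIso scaledHomVeronese.map) _ _
      (@asIso _ _ _ _ _ this)
  refine ⟨asIso scaledHomThree.map ≪≫ (asIso scaledHomVeronese.map).symm, ?_,
    Scheme.Modules.nonempty_iso_pullback_trans _ _ _ _ _ h3 h4⟩
  have h5 : inv scaledHomVeronese.map ≫ projToSpec (PGrading 1) = projToSpec gradingThree := by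
    rw [IsIso.inv_comp_eq]
    exact scaledHomVeronese.map_toSpec.symm
  change (scaledHomThree.map ≫ inv scaledHomVeronese.map) ≫ _ = _
  refine (Category.assoc _ _ _).trans ?_
  rw [h5]
  exact scaledHomThree.map_toSpec

end Three

end PluckerGIT

/-! ### Generators in degree `n`, projectivity and the covering sections -/

namespace PluckerGIT

open MvPolynomial

variable {n : ℕ}

lemma mem_invariantRing_of_mem_span (hn : 4 ≤ n) {m b c : ℕ} (hb : b = 4 * m) (hc : c = (n - 4) * m)
    {f : MatPoly 2 2 n} (hf : f ∈ mixSpan n ^ b * botSpan n ^ c) : f ∈ invariantRing 2 2 n := by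
  refine span_le_invariantRing (a := 0) (b := b) (c := c) (by omega) ?_ ?_
  · obtain ⟨l, rfl⟩ := Nat.exists_eq_add_of_le hn
    rw [hb, hc, Nat.add_sub_cancel_left]
    ring
  · rwa [pow_zero, one_mul]

lemma isHomogeneous_of_mem_span (hn : 4 ≤ n) {m b c : ℕ} (hb : b = 4 * m) (hc : c = (n - 4) * m)
    {f : MatPoly 2 2 n} (hf : f ∈ mixSpan n ^ b * botSpan n ^ c) : f.IsHomogeneous (2 * (n * m)) := by
  have h := span_le_homogeneous (n := n) 0 b c (by rwa [pow_zero, one_mul])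
  have h1 : 0 + b + c = n * m := by
    rw [zero_add, hb, hc, ← add_mul]; congr 1; omega
  rw [h1] at h
  exact h

/-- The invariant of degree `n m` with the given underlying polynomial. -/
def invOfSpan (hn : 4 ≤ n) {m b c : ℕ} (hb : b = 4 * m) (hc : c = (n - 4) * m) (f : MatPoly 2 2 n)
    (hf : f ∈ mixSpan n ^ b * botSpan n ^ c) : invariantRing 2 2 n :=
  ⟨f, mem_invariantRing_of_mem_span hn hb hc hf⟩

lemma invOfSpan_mem (hn : 4 ≤ n) {m b c : ℕ} (hb : b = 4 * m) (hc : c = (n - 4) * m) (f : MatPoly 2 2 n)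
    (hf : f ∈ mixSpan n ^ b * botSpan n ^ c) :
    invOfSpan hn hb hc f hf ∈ invGrading 2 2 n (n * m) := isHomogeneous_of_mem_span hn hb hc hf

/-- Products of four mixed Plücker coordinates and `n - 4` ones with no index in `{1, 2}`. -/
abbrev GenIndex (n : ℕ) : Type :=
  (Fin 4 → Fin 2 × Fin (n - 2)) × (Fin (n - 4) → Fin (n - 2) × Fin (n - 2))

/-- The product of Plücker coordinates given by an index. -/
def genPoly (g : GenIndex n) : MatPoly 2 2 n :=
  (∏ t, mixP (g.1 t).1 (g.1 t).2) * ∏ u, botP (g.2 u).1 (g.2 u).2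

lemma prod_mem_pow {ι : Type} {v : ι → MatPoly 2 2 n} {V : Submodule ℂ (MatPoly 2 2 n)}
    (hv : ∀ i, v i ∈ V) (k : ℕ) (t : Fin k → ι) : ∏ i, v (t i) ∈ V ^ k := by
  induction k with
  | zero => simp [Submodule.one_le.1 le_rfl]
  | succ k ih =>
    rw [Fin.prod_univ_succ, pow_succ']
    exact Submodule.mul_mem_mul (hv _) (ih _)

lemma span_range_pow {ι : Type} (v : ι → MatPoly 2 2 n) (k : ℕ) :
    Submodule.span ℂ (Set.range v) ^ k ≤
      Submodule.span ℂ (Set.range fun t : Fin k → ι => ∏ i, v (t i)) := by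
  rw [Submodule.span_pow]
  refine Submodule.span_mono fun x hx => ?_
  obtain ⟨f, rfl⟩ := Set.mem_pow.1 hx
  choose t ht using fun i => (f i).2
  refine ⟨t, ?_⟩
  rw [List.prod_ofFn]
  exact Finset.prod_congr rfl fun i _ => ht i

lemma genPoly_mem (g : GenIndex n) :
    genPoly g ∈ mixSpan n ^ 4 * botSpan n ^ (n - 4) :=
  Submodule.mul_mem_mul
    (prod_mem_pow (v := fun p : Fin 2 × Fin (n - 2) => mixP p.1 p.2) (fun p => mixP_mem p.1 p.2) 4 g.1)
    (prod_mem_pow (v := fun p : Fin (n - 2) × Fin (n - 2) => botP p.1 p.2)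
      (fun p => botP_mem p.1 p.2) (n - 4) g.2)

lemma span_le_span_genPoly :
    mixSpan n ^ 4 * botSpan n ^ (n - 4) ≤ Submodule.span ℂ (Set.range (genPoly (n := n))) := by
  refine (mul_le_mul' (span_range_pow _ 4) (span_range_pow _ (n - 4))).trans ?_
  rw [Submodule.span_mul_span]
  refine Submodule.span_mono ?_
  rintro _ ⟨_, ⟨t, rfl⟩, _, ⟨u, rfl⟩, rfl⟩
  exact ⟨(t, u), rfl⟩

/-- Generators of the invariants of degrees divisible by `n`. -/
def genInv (hn : 4 ≤ n) (g : GenIndex n) : invariantRing 2 2 n :=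
  invOfSpan hn (m := 1) (by omega) (by omega) (genPoly g) (genPoly_mem g)

lemma genInv_mem (hn : 4 ≤ n) (g : GenIndex n) : genInv hn g ∈ invGrading 2 2 n n := by
  have := invOfSpan_mem hn (m := 1) (by omega) (by omega) (genPoly g) (genPoly_mem g)
  rwa [mul_one] at this

lemma exists_aeval_genInv (hn : 4 ≤ n) (m : ℕ) (a : invariantRing 2 2 n)
    (ha : a ∈ invGrading 2 2 n (n * m)) :
    ∃ P : MvPolynomial (GenIndex n) ℂ, P.IsHomogeneous m ∧ aeval (genInv hn) P = a := by
  have h := pow_le_pow_left' (span_le_span_genPoly (n := n)) m (mem_span_of_mem_invGrading hn a.2 ha)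
  obtain ⟨P, hP, h⟩ := exists_isHomogeneous_aeval_eq _ m _ h
  refine ⟨P, hP, Subtype.ext ?_⟩
  rw [← h]
  refine DFunLike.congr_fun (algHom_ext (fun i => ?_) :
    (invariantRing 2 2 n).val.comp (aeval (genInv hn)) = aeval genPoly) P
  rw [AlgHom.comp_apply, aeval_X, aeval_X]
  rfl

/-- The `n`-th power of a homogeneous element has degree divisible by `n`, hence is a polynomial
without constant term in the generators if its degree is positive. A prime that contains all
generators would be irrelevant. -/
lemma exists_genInv_notMem (hn : 4 ≤ n) (x : GITQuotient 2 2 n) :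
    ∃ g, genInv hn g ∉ x.asHomogeneousIdeal := by
  by_contra! h
  refine x.not_irrelevant_le ?_
  rw [HomogeneousIdeal.irrelevant_le]
  intro i hi a ha
  refine x.isPrime.mem_of_pow_mem n ?_
  obtain ⟨P, hP, hPa⟩ := exists_aeval_genInv hn i (a ^ n)
    (SetLike.pow_mem_graded (A := invGrading 2 2 n) n ha)
  rw [← hPa]
  exact aeval_mem_of_isHomogeneous (I := x.asHomogeneousIdeal.toIdeal) h hi hP

/-- The finitely many generators of degree `n` define a morphism to projective space; being a closed
immersion needs them to generate only the degrees divisible by `n`. -/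
lemma isProjective_quotientToSpec (hn : 4 ≤ n) : IsProjective (quotientToSpec 2 2 n) := by
  have : Nonempty (GenIndex n) :=
    ⟨fun _ => (0, ⟨0, by omega⟩), fun _ => (⟨0, by omega⟩, ⟨0, by omega⟩)⟩
  obtain ⟨N, hN⟩ : ∃ N, Fintype.card (GenIndex n) = N + 1 :=
    Nat.exists_eq_succ_of_ne_zero Fintype.card_ne_zero
  let e : GenIndex n ≃ Fin (N + 1) := Fintype.equivFinOfCardEq hN
  have h : ∀ m, ∀ a ∈ invGrading 2 2 n (n * m),
      ∃ P ∈ PGrading N m, aeval (genInv hn ∘ e.symm) P = a := by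
    intro m a ha
    obtain ⟨P, hP, rfl⟩ := exists_aeval_genInv hn m a ha
    refine ⟨rename e P, hP.rename_isHomogeneous, ?_⟩
    rw [aeval_rename, Function.comp_assoc, Equiv.symm_comp_self, Function.comp_id]
  let φ := ProjScaled.ScaledHom.ofGenerators (genInv hn ∘ e.symm) (by omega : 0 < n)
    (fun i => genInv_mem hn _) h
  exact ⟨N, φ.map, φ.isClosedImmersion_map h, φ.map_toSpec⟩

lemma mixP_pow_mul_botP_pow_mem (i : Fin 2) (l j k : Fin (n - 2)) :
    mixP i l ^ 4 * botP j k ^ (n - 4) ∈ mixSpan n ^ 4 * botSpan n ^ (n - 4) :=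
  Submodule.mul_mem_mul (Submodule.pow_mem_pow _ (mixP_mem _ _) _)
    (Submodule.pow_mem_pow _ (botP_mem _ _) _)

/-- The invariant `p_{il}⁴ p_{jk}ⁿ⁻⁴`. -/
def mixBot (hn : 4 ≤ n) (i : Fin 2) (l j k : Fin (n - 2)) : invariantRing 2 2 n :=
  invOfSpan hn (m := 1) (by omega) (by omega) (mixP i l ^ 4 * botP j k ^ (n - 4)) (mixP_pow_mul_botP_pow_mem i l j k)

lemma mixBot_mem (hn : 4 ≤ n) (i : Fin 2) (l j k : Fin (n - 2)) :
    mixBot hn i l j k ∈ invGrading 2 2 n n := by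
  have := invOfSpan_mem hn (m := 1) (by omega) (by omega) _ (mixP_pow_mul_botP_pow_mem i l j k)
  rwa [mul_one] at this

lemma genPoly_pow (g : GenIndex n) : genPoly g ^ (4 * (n - 4)) =
    ∏ t, ∏ u, (mixP (g.1 t).1 (g.1 t).2 ^ 4 * botP (g.2 u).1 (g.2 u).2 ^ (n - 4)) := by
  simp only [genPoly, Finset.prod_mul_distrib, Finset.prod_const, Finset.card_univ,
    Fintype.card_fin, mul_pow, Finset.prod_pow, ← pow_mul]
  rw [mul_comm 4 (n - 4)]

lemma prod_prod_mem {R ι κ : Type} [CommRing R] [Fintype ι] [Fintype κ] {I : Ideal R}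
    {F : ι → κ → R} (t : ι) (u : κ) (h : F t u ∈ I) : ∏ t, ∏ u, F t u ∈ I :=
  I.mem_of_dvd ((Finset.dvd_prod_of_mem (F t) (Finset.mem_univ u)).trans
    (Finset.dvd_prod_of_mem (fun t => ∏ u, F t u) (Finset.mem_univ t))) h

lemma coe_prod_prod {ι κ B : Type} [Fintype ι] [Fintype κ] [CommRing B] [Algebra ℂ B]
    {S : Subalgebra ℂ B} (F : ι → κ → S) :
    ((∏ t, ∏ u, F t u : S) : B) = ∏ t, ∏ u, (F t u : B) := by
  simp only [SubmonoidClass.coe_finsetProd]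

/-- Each of the four mixed factors is paired with each of the `n - 4` others. A mixed factor then
occurs `4 (n - 4)` times, and so does every other factor. This replaces the generators by the
simpler sections `p_{il}⁴ p_{jk}ⁿ⁻⁴`. -/
lemma genInv_pow (hn : 4 ≤ n) (g : GenIndex n) : genInv hn g ^ (4 * (n - 4)) =
    ∏ t, ∏ u, mixBot hn (g.1 t).1 (g.1 t).2 (g.2 u).1 (g.2 u).2 := by
  have h1 (k : ℕ) : ((genInv hn g ^ k : invariantRing 2 2 n) : MatPoly 2 2 n) = genPoly g ^ k :=
    SubmonoidClass.coe_pow _ _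
  have h2 := coe_prod_prod fun (t : Fin 4) (u : Fin (n - 4)) =>
    mixBot hn (g.1 t).1 (g.1 t).2 (g.2 u).1 (g.2 u).2
  have h3 := genPoly_pow g
  obtain ⟨k, hk⟩ : ∃ k, k = 4 * (n - 4) := ⟨_, rfl⟩
  rw [← hk] at h3 ⊢
  refine Subtype.ext ((h1 k).trans (h3.trans (Eq.trans ?_ h2.symm)))
  rfl

lemma exists_mixBot_notMem (hn : 5 ≤ n) (x : GITQuotient 2 2 n) :
    ∃ i l j k, mixBot (by omega : 4 ≤ n) i l j k ∉ x.asHomogeneousIdeal := by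
  have hn4 : 4 ≤ n := by omega
  obtain ⟨g, hg⟩ := exists_genInv_notMem hn4 x
  by_contra! h
  have h1 := h (g.1 0).1 (g.1 0).2 (g.2 ⟨0, by omega⟩).1 (g.2 ⟨0, by omega⟩).2
  have h2 := prod_prod_mem (I := x.asHomogeneousIdeal.toIdeal)
    (F := fun t u => mixBot hn4 (g.1 t).1 (g.1 t).2 (g.2 u).1 (g.2 u).2) 0
    (⟨0, by omega⟩ : Fin (n - 4)) h1
  rw [← genInv_pow] at h2
  exact hg (x.isPrime.mem_of_pow_mem _ h2)

/-- The three-term Plücker relation on the columns `i`, `l`, `j`, `k`. -/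
lemma mixP_mul_botP (i : Fin 2) (l j k : Fin (n - 2)) :
    mixP i l * botP j k = mixP i j * botP l k + mixP i k * botP j l := by
  simp only [mixP, botP, plucker_two]
  ring

/-- Write `p_{il} p_{jk} = u + v` with `u = p_{ij} p_{lk}` and `v = p_{ik} p_{jl}`. Every term of
`(u + v)^7` is divisible by `u⁴` or `v⁴`, hence by `p_{ij}⁴` or `p_{ik}⁴`, and the eighth power
leaves enough factors `p_{jk}` to complete these to the two given sections. -/
lemma mixBot_pow_mem (hn : 5 ≤ n) (i : Fin 2) (l j k : Fin (n - 2))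
    {I : Ideal (invariantRing 2 2 n)} (h1 : mixBot (by omega : 4 ≤ n) i j j k ∈ I)
    (h2 : mixBot (by omega : 4 ≤ n) i k j k ∈ I) : mixBot (by omega : 4 ≤ n) i l j k ^ 8 ∈ I := by
  have hn4 : 4 ≤ n := by omega
  obtain ⟨e, rfl⟩ := Nat.exists_eq_add_of_le hn
  -- With `n = 5 + e` the eighth power has `32` mixed factors and `8(e + 1)` others. The seventh
  -- power of `u + v` uses `7` of each kind and the target section `p_{jk}^(e+1)`. The cofactor then
  -- has `25 + 3 = 4 · 7` mixed factors and `7e + 4 + 3 = 7(e + 1)` others, so it is invariant of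
  -- degree `7n`.
  have hmem {b : ℕ} (hb : b = 28) (p q : Fin (5 + e - 2)) {α : MatPoly 2 2 (5 + e)}
      (hα : α ∈ (mixSpan (5 + e) * botSpan (5 + e)) ^ 3) :
      mixP i l ^ 25 * botP j k ^ (7 * e) * botP p q ^ 4 * α ∈
        mixSpan (5 + e) ^ b * botSpan (5 + e) ^ (7 * (e + 1)) := by
    have h := Submodule.mul_mem_mul (Submodule.mul_mem_mul (Submodule.mul_mem_mul
      (Submodule.pow_mem_pow _ (mixP_mem i l) 25) (Submodule.pow_mem_pow _ (botP_mem j k) (7 * e)))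
      (Submodule.pow_mem_pow _ (botP_mem p q) 4)) hα
    subst hb
    convert h using 1
    ring
  have hu : mixP i j * botP l k ∈ mixSpan (5 + e) * botSpan (5 + e) :=
    Submodule.mul_mem_mul (mixP_mem _ _) (botP_mem _ _)
  have hv : mixP i k * botP j l ∈ mixSpan (5 + e) * botSpan (5 + e) :=
    Submodule.mul_mem_mul (mixP_mem _ _) (botP_mem _ _)
  -- The coefficients `1, 7, 21, 35` are half of the binomial row of `7`; the other half is the same
  -- expression with `u` and `v` exchanged.
  have hcomb {u v : MatPoly 2 2 (5 + e)} {V : Submodule ℂ (MatPoly 2 2 (5 + e))} (hu : u ∈ V) (hv : v ∈ V) :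
      u ^ 3 + (7 : ℂ) • (u ^ 2 * v) + (21 : ℂ) • (u * v ^ 2) + (35 : ℂ) • v ^ 3 ∈ V ^ 3 := by
    refine add_mem (add_mem (add_mem (Submodule.pow_mem_pow _ hu 3) (Submodule.smul_mem _ _ ?_))
      (Submodule.smul_mem _ _ ?_)) (Submodule.smul_mem _ _ (Submodule.pow_mem_pow _ hv 3))
    · exact Submodule.mul_mem_mul (Submodule.pow_mem_pow _ hu 2) hv
    · rw [pow_succ']
      exact Submodule.mul_mem_mul hu (Submodule.pow_mem_pow _ hv 2)
  have hα := hcomb hu hv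
  have hβ := hcomb hv hu
  obtain ⟨b, hb⟩ : ∃ b, b = 28 := ⟨_, rfl⟩
  have hA := hmem hb l k hα
  have hB := hmem hb j l hβ
  set u := mixP i j * botP l k with hu'
  set v := mixP i k * botP j l with hv'
  have key : mixBot hn4 i l j k ^ 8 =
      invOfSpan hn4 (m := 7) (by omega) (by omega) _ hA * mixBot hn4 i j j k +
        invOfSpan hn4 (m := 7) (by omega) (by omega) _ hB * mixBot hn4 i k j k := by
    apply Subtype.ext
    change (mixP i l ^ 4 * botP j k ^ (5 + e - 4)) ^ 8 =
      (mixP i l ^ 25 * botP j k ^ (7 * e) * botP l k ^ 4 * _) * (mixP i j ^ 4 * botP j k ^ (5 + e - 4)) +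
      (mixP i l ^ 25 * botP j k ^ (7 * e) * botP j l ^ 4 * _) * (mixP i k ^ 4 * botP j k ^ (5 + e - 4))
    have h3 : 5 + e - 4 = e + 1 := by omega
    have h4 : (mixP i l ^ 4 * botP j k ^ (5 + e - 4)) ^ 8 =
        mixP i l ^ 25 * botP j k ^ (7 * e) * botP j k ^ (e + 1) * (mixP i l * botP j k) ^ 7 := by
      rw [h3]; ring
    rw [h4, mixP_mul_botP, h3, ← hu', ← hv']
    have h5 (z : ℂ) (w : MatPoly 2 2 (5 + e)) : z • w = C z * w := smul_eq_C_mul _ _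
    have h6 : (C 7 : MatPoly 2 2 (5 + e)) = 7 := map_ofNat C 7
    have h7 : (C 21 : MatPoly 2 2 (5 + e)) = 21 := map_ofNat C 21
    have h8 : (C 35 : MatPoly 2 2 (5 + e)) = 35 := map_ofNat C 35
    simp only [h5, h6, h7, h8]
    have h9 : mixP i j ^ 4 * botP l k ^ 4 = u ^ 4 := by rw [hu', mul_pow]
    have h10 : mixP i k ^ 4 * botP j l ^ 4 = v ^ 4 := by rw [hv', mul_pow]
    linear_combination
      (-(mixP i l ^ 25 * botP j k ^ (7 * e) * botP j k ^ (e + 1)) *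
        (u ^ 3 + 7 * (u ^ 2 * v) + 21 * (u * v ^ 2) + 35 * v ^ 3)) * h9 -
      ((mixP i l ^ 25 * botP j k ^ (7 * e) * botP j k ^ (e + 1)) *
        (v ^ 3 + 7 * (v ^ 2 * u) + 21 * (v * u ^ 2) + 35 * u ^ 3)) * h10
  rw [key]
  exact add_mem (I.mul_mem_left _ h1) (I.mul_mem_left _ h2)

/-- The sections `p_{ik}⁴ p_{jk}ⁿ⁻⁴` have no common zero. -/
lemma exists_chart (hn : 5 ≤ n) (x : GITQuotient 2 2 n) :
    ∃ i j k, j ≠ k ∧ mixBot (by omega : 4 ≤ n) i k j k ∉ x.asHomogeneousIdeal := by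
  have hn4 : 4 ≤ n := by omega
  obtain ⟨i, l, j, k, h⟩ := exists_mixBot_notMem hn x
  have hjk : j ≠ k := by
    rintro rfl
    refine h ?_
    have : mixBot hn4 i l j j = 0 := by
      apply Subtype.ext
      change mixP i l ^ 4 * botP j j ^ (n - 4) = 0
      have h0 : (botP j j : MatPoly 2 2 n) = 0 := by rw [botP, plucker_two]; ring
      rw [h0, zero_pow (by omega), mul_zero]
    rw [this]
    exact Ideal.zero_mem _
  by_cases h1 : mixBot hn4 i k j k ∈ x.asHomogeneousIdeal
  · by_cases h2 : mixBot hn4 i j j k ∈ x.asHomogeneousIdeal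
    · exact absurd (x.isPrime.mem_of_pow_mem 8
        (mixBot_pow_mem hn i l j k (I := x.asHomogeneousIdeal.toIdeal) h2 h1)) h
    -- Exchanging `j` and `k` only changes the sign of `p_{jk}`.
    · refine ⟨i, k, j, hjk.symm, fun h3 => h2 ?_⟩
      have h4 : mixBot hn4 i j j k ∈ x.asHomogeneousIdeal.toIdeal := by
        have h5 : mixBot hn4 i j j k = (-1) ^ (n - 4) * mixBot hn4 i j k j := by
          apply Subtype.ext
          change mixP i j ^ 4 * botP j k ^ (n - 4) = (-1) ^ (n - 4) * (mixP i j ^ 4 * botP k j ^ (n - 4))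
          have h6 : (botP j k : MatPoly 2 2 n) = -1 * botP k j := by
            simp only [botP, plucker_two]; ring
          rw [h6, mul_pow]; ring
        rw [h5]
        exact Ideal.mul_mem_left _ _ h3
      exact h4
  · exact ⟨i, j, k, hjk, h1⟩

end PluckerGIT

/-- A chart `Spec L` of `Proj 𝒜`: dehomogenization by an element `f` of degree `d`. -/
structure ProjChart {A : Type} [CommRing A] [Algebra ℂ A] (𝒜 : ℕ → Submodule ℂ A) [GradedAlgebra 𝒜]
    (L : Type) [CommRing L] [Algebra ℂ L] (d : ℕ) where
  elem : A
  elem_mem : elem ∈ 𝒜 d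
  pos : 0 < d
  hom : A →ₐ[ℂ] L
  hom_elem : hom elem = 1
  inj : ∀ k, ∀ a ∈ 𝒜 (d * k), hom a = 0 → a = 0
  surj : ∀ l, ∃ k, ∃ a ∈ 𝒜 (d * k), hom a = l

/-! ### Affine charts of `Proj` by dehomogenization -/

namespace ProjChart

open HomogeneousLocalization

variable {A : Type} [CommRing A] [Algebra ℂ A] {𝒜 : ℕ → Submodule ℂ A} [GradedAlgebra 𝒜]
  {L : Type} [CommRing L] [Algebra ℂ L] {d : ℕ} (c : ProjChart 𝒜 L d)

lemma isUnit_hom_elem : IsUnit (c.hom.toRingHom c.elem) := by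
  change IsUnit (c.hom c.elem)
  rw [c.hom_elem]
  exact isUnit_one

/-- Dehomogenization. -/
def awayHom : Away 𝒜 c.elem →+* L :=
  (IsLocalization.Away.lift (S := Localization.Away c.elem) c.elem c.isUnit_hom_elem).comp (algebraMap (Away 𝒜 c.elem) (Localization.Away c.elem))

lemma awayHom_of_val {z : Away 𝒜 c.elem} {k : ℕ} {a : A}
    (h : z.val = Localization.mk a (⟨c.elem ^ k, k, rfl⟩ : Submonoid.powers c.elem)) : c.awayHom z = c.hom a := by
  have h1 : c.awayHom z = IsLocalization.Away.lift (S := Localization.Away c.elem)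
    c.elem c.isUnit_hom_elem z.val := rfl
  rw [h1, h, Localization.mk_eq_mk', IsLocalization.Away.lift, IsLocalization.lift_mk'_spec]
  change c.hom a = c.hom (c.elem ^ k) * _
  rw [map_pow, c.hom_elem, one_pow, one_mul]

lemma awayHom_mk (k : ℕ) (a : A) (ha : a ∈ 𝒜 (k • d)) :
    c.awayHom (Away.mk 𝒜 c.elem_mem k a ha) = c.hom a :=
  c.awayHom_of_val (Away.val_mk 𝒜 k c.elem_mem a ha)

lemma bijective_awayHom : Function.Bijective c.awayHom := by
  constructor
  · rw [injective_iff_map_eq_zero]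
    intro z hz
    obtain ⟨k, a, ha, rfl⟩ := Away.mk_surjective 𝒜 c.elem_mem z
    rw [awayHom_mk] at hz
    have := c.inj k a (by rwa [smul_eq_mul, mul_comm] at ha) hz
    subst this
    apply HomogeneousLocalization.val_injective
    rw [Away.val_mk, Localization.mk_zero, HomogeneousLocalization.val_zero]
  · intro l
    obtain ⟨k, a, ha, rfl⟩ := c.surj l
    exact ⟨Away.mk 𝒜 c.elem_mem k a (by rwa [smul_eq_mul, mul_comm]), c.awayHom_mk _ _ _⟩

instance isIso_awayHom : IsIso (CommRingCat.ofHom c.awayHom) :=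
  (ConcreteCategory.isIso_iff_bijective _).2 c.bijective_awayHom

/-- The inclusion of the chart. -/
def ι : Spec (.of L) ⟶ Proj 𝒜 :=
  Spec.map (CommRingCat.ofHom c.awayHom) ≫ Proj.awayι 𝒜 c.elem c.elem_mem c.pos

instance isOpenImmersion_ι : IsOpenImmersion c.ι := by
  unfold ι; infer_instance

lemma opensRange_ι : c.ι.opensRange = Proj.basicOpen 𝒜 c.elem :=
  (Scheme.Hom.opensRange_comp_of_isIso _ _).trans (Proj.opensRange_awayι 𝒜 c.elem c.elem_mem c.pos)

lemma mem_range_ι {x : Proj 𝒜} : x ∈ Set.range c.ι ↔ c.elem ∉ x.asHomogeneousIdeal :=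
  (show x ∈ Set.range c.ι ↔ x ∈ c.ι.opensRange from Iff.rfl).trans (by
    rw [opensRange_ι]; exact Iff.rfl)

/-- On the chart, the locus `a ≠ 0` is that of the degree zero fraction with numerator `a ^ d`,
whose dehomogenization is the `d`-th power of that of `a`. -/
lemma ι_mem {e : ℕ} (he : 0 < e) {a : A} (ha : a ∈ 𝒜 e) (q : Spec (.of L)) :
    a ∈ (c.ι q).asHomogeneousIdeal ↔ c.hom a ∈ q.asIdeal := by
  rw [← not_iff_not]
  have h1 := Proj.awayι_preimage_basicOpen 𝒜 c.elem_mem c.pos ha he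
  have h2 : c.ι ⁻¹ᵁ Proj.basicOpen 𝒜 a = Spec.map (CommRingCat.ofHom c.awayHom) ⁻¹ᵁ
      (Proj.awayι 𝒜 c.elem c.elem_mem c.pos ⁻¹ᵁ Proj.basicOpen 𝒜 a) := rfl
  rw [h1] at h2
  have h3 : q ∈ c.ι ⁻¹ᵁ Proj.basicOpen 𝒜 a ↔
      c.awayHom (Away.isLocalizationElem c.elem_mem ha) ∉ q.asIdeal := by
    rw [h2]; exact Iff.rfl
  refine Iff.trans (Iff.rfl : _ ↔ q ∈ c.ι ⁻¹ᵁ Proj.basicOpen 𝒜 a) (h3.trans (not_congr ?_))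
  rw [c.awayHom_mk, map_pow]
  exact ⟨q.isPrime.mem_of_pow_mem d, fun h => Ideal.pow_mem_of_mem _ h _ c.pos⟩

lemma ι_toSpec : c.ι ≫ PluckerGIT.projToSpec 𝒜 =
    Spec.map (CommRingCat.ofHom (algebraMap ℂ L)) := by
  rw [ι, Category.assoc, ProjBaseChange.awayι_projToSpec 𝒜 c.pos c.elem_mem, ← Spec.map_comp,
    ← CommRingCat.ofHom_comp]
  congr 2
  ext z
  refine (c.awayHom_of_val (k := 0) (a := algebraMap ℂ A z) ?_).trans (c.hom.commutes z)
  change Localization.mk _ _ = _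
  congr 1
  exact Subtype.ext (pow_zero _).symm

/-- Both points lie in the chart, where every function is the dehomogenization of some `a` in a
degree divisible by `d`. The extra factor `c.elem` makes that degree positive and dehomogenizes to
`1`. -/
lemma ext_of_mem {x y : Proj 𝒜} (hx : c.elem ∉ x.asHomogeneousIdeal)
    (h : ∀ k, 0 < k → ∀ a ∈ 𝒜 (d * k), a ∈ x.asHomogeneousIdeal ↔ a ∈ y.asHomogeneousIdeal) : x = y := by
  have hy : c.elem ∉ y.asHomogeneousIdeal := by
    rwa [← h 1 one_pos _ (by rw [mul_one]; exact c.elem_mem)]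
  obtain ⟨q, rfl⟩ := c.mem_range_ι.2 hx
  obtain ⟨q', rfl⟩ := c.mem_range_ι.2 hy
  congr 1
  refine PrimeSpectrum.ext (Ideal.ext fun l => ?_)
  obtain ⟨k, a, ha, rfl⟩ := c.surj l
  have h1 : a * c.elem ∈ 𝒜 (d * (k + 1)) := by
    rw [mul_add, mul_one]
    exact SetLike.mul_mem_graded ha c.elem_mem
  have h2 := h (k + 1) k.succ_pos _ h1
  rwa [c.ι_mem (Nat.mul_pos c.pos k.succ_pos) h1, c.ι_mem (Nat.mul_pos c.pos k.succ_pos) h1, map_mul,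
    c.hom_elem, mul_one] at h2

end ProjChart

/-! ### Normalized matrices -/

namespace PluckerGIT

open MvPolynomial

variable {n : ℕ}

/-- The matrix entries that are not fixed by the normalization. -/
def chartFree (i : Fin 2) (j k : Fin (n - 2)) (p : Fin 2 × Col 2 n) : Prop :=
  p ≠ (0, .inl i) ∧ p.2 ≠ .inr j ∧ p.2 ≠ .inr k

/-- The coordinate ring of a chart of the quotient. -/
abbrev ChartRing (i : Fin 2) (j k : Fin (n - 2)) : Type :=
  MvPolynomial {p : Fin 2 × Col 2 n // chartFree i j k p} ℂ

/-- The columns `j`, `k` form the unit matrix and the entry `(0, i)` is `1`. -/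
structure IsNormalized {K : Type} [CommRing K] (i : Fin 2) (j k : Fin (n - 2))
    (N : Matrix (Fin 2) (Col 2 n) K) : Prop where
  zero_left : N 0 (.inl i) = 1
  zero_j : N 0 (.inr j) = 1
  one_j : N 1 (.inr j) = 0
  zero_k : N 0 (.inr k) = 0
  one_k : N 1 (.inr k) = 1

open Classical in
/-- The universal normalized matrix. -/
def chartMat (i : Fin 2) (j k : Fin (n - 2)) : Matrix (Fin 2) (Col 2 n) (ChartRing i j k) :=
  fun r c => if h : chartFree i j k (r, c) then X ⟨(r, c), h⟩ else
    if (r, c) = (1, .inr j) ∨ (r, c) = (0, .inr k) then 0 else 1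

lemma isNormalized_chartMat (i : Fin 2) {j k : Fin (n - 2)} (hjk : j ≠ k) :
    IsNormalized i j k (chartMat i j k) := by
  constructor <;> simp [chartMat, chartFree, hjk, hjk.symm]

section
variable {K : Type} [CommRing K] [Algebra ℂ K] {i : Fin 2} {j k : Fin (n - 2)}

/-- The specialization of the universal normalized matrix to a given one. -/
def chartSpec (i : Fin 2) (j k : Fin (n - 2)) (N : Matrix (Fin 2) (Col 2 n) K) : ChartRing i j k →ₐ[ℂ] K :=
  aeval fun p => N p.1.1 p.1.2

lemma IsNormalized.map_chartMat {N : Matrix (Fin 2) (Col 2 n) K} (hN : IsNormalized i j k N)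
    (hjk : j ≠ k) : (chartMat i j k).map (chartSpec i j k N) = N := by
  have h0 := isNormalized_chartMat i hjk
  ext r c
  rw [Matrix.map_apply]
  by_cases h : chartFree i j k (r, c)
  · rw [chartMat, dif_pos h, chartSpec, aeval_X]
  · rw [chartFree] at h
    push Not at h
    by_cases h1 : (r, c) = (0, Sum.inl i)
    · obtain ⟨rfl, rfl⟩ := Prod.mk.inj h1
      rw [h0.zero_left, hN.zero_left, map_one]
    · by_cases h2 : c = .inr j
      · subst h2
        fin_cases r
        · exact (congrArg _ h0.zero_j).trans ((map_one _).trans hN.zero_j.symm)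
        · exact (congrArg _ h0.one_j).trans ((map_zero _).trans hN.one_j.symm)
      · obtain rfl := h h1 h2
        fin_cases r
        · exact (congrArg _ h0.zero_k).trans ((map_zero _).trans hN.zero_k.symm)
        · exact (congrArg _ h0.one_k).trans ((map_one _).trans hN.one_k.symm)

lemma IsNormalized.evalMat_eq {N : Matrix (Fin 2) (Col 2 n) K} (hN : IsNormalized i j k N)
    (hjk : j ≠ k) (f : MatPoly 2 2 n) :
    evalMat N f = chartSpec i j k N (evalMat (chartMat i j k) f) := by
  conv_lhs => rw [← hN.map_chartMat hjk, evalMat_map]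

lemma IsNormalized.map {L : Type} [CommRing L] [Algebra ℂ L] {N : Matrix (Fin 2) (Col 2 n) K}
    (hN : IsNormalized i j k N) (φ : K →ₐ[ℂ] L) : IsNormalized i j k (N.map φ) where
  zero_left := by rw [Matrix.map_apply, hN.zero_left, map_one]
  zero_j := by rw [Matrix.map_apply, hN.zero_j, map_one]
  one_j := by rw [Matrix.map_apply, hN.one_j, map_zero]
  zero_k := by rw [Matrix.map_apply, hN.zero_k, map_zero]
  one_k := by rw [Matrix.map_apply, hN.one_k, map_one]

variable {N : Matrix (Fin 2) (Col 2 n) K}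

lemma IsNormalized.evalMat_botP (hN : IsNormalized i j k N) : evalMat N (botP j k) = 1 := by
  rw [botP, evalMat_plucker, hN.zero_j, hN.one_j, hN.zero_k, hN.one_k]; ring

lemma IsNormalized.evalMat_mixP_k (hN : IsNormalized i j k N) (b : Fin 2) :
    evalMat N (mixP b k) = N 0 (.inl b) := by
  rw [mixP, evalMat_plucker, hN.zero_k, hN.one_k]; ring

lemma IsNormalized.evalMat_mixP_j (hN : IsNormalized i j k N) (b : Fin 2) :
    evalMat N (mixP b j) = - N 1 (.inl b) := by
  rw [mixP, evalMat_plucker, hN.zero_j, hN.one_j]; ring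

lemma IsNormalized.evalMat_botP_k (hN : IsNormalized i j k N) (l : Fin (n - 2)) :
    evalMat N (botP l k) = N 0 (.inr l) := by
  rw [botP, evalMat_plucker, hN.zero_k, hN.one_k]; ring

lemma IsNormalized.evalMat_botP_j (hN : IsNormalized i j k N) (l : Fin (n - 2)) :
    evalMat N (botP j l) = N 1 (.inr l) := by
  rw [botP, evalMat_plucker, hN.zero_j, hN.one_j]; ring

lemma IsNormalized.evalMat_mixBot (hN : IsNormalized i j k N) (hn : 4 ≤ n) :
    evalMat N (mixBot hn i k j k : MatPoly 2 2 n) = 1 := by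
  change evalMat N (mixP i k ^ 4 * botP j k ^ (n - 4)) = 1
  rw [map_mul, map_pow, map_pow, hN.evalMat_botP, hN.evalMat_mixP_k, hN.zero_left, one_pow, one_pow,
    one_mul]

end

/-- Over a field, a matrix with `p_{ik}, p_{jk} ≠ 0` can be normalized. -/
lemma exists_isNormalized {K : Type} [Field K] [Algebra ℂ K] {i : Fin 2} {j k : Fin (n - 2)}
    {N : Matrix (Fin 2) (Col 2 n) K} (h1 : evalMat N (mixP i k) ≠ 0) (h2 : evalMat N (botP j k) ≠ 0) :
    ∃ (g : Matrix (Fin 2) (Fin 2) K) (s : K), g.det ≠ 0 ∧ s ≠ 0 ∧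
      IsNormalized i j k (g * N * blockScale n s 1) := by
  rw [mixP, evalMat_plucker] at h1
  rw [botP, evalMat_plucker] at h2
  set e := N 0 (.inr j) * N 1 (.inr k) - N 0 (.inr k) * N 1 (.inr j) with he
  set f := N 0 (.inl i) * N 1 (.inr k) - N 0 (.inr k) * N 1 (.inl i) with hf
  -- `g` is the inverse of the block of columns `j`, `k`, whose determinant is `e`. The entry `(0,
  -- i)` of `g * N` is then `f / e`, which the factor `s = e / f` on the first column block turns
  -- into `1`.
  refine ⟨!![e⁻¹ * N 1 (.inr k), - e⁻¹ * N 0 (.inr k); - e⁻¹ * N 1 (.inr j), e⁻¹ * N 0 (.inr j)],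
    e * f⁻¹, ?_, mul_ne_zero h2 (inv_ne_zero h1), ?_⟩
  · rw [Matrix.det_fin_two_of]
    have : e⁻¹ * N 1 (.inr k) * (e⁻¹ * N 0 (.inr j)) - - e⁻¹ * N 0 (.inr k) * (- e⁻¹ * N 1 (.inr j)) =
        e⁻¹ * e⁻¹ * e := by rw [he]; ring
    rw [this]
    exact mul_ne_zero (mul_ne_zero (inv_ne_zero h2) (inv_ne_zero h2)) h2
  · constructor <;> rw [mul_blockScale_apply] <;> simp
    · have : (e⁻¹ * N 1 (.inr k) * N 0 (.inl i) + -(e⁻¹ * N 0 (.inr k) * N 1 (.inl i))) * (e * f⁻¹) =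
          e⁻¹ * e * (f * f⁻¹) := by rw [hf]; ring
      rw [this, inv_mul_cancel₀ h2, mul_inv_cancel₀ h1, one_mul]
    · rw [← inv_mul_cancel₀ h2, he]; ring
    · ring
    · ring
    · rw [← inv_mul_cancel₀ h2, he]; ring

end PluckerGIT

/-! ### The quotient is covered by affine spaces -/

namespace PluckerGIT

open MvPolynomial

variable {n : ℕ}

/-- The generic matrix over the field of rational functions. -/
def genericMat (n : ℕ) : Matrix (Fin 2) (Col 2 n) (FractionRing (MatPoly 2 2 n)) :=
  fun r c => algebraMap (MatPoly 2 2 n) _ (X (r, c))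

lemma evalMat_genericMat (f : MatPoly 2 2 n) :
    evalMat (genericMat n) f = algebraMap (MatPoly 2 2 n) (FractionRing (MatPoly 2 2 n)) f := by
  refine DFunLike.congr_fun (algHom_ext (fun p => ?_) :
    evalMat (genericMat n) = IsScalarTower.toAlgHom ℂ (MatPoly 2 2 n) (FractionRing (MatPoly 2 2 n))) f
  rw [evalMat, aeval_X]
  rfl

lemma evalMat_scale_of_mem {K : Type} [CommRing K] [Algebra ℂ K] (hn : 4 ≤ n)
    (g : Matrix (Fin 2) (Fin 2) K) (N : Matrix (Fin 2) (Col 2 n) K) (s t : K) {m : ℕ}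
    {a : invariantRing 2 2 n} (ha : a ∈ invGrading 2 2 n (n * m)) :
    evalMat (g * N * blockScale n s t) (a : MatPoly 2 2 n) =
      ((g.det * s * t) ^ 4 * (g.det * t ^ 2) ^ (n - 4)) ^ m * evalMat N (a : MatPoly 2 2 n) :=
  evalMat_scale hn g N s t a.2 ha

lemma evalMat_scale_eq_zero_iff {K : Type} [Field K] [Algebra ℂ K] (hn : 4 ≤ n)
    {g : Matrix (Fin 2) (Fin 2) K} (hg : g.det ≠ 0) (N : Matrix (Fin 2) (Col 2 n) K) {s : K} (hs : s ≠ 0)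
    {m : ℕ} {a : invariantRing 2 2 n} (ha : a ∈ invGrading 2 2 n (n * m)) :
    evalMat (g * N * blockScale n s 1) (a : MatPoly 2 2 n) = 0 ↔ evalMat N (a : MatPoly 2 2 n) = 0 := by
  rw [evalMat_scale_of_mem hn g N s 1 ha, mul_eq_zero, or_iff_right]
  simp [hg, hs]

variable {i : Fin 2} {j k : Fin (n - 2)}

lemma isNormalized_const (i : Fin 2) {j k : Fin (n - 2)} (hjk : j ≠ k) :
    IsNormalized i j k ((chartMat i j k).map (chartSpec i j k (0 : Matrix (Fin 2) (Col 2 n) ℂ))) :=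
  (isNormalized_chartMat i hjk).map _

lemma mixP_ne_zero (i : Fin 2) (hjk : j ≠ k) : (mixP i k : MatPoly 2 2 n) ≠ 0 := by
  intro h
  have h1 := (isNormalized_const i hjk).evalMat_mixP_k i
  rw [h, map_zero, (isNormalized_const i hjk).zero_left] at h1
  exact zero_ne_one h1

lemma botP_ne_zero (hjk : j ≠ k) : (botP j k : MatPoly 2 2 n) ≠ 0 := by
  intro h
  have h1 := (isNormalized_const 0 hjk).evalMat_botP
  rw [h, map_zero] at h1
  exact zero_ne_one h1

/-- Over the field of rational functions the generic matrix can be normalized, and the result is a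
specialization of `chartMat`. Normalization multiplies the value of an invariant by a nonzero
scalar, so an invariant vanishing on `chartMat` vanishes on the generic matrix. -/
lemma eq_zero_of_evalMat_chartMat (hn : 4 ≤ n) (hjk : j ≠ k) {m : ℕ} {a : invariantRing 2 2 n}
    (ha : a ∈ invGrading 2 2 n (n * m)) (h : evalMat (chartMat i j k) (a : MatPoly 2 2 n) = 0) : a = 0 := by
  have hinj : Function.Injective (algebraMap (MatPoly 2 2 n) (FractionRing (MatPoly 2 2 n))) :=
    IsFractionRing.injective _ _
  obtain ⟨g, s, hg, hs, hN⟩ := exists_isNormalized (i := i) (j := j) (k := k) (N := genericMat n)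
    (by rw [evalMat_genericMat]; exact fun h => mixP_ne_zero i hjk (hinj (h.trans (map_zero _).symm)))
    (by rw [evalMat_genericMat]; exact fun h => botP_ne_zero hjk (hinj (h.trans (map_zero _).symm)))
  have h1 := hN.evalMat_eq hjk (a : MatPoly 2 2 n)
  rw [h, map_zero, evalMat_scale_eq_zero_iff hn hg _ hs ha, evalMat_genericMat] at h1
  exact Subtype.ext (hinj (h1.trans (map_zero _).symm))

/-- An invariant whose value at normalized matrices is the product of two given coordinates. -/
lemma exists_evalMat_eq_mul (hn : 5 ≤ n) (i : Fin 2) (j k : Fin (n - 2)) {u v : MatPoly 2 2 n}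
    (hu : u ∈ mixSpan n) (hv : v ∈ botSpan n) : ∃ a ∈ invGrading 2 2 n (n * 1),
      ∀ {K : Type} [CommRing K] [Algebra ℂ K] (N : Matrix (Fin 2) (Col 2 n) K), IsNormalized i j k N →
        evalMat N (a : MatPoly 2 2 n) = evalMat N u * evalMat N v := by
  -- On normalized matrices `p_{ik} = p_{jk} = 1`, so these coordinates fill up the degree freely.
  -- The hypothesis `5 ≤ n` leaves room for the factor `v`.
  have h : (mixP i k ^ 3 * u) * (botP j k ^ (n - 5) * v) ∈
      mixSpan n ^ (3 + 1) * botSpan n ^ (n - 5 + 1) := by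
    rw [pow_succ (mixSpan n) 3, pow_succ (botSpan n) (n - 5)]
    exact Submodule.mul_mem_mul (Submodule.mul_mem_mul (Submodule.pow_mem_pow _ (mixP_mem _ _) _) hu)
      (Submodule.mul_mem_mul (Submodule.pow_mem_pow _ (botP_mem _ _) _) hv)
  refine ⟨invOfSpan (by omega) (m := 1) (by omega) (by omega) _ h,
    invOfSpan_mem (by omega) (by omega) (by omega) _ h, fun N hN => ?_⟩
  change evalMat N ((mixP i k ^ 3 * u) * (botP j k ^ (n - 5) * v)) = _
  rw [map_mul, map_mul, map_mul, map_pow, map_pow, hN.evalMat_botP, hN.evalMat_mixP_k, hN.zero_left,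
    one_pow, one_pow, one_mul, one_mul]

/-- Every free entry of a normalized matrix is, up to sign, a Plücker coordinate involving column
`j` or `k`, hence the value of an invariant of degree `n`. -/
lemma exists_evalMat_chartMat_eq (hn : 5 ≤ n) (i : Fin 2) {j k : Fin (n - 2)} (hjk : j ≠ k)
    (l : ChartRing i j k) : ∃ m, ∃ a ∈ invGrading 2 2 n (n * m),
      evalMat (chartMat i j k) (a : MatPoly 2 2 n) = l := by
  have hN := isNormalized_chartMat i hjk
  induction l using MvPolynomial.induction_on with
  | C z =>
    refine ⟨0, algebraMap ℂ _ z, ?_, ?_⟩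
    · rw [mul_zero]; exact SetLike.algebraMap_mem_graded (invGrading 2 2 n) z
    · exact (evalMat (chartMat i j k)).commutes z
  | add p q hp hq =>
    obtain ⟨m, a, ha, rfl⟩ := hp
    obtain ⟨m', a', ha', rfl⟩ := hq
    have hn4 : 4 ≤ n := by omega
    have hf (m : ℕ) : mixBot hn4 i k j k ^ m ∈ invGrading 2 2 n (n * m) := by
      rw [mul_comm]; exact SetLike.pow_mem_graded (A := invGrading 2 2 n) m (mixBot_mem hn4 i k j k)
    -- The two invariants are brought to the same degree by powers of the section that takes the
    -- value `1` on the chart.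
    refine ⟨m + m', a * mixBot hn4 i k j k ^ m' + mixBot hn4 i k j k ^ m * a', ?_, ?_⟩
    · rw [mul_add]
      exact add_mem (SetLike.mul_mem_graded ha (hf m')) (SetLike.mul_mem_graded (hf m) ha')
    · change evalMat (chartMat i j k) ((a : MatPoly 2 2 n) * (mixBot hn4 i k j k : MatPoly 2 2 n) ^ m' +
        (mixBot hn4 i k j k : MatPoly 2 2 n) ^ m * (a' : MatPoly 2 2 n)) = _
      rw [map_add, map_mul, map_mul, map_pow, map_pow, hN.evalMat_mixBot, one_pow, one_pow, mul_one,
        one_mul]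
  | mul_X p x hp =>
    obtain ⟨m, a, ha, rfl⟩ := hp
    suffices ∃ b ∈ invGrading 2 2 n (n * 1), evalMat (chartMat i j k) (b : MatPoly 2 2 n) = X x by
      obtain ⟨b, hb, hb'⟩ := this
      refine ⟨m + 1, a * b, ?_, ?_⟩
      · rw [mul_add]; exact SetLike.mul_mem_graded ha hb
      · rw [← hb']; exact map_mul (evalMat (chartMat i j k)) _ _
    obtain ⟨⟨r, c⟩, hx⟩ := x
    have hX : (X ⟨(r, c), hx⟩ : ChartRing i j k) = chartMat i j k r c := by
      rw [chartMat, dif_pos hx]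
    rw [hX]
    -- The entries are `N₀b = p_{bk}`, `N₁b = -p_{bj}`, `N₀l = p_{lk}` and `N₁l = p_{jl}`.
    rcases c with b | l <;> fin_cases r
    · obtain ⟨a, ha, h⟩ := exists_evalMat_eq_mul hn i j k (mixP_mem b k) (botP_mem j k)
      refine ⟨a, ha, (h _ hN).trans ?_⟩
      rw [hN.evalMat_botP, hN.evalMat_mixP_k, mul_one]
      rfl
    · obtain ⟨a, ha, h⟩ := exists_evalMat_eq_mul hn i j k (neg_mem (mixP_mem b j)) (botP_mem j k)
      refine ⟨a, ha, (h _ hN).trans ?_⟩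
      rw [hN.evalMat_botP, map_neg, hN.evalMat_mixP_j, mul_one, neg_neg]
      rfl
    · obtain ⟨a, ha, h⟩ := exists_evalMat_eq_mul hn i j k (mixP_mem i k) (botP_mem l k)
      refine ⟨a, ha, (h _ hN).trans ?_⟩
      rw [hN.evalMat_botP_k, hN.evalMat_mixP_k, hN.zero_left, one_mul]
      rfl
    · obtain ⟨a, ha, h⟩ := exists_evalMat_eq_mul hn i j k (mixP_mem i k) (botP_mem j l)
      refine ⟨a, ha, (h _ hN).trans ?_⟩
      rw [hN.evalMat_botP_j, hN.evalMat_mixP_k, hN.zero_left, one_mul]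
      rfl

/-- The chart of the quotient where `p_{ik}` and `p_{jk}` do not vanish. -/
def quotientChart (hn : 5 ≤ n) (i : Fin 2) {j k : Fin (n - 2)} (hjk : j ≠ k) :
    ProjChart (invGrading 2 2 n) (ChartRing i j k) n where
  elem := mixBot (by omega) i k j k
  elem_mem := mixBot_mem _ i k j k
  pos := by omega
  hom := (evalMat (chartMat i j k)).comp (invariantRing 2 2 n).val
  hom_elem := (isNormalized_chartMat i hjk).evalMat_mixBot (by omega)
  inj _ _ ha h := eq_zero_of_evalMat_chartMat (by omega) hjk ha h
  surj l := exists_evalMat_chartMat_eq hn i hjk l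

lemma quotientChart_hom (hn : 5 ≤ n) (i : Fin 2) {j k : Fin (n - 2)} (hjk : j ≠ k)
    (a : invariantRing 2 2 n) :
    (quotientChart hn i hjk).hom a = evalMat (chartMat i j k) (a : MatPoly 2 2 n) := rfl

lemma exists_quotientChart (hn : 5 ≤ n) (x : GITQuotient 2 2 n) :
    ∃ (i : Fin 2) (j k : Fin (n - 2)) (hjk : j ≠ k), x ∈ Set.range (quotientChart hn i hjk).ι := by
  obtain ⟨i, j, k, hjk, h⟩ := exists_chart hn x
  exact ⟨i, j, k, hjk, (quotientChart hn i hjk).mem_range_ι.2 h⟩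

/-- Indices of the charts of the quotient. -/
abbrev ChartIndex (n : ℕ) : Type := {p : Fin 2 × Fin (n - 2) × Fin (n - 2) // p.2.1 ≠ p.2.2}

/-- The charts cover the quotient. -/
def quotientCover (hn : 5 ≤ n) : (GITQuotient 2 2 n).AffineOpenCover where
  I₀ := ChartIndex n
  X p := .of (ChartRing p.1.1 p.1.2.1 p.1.2.2)
  f p := (quotientChart hn p.1.1 p.2).ι
  idx x := ⟨(_, _, _), (exists_quotientChart hn x).choose_spec.choose_spec.choose_spec.choose⟩
  covers x := (exists_quotientChart hn x).choose_spec.choose_spec.choose_spec.choose_spec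

lemma smooth_SpecMap_mvPolynomial (σ : Type) [Finite σ] :
    Smooth (Spec.map (CommRingCat.ofHom (algebraMap ℂ (MvPolynomial σ ℂ)))) := by
  rw [HasRingHomProperty.Spec_iff (P := @Smooth)]
  change RingHom.Smooth (algebraMap ℂ (MvPolynomial σ ℂ))
  rw [RingHom.smooth_algebraMap]
  exact ⟨inferInstance, inferInstance⟩

lemma smooth_quotientToSpec (hn : 5 ≤ n) : Smooth (quotientToSpec 2 2 n) := by
  have : IsZariskiLocalAtSource.{0} @Smooth :=
    HasRingHomProperty.instIsZariskiLocalAtSource (Q := RingHom.Smooth)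
  refine IsZariskiLocalAtSource.of_openCover (P := @Smooth.{0}) (quotientCover hn).openCover fun p => ?_
  change Smooth ((quotientChart hn p.1.1 p.2).ι ≫ projToSpec (invGrading 2 2 n))
  rw [ProjChart.ι_toSpec]
  exact smooth_SpecMap_mvPolynomial _

lemma isReduced_quotient (hn : 5 ≤ n) : IsReduced (GITQuotient 2 2 n) := by
  have (p : (quotientCover hn).openCover.I₀) : IsReduced ((quotientCover hn).openCover.X p) := by
    change IsReduced (Spec (.of (ChartRing p.1.1 p.1.2.1 p.1.2.2)))
    infer_instance
  exact IsReduced.of_openCover _ (quotientCover hn).openCover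

lemma jacobsonSpace_quotient (hn : 5 ≤ n) : JacobsonSpace (GITQuotient 2 2 n) := by
  have := smooth_quotientToSpec hn
  exact LocallyOfFiniteType.jacobsonSpace (quotientToSpec 2 2 n)

end PluckerGIT

/-! ### Completing rows to matrices of determinant one -/

section SpecialLinear

/-- The first two rows of the unit matrix. -/
def topRows (m : ℕ) : Matrix (Fin 2) (Fin m) ℂ := fun r c => if (c : ℕ) = r then 1 else 0

lemma topRows_mul {m : ℕ} (hm : 2 ≤ m) (S : Matrix (Fin m) (Fin m) ℂ) (r : Fin 2) (c : Fin m) :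
    (topRows m * S) r c = S ⟨r, by omega⟩ c := by
  rw [Matrix.mul_apply, Finset.sum_eq_single (⟨r, by omega⟩ : Fin m)]
  · simp [topRows]
  · intro b _ hb
    rw [topRows, if_neg (fun h => hb (Fin.ext h)), zero_mul]
  · simp

/-- A `2 × m` matrix of rank two, `m ≥ 3`, consists of the first two rows of a matrix of
determinant one. -/
lemma exists_topRows_mul_eq {m : ℕ} (hm : 3 ≤ m) (B : Matrix (Fin 2) (Fin m) ℂ) {j k : Fin m}
    (hB : B 0 j * B 1 k - B 0 k * B 1 j ≠ 0) :
    ∃ S : Matrix.SpecialLinearGroup (Fin m) ℂ, topRows m * S.1 = B := by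
  have hjk : j ≠ k := by
    rintro rfl
    exact hB (by ring)
  let e0 : Fin m := ⟨0, by omega⟩
  let e1 : Fin m := ⟨1, by omega⟩
  let e2 : Fin m := ⟨2, by omega⟩
  have h01 : e0 ≠ e1 := by simp [e0, e1]
  -- `σ` carries the first two indices to `j` and `k`, so that the remaining rows of `S` can be
  -- taken to be the unit vectors of the other columns.
  let σ : Equiv.Perm (Fin m) := Equiv.swap (Equiv.swap e0 j e1) k * Equiv.swap e0 j
  have hx : Equiv.swap e0 j e1 ≠ j := fun h => h01 (((Equiv.swap e0 j).injective
    (h.trans (Equiv.swap_apply_left e0 j).symm)).symm)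
  have hσ0 : σ e0 = j := by
    rw [Equiv.Perm.mul_apply, Equiv.swap_apply_left, Equiv.swap_apply_of_ne_of_ne hx.symm hjk]
  have hσ1 : σ e1 = k := by
    rw [Equiv.Perm.mul_apply, Equiv.swap_apply_left]
  let S : Matrix (Fin m) (Fin m) ℂ := fun r c =>
    if r = e0 then B 0 c else if r = e1 then B 1 c else if c = σ r then 1 else 0
  -- The unit rows confine a kernel vector to the columns `j`, `k`, where the first two rows form an
  -- invertible system.
  have hdet : S.det ≠ 0 := by
    intro h
    obtain ⟨v, hv, hSv⟩ := Matrix.exists_mulVec_eq_zero_iff.2 h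
    have hr (r : Fin m) (h0 : r ≠ e0) (h1 : r ≠ e1) : v (σ r) = 0 := by
      have := congrFun hSv r
      rw [Matrix.mulVec, dotProduct, Finset.sum_eq_single (σ r)] at this
      · simpa [S, h0, h1] using this
      · intro b _ hb
        simp [S, h0, h1, hb]
      · simp
    have hv' (c : Fin m) (hc : c ≠ j) (hc' : c ≠ k) : v c = 0 := by
      have := hr (σ.symm c) (fun h => hc (by rw [← hσ0, ← h, Equiv.apply_symm_apply]))
        (fun h => hc' (by rw [← hσ1, ← h, Equiv.apply_symm_apply]))
      rwa [Equiv.apply_symm_apply] at this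
    have hsum (w : Fin m → ℂ) : ∑ c, w c * v c = w j * v j + w k * v k := by
      rw [← Finset.sum_pair hjk (f := fun c => w c * v c)]
      refine (Finset.sum_subset (Finset.subset_univ _) fun c _ hc => ?_).symm
      simp only [Finset.mem_insert, Finset.mem_singleton, not_or] at hc
      rw [hv' c hc.1 hc.2, mul_zero]
    have h0 : B 0 j * v j + B 0 k * v k = 0 := by
      rw [← hsum (B 0)]
      have := congrFun hSv e0
      simpa [Matrix.mulVec, dotProduct, S] using this
    have h1 : B 1 j * v j + B 1 k * v k = 0 := by
      rw [← hsum (B 1)]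
      have := congrFun hSv e1
      simpa [Matrix.mulVec, dotProduct, S, h01.symm] using this
    have hj : v j = 0 := by
      have : (B 0 j * B 1 k - B 0 k * B 1 j) * v j = 0 := by
        linear_combination B 1 k * h0 - B 0 k * h1
      exact (mul_eq_zero.1 this).resolve_left hB
    have hk : v k = 0 := by
      have : (B 0 j * B 1 k - B 0 k * B 1 j) * v k = 0 := by
        linear_combination B 0 j * h1 - B 1 j * h0
      exact (mul_eq_zero.1 this).resolve_left hB
    refine hv (funext fun c => ?_)
    by_cases hc : c = j
    · rw [hc, hj]; rfl
    · by_cases hc' : c = k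
      · rw [hc', hk]; rfl
      · exact hv' c hc hc'
  -- Since `m ≥ 3`, there is a third row that can be rescaled to make the determinant `1` without
  -- touching the first two.
  refine ⟨⟨S.updateRow e2 (S.det⁻¹ • S e2), ?_⟩, ?_⟩
  · rw [Matrix.det_updateRow_smul, Matrix.updateRow_eq_self]
    exact inv_mul_cancel₀ hdet
  · ext r c
    rw [topRows_mul (by omega)]
    have hrow (r : Fin m) (hr : r ≠ e2) : S.updateRow e2 (S.det⁻¹ • S e2) r c = S r c := by
      rw [Matrix.updateRow_ne hr]
    fin_cases r
    · exact (hrow e0 (by simp [e0, e2])).trans (if_pos rfl)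
    · exact (hrow e1 (by simp [e1, e2])).trans ((if_neg h01.symm).trans (if_pos rfl))

lemma exists_specialLinear_row (a b : ℂ) (h : a ≠ 0 ∨ b ≠ 0) :
    ∃ T : Matrix.SpecialLinearGroup (Fin 2) ℂ, T.1 0 0 = a ∧ T.1 0 1 = b := by
  by_cases ha : a = 0
  · have hb := h.resolve_left (not_not.2 ha)
    refine ⟨⟨!![a, b; -b⁻¹, 0], ?_⟩, rfl, rfl⟩
    rw [Matrix.det_fin_two_of, ha]
    field_simp
    ring
  · refine ⟨⟨!![a, b; 0, a⁻¹], ?_⟩, rfl, rfl⟩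
    rw [Matrix.det_fin_two_of]
    field_simp
    ring

end SpecialLinear

/-! ### Closed points as matrices and the classification of orbits -/

namespace PluckerGIT

open MvPolynomial

variable {n : ℕ}

/-- The point `x` of the quotient is the image of the row space of `M`. -/
def Represents (M : Matrix (Fin 2) (Col 2 n) ℂ) (x : GITQuotient 2 2 n) : Prop :=
  ∀ m, 0 < m → ∀ a ∈ invGrading 2 2 n (n * m),
    a ∈ x.asHomogeneousIdeal ↔ evalMat M (a : MatPoly 2 2 n) = 0

lemma Represents.eq (hn : 5 ≤ n) {M : Matrix (Fin 2) (Col 2 n) ℂ} {x y : GITQuotient 2 2 n}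
    (hx : Represents M x) (hy : Represents M y) : x = y := by
  obtain ⟨i, j, k, hjk, h⟩ := exists_chart hn x
  exact (quotientChart hn i hjk).ext_of_mem h fun m hm a ha => (hx m hm a ha).trans (hy m hm a ha).symm

lemma represents_scale_iff (hn : 5 ≤ n) {g : Matrix (Fin 2) (Fin 2) ℂ} (hg : g.det ≠ 0)
    (M : Matrix (Fin 2) (Col 2 n) ℂ) {s : ℂ} (hs : s ≠ 0) {x : GITQuotient 2 2 n} :
    Represents (g * M * blockScale n s 1) x ↔ Represents M x :=
  forall_congr' fun m => forall_congr' fun _ => forall_congr' fun a => forall_congr' fun ha => by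
    rw [evalMat_scale_eq_zero_iff (by omega) hg M hs ha]

lemma blockScale_one : blockScale n (1 : ℂ) 1 = 1 := by
  rw [blockScale, ← Matrix.diagonal_one]
  congr 1
  ext (c | c) <;> rfl

lemma represents_mul_iff (hn : 5 ≤ n) {g : Matrix (Fin 2) (Fin 2) ℂ} (hg : g.det ≠ 0)
    (M : Matrix (Fin 2) (Col 2 n) ℂ) {x : GITQuotient 2 2 n} :
    Represents (g * M) x ↔ Represents M x := by
  have := represents_scale_iff hn hg M one_ne_zero (x := x)
  rwa [blockScale_one, Matrix.mul_one] at this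

lemma mem_movePoint {h : LeviSS 2 n} {x : GITQuotient 2 2 n} {a : invariantRing 2 2 n} :
    a ∈ (movePoint (leviAct 2 2 n) h x).asHomogeneousIdeal ↔
      leviGradedHom h a ∈ x.asHomogeneousIdeal := Iff.rfl

lemma Represents.movePoint {M : Matrix (Fin 2) (Col 2 n) ℂ} {x : GITQuotient 2 2 n}
    (hx : Represents M x) (h : LeviSS 2 n) :
    Represents (M * (leviMatrix h).transpose) (movePoint (leviAct 2 2 n) h x) := by
  intro m hm a ha
  refine mem_movePoint.trans ((hx m hm _ ((leviGradedHom h).map_mem ha)).trans ?_)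
  rw [← evalMat_colSubst]
  rfl

/-- A closed point of `X` is closed in a chart, which is an affine space. By the Nullstellensatz it
is a complex point `v`, and `chartMat` specialized at `v` represents it. -/
lemma exists_represents (hn : 5 ≤ n) {x : GITQuotient 2 2 n} (hx : IsClosed {x}) :
    ∃ (i : Fin 2) (j k : Fin (n - 2)) (M : Matrix (Fin 2) (Col 2 n) ℂ),
      j ≠ k ∧ IsNormalized i j k M ∧ Represents M x := by
  obtain ⟨i, j, k, hjk, q, rfl⟩ := exists_quotientChart hn x
  set c := quotientChart hn i hjk with hc
  have hq : IsClosed {q} := by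
    have h1 : c.ι ⁻¹' {c.ι q} = {q} := by
      ext q'
      exact ⟨fun h => c.ι.isOpenEmbedding.injective h, fun h => congrArg c.ι h⟩
    rw [← h1]
    exact hx.preimage c.ι.continuous
  have hmax := (PrimeSpectrum.isClosed_singleton_iff_isMaximal q).1 hq
  obtain ⟨v, hv⟩ := isMaximal_iff_eq_vanishingIdeal_singleton.1 hmax
  refine ⟨i, j, k, (chartMat i j k).map (aeval v), hjk, (isNormalized_chartMat i hjk).map _, ?_⟩
  intro m hm a ha
  rw [c.ι_mem (Nat.mul_pos (by omega) hm) ha, hv, mem_vanishingIdeal_singleton_iff, evalMat_map]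
  exact Iff.rfl

/-- The normalized matrix is a complex point of the chart. It is closed in all of `X` because `X` is
a Jacobson space. -/
lemma exists_isClosed_represents (hn : 5 ≤ n) {i : Fin 2} {j k : Fin (n - 2)} (hjk : j ≠ k)
    {M : Matrix (Fin 2) (Col 2 n) ℂ} (h1 : evalMat M (mixP i k) ≠ 0) (h2 : evalMat M (botP j k) ≠ 0) :
    ∃ x : GITQuotient 2 2 n, IsClosed {x} ∧ Represents M x := by
  obtain ⟨g, s, hg, hs, hN⟩ := exists_isNormalized h1 h2
  set N := g * M * blockScale n s 1
  set c := quotientChart hn i hjk with hc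
  let v : {p : Fin 2 × Col 2 n // chartFree i j k p} → ℂ := fun p => N p.1.1 p.1.2
  have hmax : (vanishingIdeal ℂ {v} : Ideal (ChartRing i j k)).IsMaximal :=
    isMaximal_iff_eq_vanishingIdeal_singleton.2 ⟨v, rfl⟩
  let q : Spec (.of (ChartRing i j k)) := ⟨vanishingIdeal ℂ {v}, hmax.isPrime⟩
  have hq : q ∈ closedPoints (Spec (.of (ChartRing i j k))) :=
    (PrimeSpectrum.isClosed_singleton_iff_isMaximal q).2 hmax
  have := jacobsonSpace_quotient hn
  rw [← c.ι.isOpenEmbedding.preimage_closedPoints] at hq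
  refine ⟨c.ι q, hq, (represents_scale_iff hn hg M hs).1 fun m hm a ha => ?_⟩
  rw [c.ι_mem (Nat.mul_pos (by omega) hm) ha, hN.evalMat_eq hjk]
  exact mem_vanishingIdeal_singleton_iff _ _

/-- The matrix with blocks `P` and `(1 0)`. -/
def baseMat (n : ℕ) (P : Matrix (Fin 2) (Fin 2) ℂ) : Matrix (Fin 2) (Col 2 n) ℂ :=
  Matrix.fromCols P (topRows (n - 2))

lemma baseMat_mul (P : Matrix (Fin 2) (Fin 2) ℂ) (h : LeviSS 2 n) :
    baseMat n P * (leviMatrix h).transpose =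
      Matrix.fromCols (P * h.1.1.transpose) (topRows (n - 2) * h.2.1.transpose) := by
  rw [baseMat, leviMatrix, Matrix.fromBlocks_transpose, Matrix.fromCols_mul_fromBlocks]
  simp

lemma exists_represents_baseMat (hn : 5 ≤ n) {P : Matrix (Fin 2) (Fin 2) ℂ} (hP : P 0 0 = 1) :
    ∃ x : GITQuotient 2 2 n, IsClosed {x} ∧ Represents (baseMat n P) x := by
  let j : Fin (n - 2) := ⟨0, by omega⟩
  let k : Fin (n - 2) := ⟨1, by omega⟩
  refine exists_isClosed_represents hn (i := 0) (j := j) (k := k) (by simp [j, k]) ?_ ?_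
  · rw [mixP, evalMat_plucker]
    simp [baseMat, topRows, hP, k]
  · rw [botP, evalMat_plucker]
    simp [baseMat, topRows, j, k]

lemma evalMat_topP {K : Type} [CommRing K] [Algebra ℂ K] (N : Matrix (Fin 2) (Col 2 n) K) :
    evalMat N (topP n) = N 0 (.inl 0) * N 1 (.inl 1) - N 0 (.inl 1) * N 1 (.inl 0) :=
  evalMat_plucker N _ _

/-- The row relation of normalized matrices whose first block is degenerate. -/
lemma IsNormalized.row_eq {K : Type} [CommRing K] [Algebra ℂ K] {i : Fin 2} {j k : Fin (n - 2)}
    {N : Matrix (Fin 2) (Col 2 n) K} (hN : IsNormalized i j k N) (h : evalMat N (topP n) = 0)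
    (b : Fin 2) : N 1 (.inl b) = N 1 (.inl i) * N 0 (.inl b) := by
  rw [evalMat_topP] at h
  have key : ∀ i b : Fin 2, N 0 (.inl i) = 1 → N 1 (.inl b) = N 1 (.inl i) * N 0 (.inl b) := by
    rw [Fin.forall_fin_two, Fin.forall_fin_two, Fin.forall_fin_two]
    exact ⟨⟨fun h1 => by linear_combination -N 1 (.inl 0) * h1,
      fun h1 => by linear_combination h - N 1 (.inl 1) * h1⟩,
      ⟨fun h1 => by linear_combination -h - N 1 (.inl 0) * h1,
      fun h1 => by linear_combination -N 1 (.inl 1) * h1⟩⟩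
  exact key i b hN.zero_left

/-- Multiplying by the inverse of the first block gives `(1 | B)` with `B` of rank two, and `SL(n -
2)` carries the standard `2 × (n - 2)` matrix to `B`. -/
lemma IsNormalized.mem_orbit_of_ne_zero (hn : 5 ≤ n) {i : Fin 2} {j k : Fin (n - 2)}
    {M : Matrix (Fin 2) (Col 2 n) ℂ} (hM : IsNormalized i j k M) (h : evalMat M (topP n) ≠ 0)
    {x x0 : GITQuotient 2 2 n} (hx : Represents M x) (hx0 : Represents (baseMat n 1) x0) :
    x ∈ orbit (leviAct 2 2 n) x0 := by
  have hP : M.toCols₁.det ≠ 0 := by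
    rw [evalMat_topP] at h
    rwa [Matrix.det_fin_two]
  have hg : (M.toCols₁)⁻¹.det ≠ 0 := by
    rw [Matrix.det_nonsing_inv]
    exact (Ring.inverse_eq_inv M.toCols₁.det).symm ▸ inv_ne_zero hP
  -- Columns `j`, `k` of `M` form the unit matrix, so those of the product form the inverse block,
  -- and the corresponding minor of `B` is nonzero.
  have hcol (r : Fin 2) : ((M.toCols₁)⁻¹ * M.toCols₂) r j = (M.toCols₁)⁻¹ r 0 ∧
      ((M.toCols₁)⁻¹ * M.toCols₂) r k = (M.toCols₁)⁻¹ r 1 := by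
    constructor <;> rw [Matrix.mul_apply, Fin.sum_univ_two] <;>
      simp [Matrix.toCols₂, hM.zero_j, hM.one_j, hM.zero_k, hM.one_k]
  obtain ⟨S, hS⟩ := exists_topRows_mul_eq (by omega) ((M.toCols₁)⁻¹ * M.toCols₂) (j := j) (k := k) (by
    rw [(hcol 0).1, (hcol 0).2, (hcol 1).1, (hcol 1).2, ← Matrix.det_fin_two]
    exact hg)
  refine ⟨(1, S.transpose), Represents.eq hn (hx0.movePoint _) ?_⟩
  rw [baseMat_mul]
  have h1 : Matrix.fromCols (1 * (1 : Matrix.SpecialLinearGroup (Fin 2) ℂ).1.transpose)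
      (topRows (n - 2) * S.transpose.1.transpose) = (M.toCols₁)⁻¹ * M := by
    conv_rhs => rw [← Matrix.fromCols_toCols M, Matrix.mul_fromCols]
    rw [Matrix.fromCols_toCols, Matrix.nonsing_inv_mul _ (isUnit_iff_ne_zero.2 hP), ← hS,
      Matrix.SpecialLinearGroup.coe_transpose, Matrix.transpose_transpose]
    simp
  exact h1 ▸ (represents_mul_iff hn hg M).2 hx

/-- A row operation clears the second row of the degenerate first block. Its first row is nonzero,
so `SL(2)` carries `(1, 0)` to it, while `SL(n - 2)` takes care of the second block. -/
lemma IsNormalized.mem_orbit_of_eq_zero (hn : 5 ≤ n) {i : Fin 2} {j k : Fin (n - 2)}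
    {M : Matrix (Fin 2) (Col 2 n) ℂ} (hM : IsNormalized i j k M) (h : evalMat M (topP n) = 0)
    {x x1 : GITQuotient 2 2 n} (hx : Represents M x)
    (hx1 : Represents (baseMat n !![1, 0; 0, 0]) x1) : x ∈ orbit (leviAct 2 2 n) x1 := by
  set y := M 1 (.inl i) with hy
  let g : Matrix (Fin 2) (Fin 2) ℂ := !![1, 0; -y, 1]
  have hg : g.det ≠ 0 := by simp [g]
  obtain ⟨T, hT0, hT1⟩ := exists_specialLinear_row (M 0 (.inl 0)) (M 0 (.inl 1)) (by
    have h1 := hM.zero_left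
    fin_cases i
    · exact Or.inl (h1 ▸ one_ne_zero)
    · exact Or.inr (h1 ▸ one_ne_zero))
  have hcol (r : Fin 2) : (g * M.toCols₂) r j = g r 0 ∧ (g * M.toCols₂) r k = g r 1 := by
    constructor <;> rw [Matrix.mul_apply, Fin.sum_univ_two] <;>
      simp [Matrix.toCols₂, hM.zero_j, hM.one_j, hM.zero_k, hM.one_k]
  obtain ⟨S, hS⟩ := exists_topRows_mul_eq (by omega) (g * M.toCols₂) (j := j) (k := k) (by
    rw [(hcol 0).1, (hcol 0).2, (hcol 1).1, (hcol 1).2, ← Matrix.det_fin_two]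
    exact hg)
  refine ⟨(T.transpose, S.transpose), Represents.eq hn (hx1.movePoint _) ?_⟩
  rw [baseMat_mul]
  have h2 : g * M.toCols₁ = !![1, 0; 0, 0] * T.1 := by
    ext r c
    have h3 := hM.row_eq h c
    rw [Matrix.mul_apply, Matrix.mul_apply, Fin.sum_univ_two, Fin.sum_univ_two]
    fin_cases r
    · fin_cases c
      · simp [g, Matrix.toCols₁, hT0]
      · simp [g, Matrix.toCols₁, hT1]
    · simp [g, Matrix.toCols₁, h3, hy]
  have h1 : Matrix.fromCols (!![1, 0; 0, 0] * T.transpose.1.transpose)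
      (topRows (n - 2) * S.transpose.1.transpose) = g * M := by
    conv_rhs => rw [← Matrix.fromCols_toCols M, Matrix.mul_fromCols]
    rw [h2, ← hS, Matrix.SpecialLinearGroup.coe_transpose, Matrix.SpecialLinearGroup.coe_transpose,
      Matrix.transpose_transpose, Matrix.transpose_transpose]
  exact h1 ▸ (represents_mul_iff hn hg M).2 hx

end PluckerGIT

/-! ### Points from prime ideals and specialization in `Proj` -/

namespace ProjCore

variable {A : Type} [CommRing A] [Algebra ℂ A] {𝒜 : ℕ → Submodule ℂ A} [GradedAlgebra 𝒜]

/-- The point of `Proj 𝒜` given by the homogeneous core of a prime ideal. -/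
def point (I : Ideal A) (hI : I.IsPrime) (h : ∃ d > 0, ∃ a ∈ 𝒜 d, a ∉ I) : Proj 𝒜 where
  asHomogeneousIdeal := I.homogeneousCore 𝒜
  isPrime := hI.homogeneousCore
  not_irrelevant_le h' := by
    obtain ⟨d, hd, a, ha, haI⟩ := h
    exact haI (I.toIdeal_homogeneousCore_le 𝒜 (h' (HomogeneousIdeal.mem_irrelevant_of_mem 𝒜 hd ha)))

lemma mem_point {I : Ideal A} {hI : I.IsPrime} {h : ∃ d > 0, ∃ a ∈ 𝒜 d, a ∉ I} {d : ℕ} {a : A}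
    (ha : a ∈ 𝒜 d) : a ∈ (point I hI h).asHomogeneousIdeal ↔ a ∈ I :=
  ⟨fun h' => I.toIdeal_homogeneousCore_le 𝒜 h',
    fun h' => Ideal.mem_homogeneousCore_of_homogeneous_of_mem ⟨d, ha⟩ h'⟩

/-- Specializations can be tested on elements of degrees divisible by `d`. -/
lemma mem_closure_point {x y : Proj 𝒜} {d : ℕ} (hd : 0 < d) {s : A} (hs : s ∈ 𝒜 d)
    (hsx : s ∉ y.asHomogeneousIdeal) :
    y ∈ closure {x} ↔ ∀ k, 0 < k → ∀ a ∈ 𝒜 (d * k), a ∈ x.asHomogeneousIdeal → a ∈ y.asHomogeneousIdeal := by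
  have h1 : y ∈ closure {x} ↔ x.asHomogeneousIdeal.toIdeal ≤ y.asHomogeneousIdeal.toIdeal :=
    (ProjectiveSpectrum.le_iff_mem_closure 𝒜 x y).symm
  rw [h1]
  refine ⟨fun h k _ a _ ha => h ha, fun h a ha => ?_⟩
  classical
  rw [← DirectSum.sum_support_decompose 𝒜 a]
  refine Ideal.sum_mem _ fun i _ => ?_
  have hi : (DirectSum.decompose 𝒜 a i : A) ∈ x.asHomogeneousIdeal.toIdeal :=
    x.asHomogeneousIdeal.isHomogeneous i ha
  have hi' := (DirectSum.decompose 𝒜 a i).2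
  set b : A := (DirectSum.decompose 𝒜 a i : A)
  -- Only positive multiples of `d` may be tested: `b ^ d * s` has degree `d * (i + 1)`, and `s`
  -- lies outside the prime.
  refine y.isPrime.mem_of_pow_mem d ((y.isPrime.mem_or_mem (x := b ^ d) (y := s) ?_).resolve_right hsx)
  refine h (i + 1) i.succ_pos _ ?_ (Ideal.mul_mem_right _ _ (Ideal.pow_mem_of_mem _ hi _ hd))
  rw [mul_add, mul_one]
  exact SetLike.mul_mem_graded (SetLike.pow_mem_graded d hi') hs

end ProjCore

/-! ### The boundary divisor -/

namespace PluckerGIT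

open MvPolynomial

variable {n : ℕ}

lemma evalMat_colSubst_map {K : Type} [CommRing K] [Algebra ℂ K] (M : Matrix (Fin 2) (Col 2 n) K)
    (g : Matrix (Col 2 n) (Col 2 n) ℂ) (f : MatPoly 2 2 n) :
    evalMat M (colSubst g f) = evalMat (M * (g.transpose.map (algebraMap ℂ K))) f := by
  refine DFunLike.congr_fun (algHom_ext (fun p => ?_) :
    (evalMat M).comp (colSubst g) = evalMat (M * (g.transpose.map (algebraMap ℂ K)))) f
  rw [AlgHom.comp_apply, colSubst, aeval_X, map_sum]
  simp only [evalMat, map_mul, aeval_X, algHom_C, Matrix.mul_apply, Matrix.transpose_apply,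
    Matrix.map_apply]
  exact Finset.sum_congr rfl fun k _ => mul_comm _ _

/-- The generic matrix whose first block is degenerate. -/
def degenMat (n : ℕ) : Matrix (Fin 2) (Col 2 n) (MatPoly 2 2 n) :=
  ![fun c => X (0, c), Sum.elim (fun b => X (1, .inl 0) * X (0, .inl b)) fun l => X (1, .inr l)]

/-- `degenMat` is universal: any matrix whose first block has second row proportional to the first,
with factor `y`, is a specialization of it. -/
lemma evalMat_eq_zero_of_degenMat {K : Type} [CommRing K] [Algebra ℂ K]
    {N : Matrix (Fin 2) (Col 2 n) K} {y : K} (hN : ∀ b, N 1 (.inl b) = y * N 0 (.inl b))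
    {f : MatPoly 2 2 n} (hf : evalMat (degenMat n) f = 0) : evalMat N f = 0 := by
  let φ : MatPoly 2 2 n →ₐ[ℂ] K := aeval fun p =>
    (![fun c => N 0 c, Sum.elim (fun _ => y) fun l => N 1 (.inr l)] : Fin 2 → Col 2 n → K) p.1 p.2
  have h : (degenMat n).map φ = N := by
    ext r c
    fin_cases r
    · exact aeval_X _ _
    · rcases c with b | l
      · exact (map_mul φ _ _).trans ((congrArg₂ (· * ·) (aeval_X _ _) (aeval_X _ _)).trans (hN b).symm)
      · exact aeval_X _ _
  rw [← h, evalMat_map, hf, map_zero]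

lemma isNormalized_baseMat (hn : 5 ≤ n) {P : Matrix (Fin 2) (Fin 2) ℂ} (hP : P 0 0 = 1) :
    IsNormalized 0 (⟨0, by omega⟩ : Fin (n - 2)) ⟨1, by omega⟩ (baseMat n P) := by
  constructor <;> simp [baseMat, topRows, hP]

/-- The invariants that vanish on matrices with degenerate first block. -/
def boundaryIdeal (n : ℕ) : Ideal (invariantRing 2 2 n) :=
  RingHom.ker ((evalMat (degenMat n)).comp (invariantRing 2 2 n).val)

lemma mem_boundaryIdeal {a : invariantRing 2 2 n} :
    a ∈ boundaryIdeal n ↔ evalMat (degenMat n) (a : MatPoly 2 2 n) = 0 := Iff.rfl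

lemma isPrime_boundaryIdeal : (boundaryIdeal n).IsPrime := RingHom.ker_isPrime _

lemma exists_notMem_boundaryIdeal (hn : 5 ≤ n) :
    ∃ d > 0, ∃ a ∈ invGrading 2 2 n d, a ∉ boundaryIdeal n := by
  refine ⟨n, by omega, mixBot (by omega) 0 ⟨1, by omega⟩ ⟨0, by omega⟩ ⟨1, by omega⟩,
    mixBot_mem _ _ _ _ _, fun h => ?_⟩
  have h1 := (isNormalized_baseMat hn (P := !![1, 0; 0, 0]) rfl).evalMat_mixBot (by omega)
  rw [evalMat_eq_zero_of_degenMat (y := 0) (fun b => ?_) (mem_boundaryIdeal.1 h)] at h1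
  · exact zero_ne_one h1
  · fin_cases b <;> simp [baseMat]

/-- The generic point of the boundary divisor. -/
def boundaryPoint (hn : 5 ≤ n) : GITQuotient 2 2 n :=
  ProjCore.point (boundaryIdeal n) isPrime_boundaryIdeal (exists_notMem_boundaryIdeal hn)

/-- The boundary divisor. -/
def boundary (hn : 5 ≤ n) : Closeds (GITQuotient 2 2 n) := ⟨closure {boundaryPoint hn}, isClosed_closure⟩

lemma isIrreducible_boundary (hn : 5 ≤ n) : IsIrreducible (boundary hn : Set (GITQuotient 2 2 n)) :=
  isIrreducible_singleton.closure

lemma mem_boundary_iff (hn : 5 ≤ n) {x : GITQuotient 2 2 n} : x ∈ boundary hn ↔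
    ∀ m, 0 < m → ∀ a ∈ invGrading 2 2 n (n * m), evalMat (degenMat n) (a : MatPoly 2 2 n) = 0 →
      a ∈ x.asHomogeneousIdeal := by
  obtain ⟨i, j, k, hjk, h⟩ := exists_chart hn x
  refine (ProjCore.mem_closure_point (x := boundaryPoint hn) (by omega) (mixBot_mem _ i k j k) h).trans ?_
  refine forall_congr' fun m => forall_congr' fun _ => forall_congr' fun a => forall_congr' fun ha => ?_
  exact imp_congr (ProjCore.mem_point ha) Iff.rfl

lemma topP_sq_mul_mem (j k : Fin (n - 2)) :
    topP n ^ 2 * botP j k ^ (n - 2) ∈ topSpan n ^ 2 * mixSpan n ^ 0 * botSpan n ^ (n - 2) := by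
  rw [pow_zero, mul_one]
  exact Submodule.mul_mem_mul (Submodule.pow_mem_pow _ topP_mem _) (Submodule.pow_mem_pow _ (botP_mem _ _) _)

/-- The invariant `p₁₂² p_{jk}ⁿ⁻²`. -/
def topBot (hn : 4 ≤ n) (j k : Fin (n - 2)) : invariantRing 2 2 n :=
  ⟨topP n ^ 2 * botP j k ^ (n - 2), span_le_invariantRing (by omega) (by
    obtain ⟨l, rfl⟩ := Nat.exists_eq_add_of_le hn
    have : 4 + l - 2 = l + 2 := by omega
    rw [this]
    ring) (topP_sq_mul_mem j k)⟩

lemma topBot_mem (hn : 4 ≤ n) (j k : Fin (n - 2)) : topBot hn j k ∈ invGrading 2 2 n (n * 1) := by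
  have h := span_le_homogeneous (n := n) _ _ _ (topP_sq_mul_mem j k)
  have h1 : 2 + 0 + (n - 2) = n * 1 := by omega
  rw [h1] at h
  exact h

lemma topBot_mem_of_mem_boundary (hn : 5 ≤ n) {x : GITQuotient 2 2 n} (hx : x ∈ boundary hn)
    (j k : Fin (n - 2)) : topBot (by omega) j k ∈ x.asHomogeneousIdeal := by
  refine (mem_boundary_iff hn).1 hx 1 one_pos _ (topBot_mem (by omega) j k) ?_
  change evalMat (degenMat n) (topP n ^ 2 * botP j k ^ (n - 2)) = 0
  rw [map_mul, map_pow, evalMat_topP]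
  have : degenMat n 0 (.inl 0) * degenMat n 1 (.inl 1) - degenMat n 0 (.inl 1) * degenMat n 1 (.inl 0) = 0 := by
    simp only [degenMat, Matrix.cons_val_zero, Matrix.cons_val_one, Sum.elim_inl]
    ring
  rw [this, zero_pow two_ne_zero, zero_mul]

lemma IsNormalized.evalMat_topBot {K : Type} [CommRing K] [Algebra ℂ K] {i : Fin 2}
    {j k : Fin (n - 2)} {N : Matrix (Fin 2) (Col 2 n) K} (hN : IsNormalized i j k N) (hn : 4 ≤ n) :
    evalMat N (topBot hn j k : MatPoly 2 2 n) = evalMat N (topP n) ^ 2 := by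
  change evalMat N (topP n ^ 2 * botP j k ^ (n - 2)) = _
  rw [map_mul, map_pow, map_pow, hN.evalMat_botP, one_pow, mul_one]

/-- The invariant `p₁₂² p_{jk}ⁿ⁻²` vanishes on the boundary and equals `p₁₂²` on the chart.
Conversely, modulo a prime containing `p₁₂` the normalized matrix has degenerate first block, so it
is a specialization of `degenMat`. -/
lemma ι_mem_boundary_iff (hn : 5 ≤ n) (i : Fin 2) {j k : Fin (n - 2)} (hjk : j ≠ k)
    (q : Spec (.of (ChartRing i j k))) : (quotientChart hn i hjk).ι q ∈ boundary hn ↔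
      evalMat (chartMat i j k) (topP n) ∈ q.asIdeal := by
  have hN := isNormalized_chartMat i hjk
  constructor
  · intro h
    have h1 := topBot_mem_of_mem_boundary hn h j k
    rw [(quotientChart hn i hjk).ι_mem (by omega) (topBot_mem (by omega) j k)] at h1
    refine q.isPrime.mem_of_pow_mem 2 ?_
    rw [← hN.evalMat_topBot (by omega)]
    exact h1
  · intro h
    rw [mem_boundary_iff]
    intro m hm a ha h0
    rw [(quotientChart hn i hjk).ι_mem (Nat.mul_pos (by omega) hm) ha]
    let φ := Ideal.Quotient.mkₐ ℂ q.asIdeal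
    have hφ := hN.map φ
    have h1 : evalMat ((chartMat i j k).map φ) (topP n) = 0 := by
      rw [evalMat_map]
      exact Ideal.Quotient.eq_zero_iff_mem.2 h
    have h2 := evalMat_eq_zero_of_degenMat (hφ.row_eq h1) h0
    rw [evalMat_map] at h2
    exact Ideal.Quotient.eq_zero_iff_mem.1 h2

lemma Represents.mem_boundary_iff (hn : 5 ≤ n) {i : Fin 2} {j k : Fin (n - 2)}
    {M : Matrix (Fin 2) (Col 2 n) ℂ} (hM : IsNormalized i j k M) {x : GITQuotient 2 2 n}
    (hx : Represents M x) : x ∈ boundary hn ↔ evalMat M (topP n) = 0 := by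
  constructor
  · intro h
    have h1 := topBot_mem_of_mem_boundary hn h j k
    rw [hx 1 one_pos _ (topBot_mem (by omega) j k), hM.evalMat_topBot] at h1
    exact pow_eq_zero_iff two_ne_zero |>.1 h1
  · intro h
    rw [PluckerGIT.mem_boundary_iff]
    intro m hm a ha h0
    rw [hx m hm a ha]
    exact evalMat_eq_zero_of_degenMat (hM.row_eq h) h0

/-- Block diagonal column operations preserve proportionality of the two rows of the first block,
with the same factor. -/
lemma movePoint_mem_boundary (hn : 5 ≤ n) (h : LeviSS 2 n) {x : GITQuotient 2 2 n}
    (hx : x ∈ boundary hn) : movePoint (leviAct 2 2 n) h x ∈ boundary hn := by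
  rw [mem_boundary_iff] at hx ⊢
  intro m hm a ha h0
  refine mem_movePoint.2 (hx m hm _ ((leviGradedHom h).map_mem ha) ?_)
  change evalMat (degenMat n) (colSubst (leviMatrix h) (a : MatPoly 2 2 n)) = 0
  rw [evalMat_colSubst_map]
  refine evalMat_eq_zero_of_degenMat (y := X (1, .inl 0)) (fun b => ?_) h0
  rw [Matrix.mul_apply, Matrix.mul_apply, Fintype.sum_sum_type, Fintype.sum_sum_type]
  simp only [Matrix.map_apply, Matrix.transpose_apply, leviMatrix, Matrix.fromBlocks_apply₁₁,
    Matrix.fromBlocks_apply₁₂, Matrix.zero_apply, map_zero, mul_zero, Finset.sum_const_zero, add_zero,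
    Finset.mul_sum, degenMat, Matrix.cons_val_zero, Matrix.cons_val_one, Sum.elim_inl]
  exact Finset.sum_congr rfl fun _ _ => by ring

end PluckerGIT

/-! ### The two orbits and the wonderful structure -/

namespace PluckerGIT

section Orbit

variable {G : Type} [Group G] {X : Scheme.{0}} (act : G →* End X)

lemma movePoint_one (x : X) : movePoint act 1 x = x := by
  rw [movePoint, map_one]
  rfl

lemma movePoint_mul (g h : G) (x : X) :
    movePoint act (g * h) x = movePoint act g (movePoint act h x) := by
  rw [movePoint, map_mul]
  rfl

lemma isClosed_movePoint {x : X} (hx : IsClosed {x}) (g : G) : IsClosed {movePoint act g x} := by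
  have h : (End.asHom (act g⁻¹)) ⁻¹' {x} = {movePoint act g x} := by
    ext y
    constructor
    · intro hy
      have hy' : movePoint act g⁻¹ y = x := hy
      rw [Set.mem_singleton_iff, ← hy', ← movePoint_mul, mul_inv_cancel, movePoint_one]
    · rintro rfl
      change movePoint act g⁻¹ (movePoint act g x) = x
      rw [← movePoint_mul, inv_mul_cancel, movePoint_one]
  rw [← h]
  exact hx.preimage (End.asHom (act g⁻¹)).continuous

lemma mem_orbit_self (x : X) : x ∈ orbit act x := ⟨1, movePoint_one act x⟩

lemma orbit_eq_of_mem {x y : X} (h : y ∈ orbit act x) : orbit act y = orbit act x := by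
  obtain ⟨g, rfl⟩ := h
  ext z
  constructor
  · rintro ⟨h, rfl⟩
    exact ⟨h * g, movePoint_mul act h g x⟩
  · rintro ⟨h, rfl⟩
    refine ⟨h * g⁻¹, ?_⟩
    change movePoint act (h * g⁻¹) (movePoint act g x) = movePoint act h x
    rw [← movePoint_mul, inv_mul_cancel_right]

end Orbit

variable {n : ℕ}

/-- The zero ideal of the domain of invariants gives a point whose closure is everything;
reducedness is inherited from the charts. -/
lemma isIntegral_quotient (hn : 5 ≤ n) : IsIntegral (GITQuotient 2 2 n) := by
  have := isReduced_quotient hn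
  obtain ⟨d, hd, a, ha, h⟩ := exists_notMem_boundaryIdeal hn
  have hbot : (⊥ : Ideal (invariantRing 2 2 n)).IsPrime := Ideal.isPrime_bot
  have ha0 : a ∉ (⊥ : Ideal (invariantRing 2 2 n)) := fun h0 =>
    h ((Ideal.mem_bot.1 h0) ▸ zero_mem _)
  let η : GITQuotient 2 2 n := ProjCore.point ⊥ hbot ⟨d, hd, a, ha, ha0⟩
  have h1 : closure {η} = Set.univ := by
    refine Set.eq_univ_of_forall fun x => ?_
    obtain ⟨i, j, k, hjk, h⟩ := exists_chart hn x
    refine (ProjCore.mem_closure_point (by omega) (mixBot_mem _ i k j k) h).2 fun m _ b hb h0 => ?_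
    rw [Ideal.mem_bot.1 ((ProjCore.mem_point hb).1 h0)]
    exact zero_mem _
  have : IrreducibleSpace (GITQuotient 2 2 n) :=
    { isPreirreducible_univ := h1 ▸ isIrreducible_singleton.closure.isPreirreducible
      toNonempty := ⟨η⟩ }
  exact isIntegral_of_irreducibleSpace_of_isReduced _

/-- Representatives of the two orbits. -/
lemma exists_orbit_representatives (hn : 5 ≤ n) : ∃ x0 x1 : GITQuotient 2 2 n,
    IsClosed {x0} ∧ IsClosed {x1} ∧ x0 ∉ boundary hn ∧ x1 ∈ boundary hn ∧
      (∀ y, IsClosed {y} → y ∉ boundary hn → y ∈ orbit (leviAct 2 2 n) x0) ∧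
      ∀ y, IsClosed {y} → y ∈ boundary hn → y ∈ orbit (leviAct 2 2 n) x1 := by
  obtain ⟨x0, h0, hx0⟩ := exists_represents_baseMat hn (P := 1) rfl
  obtain ⟨x1, h1, hx1⟩ := exists_represents_baseMat hn (P := !![1, 0; 0, 0]) rfl
  refine ⟨x0, x1, h0, h1, fun h => ?_, ?_, fun y hy hyD => ?_, fun y hy hyD => ?_⟩
  · rw [hx0.mem_boundary_iff hn (isNormalized_baseMat hn rfl), evalMat_topP] at h
    simp [baseMat] at h
  · rw [hx1.mem_boundary_iff hn (isNormalized_baseMat hn rfl), evalMat_topP]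
    simp [baseMat]
  · obtain ⟨i, j, k, M, -, hM, hyM⟩ := exists_represents hn hy
    exact hM.mem_orbit_of_ne_zero hn (fun h => hyD ((hyM.mem_boundary_iff hn hM).2 h)) hyM hx0
  · obtain ⟨i, j, k, M, -, hM, hyM⟩ := exists_represents hn hy
    exact hM.mem_orbit_of_eq_zero hn ((hyM.mem_boundary_iff hn hM).1 hyD) hyM hx1

lemma movePoint_notMem_boundary (hn : 5 ≤ n) (h : LeviSS 2 n) {x : GITQuotient 2 2 n}
    (hx : x ∉ boundary hn) : movePoint (leviAct 2 2 n) h x ∉ boundary hn := fun h1 => hx <| by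
  have h2 := movePoint_mem_boundary hn h⁻¹ h1
  rwa [← movePoint_mul, inv_mul_cancel, movePoint_one] at h2

/-- The two orbits. -/
lemma exists_orbits_eq (hn : 5 ≤ n) : ∃ x0 x1 : GITQuotient 2 2 n,
    IsClosed {x0} ∧ IsClosed {x1} ∧
      orbit (leviAct 2 2 n) x0 = {y | IsClosed {y} ∧ y ∉ boundary hn} ∧
      orbit (leviAct 2 2 n) x1 = {y | IsClosed {y} ∧ y ∈ boundary hn} ∧
      (∀ y, IsClosed {y} → orbit (leviAct 2 2 n) y = orbit (leviAct 2 2 n) x0 ∨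
        orbit (leviAct 2 2 n) y = orbit (leviAct 2 2 n) x1) ∧
      orbit (leviAct 2 2 n) x0 ≠ orbit (leviAct 2 2 n) x1 := by
  obtain ⟨x0, x1, h0, h1, h0D, h1D, hD0, hD1⟩ := exists_orbit_representatives hn
  have e0 : orbit (leviAct 2 2 n) x0 = {y | IsClosed {y} ∧ y ∉ boundary hn} := by
    refine Set.Subset.antisymm ?_ fun y hy => hD0 y hy.1 hy.2
    rintro _ ⟨g, rfl⟩
    exact ⟨isClosed_movePoint _ h0 g, movePoint_notMem_boundary hn g h0D⟩
  have e1 : orbit (leviAct 2 2 n) x1 = {y | IsClosed {y} ∧ y ∈ boundary hn} := by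
    refine Set.Subset.antisymm ?_ fun y hy => hD1 y hy.1 hy.2
    rintro _ ⟨g, rfl⟩
    exact ⟨isClosed_movePoint _ h1 g, movePoint_mem_boundary hn g h1D⟩
  refine ⟨x0, x1, h0, h1, e0, e1, fun y hy => ?_, fun h => ?_⟩
  · by_cases hyD : y ∈ boundary hn
    · exact Or.inr (orbit_eq_of_mem _ (hD1 y hy hyD))
    · exact Or.inl (orbit_eq_of_mem _ (hD0 y hy hyD))
  · have h2 := mem_orbit_self (leviAct 2 2 n) x1
    rw [← h, e0] at h2
    exact h2.2 h1D

lemma closure_closed_inter_boundary (hn : 5 ≤ n) :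
    closure {y | IsClosed {y} ∧ y ∈ boundary hn} = (boundary hn : Set (GITQuotient 2 2 n)) := by
  have := jacobsonSpace_quotient hn
  have h := closure_inter_closedPoints (boundary hn).isClosed
  rw [Set.inter_comm] at h
  exact h

/-- A nonempty open subset of an irreducible space is dense, and in a Jacobson space its closed
points are dense in it. -/
lemma dense_closed_diff_boundary (hn : 5 ≤ n) :
    Dense {y : GITQuotient 2 2 n | IsClosed {y} ∧ y ∉ boundary hn} := by
  have := jacobsonSpace_quotient hn
  have := isIntegral_quotient hn
  have ho : IsOpen ((boundary hn : Set (GITQuotient 2 2 n))ᶜ) := (boundary hn).isClosed.isOpen_compl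
  have h := JacobsonSpace.closure_inter_closedPoints_eq_closure ho.isLocallyClosed
  obtain ⟨x0, -, -, -, h0D, -⟩ := exists_orbit_representatives hn
  rw [(ho.dense ⟨x0, h0D⟩).closure_eq, Set.inter_comm] at h
  exact dense_iff_closure_eq.2 h

lemma ncard_orbits (hn : 5 ≤ n) : (orbits (leviAct 2 2 n)).ncard = 2 := by
  obtain ⟨x0, x1, h0, h1, -, -, h, hne⟩ := exists_orbits_eq hn
  have : orbits (leviAct 2 2 n) = {orbit (leviAct 2 2 n) x0, orbit (leviAct 2 2 n) x1} := by
    ext O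
    constructor
    · rintro ⟨y, hy, rfl⟩
      exact h y hy
    · rintro (rfl | rfl)
      · exact ⟨x0, h0, rfl⟩
      · exact ⟨x1, h1, rfl⟩
  rw [this, Set.ncard_pair hne]

lemma iInter_boundary (hn : 5 ≤ n) (I : Finset (Fin 1)) :
    (⋂ i ∈ I, ((fun _ => boundary hn : Fin 1 → Closeds (GITQuotient 2 2 n)) i : Set _)) =
      if 0 ∈ I then (boundary hn : Set (GITQuotient 2 2 n)) else Set.univ := by
  split_ifs with h
  · ext y
    simp only [Set.mem_iInter]
    exact ⟨fun h' => h' 0 h, fun h' _ _ => h'⟩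
  · refine Set.eq_univ_of_forall fun y => ?_
    simp only [Set.mem_iInter]
    intro i hi
    rw [Subsingleton.elim i 0] at hi
    exact absurd hi h

/-- With one divisor the only intersections are `X` and the divisor, and these are the closures of
the two orbits. -/
lemma isWonderful_quotient (hn : 5 ≤ n)
    (hnc : ∀ x : GITQuotient 2 2 n, IsClosed {x} →
      IsNormalCrossingAt (fun _ => boundary hn : Fin 1 → Closeds (GITQuotient 2 2 n)) x) :
    IsWonderful (leviCoord 2 n) (quotientToSpec 2 2 n) (leviAct 2 2 n)
      (fun _ => boundary hn : Fin 1 → Closeds (GITQuotient 2 2 n)) := by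
  obtain ⟨x0, x1, h0, h1, e0, e1, h, -⟩ := exists_orbits_eq hn
  have c0 : closure (orbit (leviAct 2 2 n) x0) = Set.univ := by
    rw [e0]; exact (dense_closed_diff_boundary hn).closure_eq
  have c1 : closure (orbit (leviAct 2 2 n) x1) = boundary hn := by
    rw [e1]; exact closure_closed_inter_boundary hn
  exact
  { integral := isIntegral_quotient hn
    smooth := smooth_quotientToSpec hn
    projective := isProjective_quotientToSpec (by omega)
    algebraic := isAlgebraicAction_leviAct 2 2 n
    open_orbit := by
      refine ⟨x0, h0, dense_iff_closure_eq.2 c0, e0.trans ?_⟩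
      ext y
      exact and_congr_right fun _ => ⟨fun h _ => h, fun h => h 0⟩
    irreducible := fun _ => isIrreducible_boundary hn
    stable := fun _ g x hx => movePoint_mem_boundary hn g hx
    normal_crossing := hnc
    inter_eq := fun I => by
      by_cases hI : 0 ∈ I
      · exact ⟨x1, h1, by rw [iInter_boundary, if_pos hI, c1]⟩
      · exact ⟨x0, h0, by rw [iInter_boundary, if_neg hI, c0]⟩
    closure_eq := fun y hy => by
      rcases h y hy with h | h
      · exact ⟨∅, by rw [iInter_boundary, if_neg (Finset.notMem_empty _), h, c0]⟩
      · exact ⟨{0}, by rw [iInter_boundary, if_pos (Finset.mem_singleton_self _), h, c1]⟩ }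

end PluckerGIT

/-! ### Ideals and stalks in an affine chart -/

section Chart

variable {X : Scheme.{0}} {L : Type} [CommRing L] (ι : Spec (.of L) ⟶ X) [IsOpenImmersion ι]

/-- The functions on the image of an affine chart. -/
def chartSections : Γ(X, ι ''ᵁ ⊤) ≃+* L :=
  (ι.appIso ⊤ ≪≫ Scheme.ΓSpecIso (.of L)).commRingCatIsoToRingEquiv

lemma mem_basicOpen_iff_chartSections (s : Γ(X, ι ''ᵁ ⊤)) (q : Spec (.of L)) :
    ι q ∈ X.basicOpen s ↔ chartSections ι s ∉ q.asIdeal := by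
  have h1 := Scheme.basicOpen_appLE ι ⊤ (ι ''ᵁ ⊤) (ι.preimage_image_eq ⊤).ge s
  rw [← Scheme.Hom.appIso_hom', basicOpen_eq_of_affine', top_inf_eq] at h1
  have h2 : q ∈ ι ⁻¹ᵁ X.basicOpen s ↔ q ∈ PrimeSpectrum.basicOpen
      ((Scheme.ΓSpecIso (.of L)).hom ((ι.appIso ⊤).hom s)) := h1 ▸ Iff.rfl
  exact h2

lemma isAffineOpen_chart : IsAffineOpen (ι ''ᵁ ⊤) := (isAffineOpen_top _).image_of_isOpenImmersion ι

/-- The image of an affine chart. -/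
abbrev chartOpen : X.affineOpens := ⟨ι ''ᵁ ⊤, isAffineOpen_chart ι⟩

lemma mem_chartOpen (q : Spec (.of L)) : ι q ∈ ι ''ᵁ ⊤ := ⟨q, trivial, rfl⟩

lemma mem_asIdeal_iff_fromSpec {U : X.Opens} (hU : IsAffineOpen U) (s : Γ(X, U)) (p : Spec Γ(X, U)) :
    s ∈ p.asIdeal ↔ hU.fromSpec p ∉ X.basicOpen s := by
  have h1 : p ∈ hU.fromSpec ⁻¹ᵁ X.basicOpen s ↔ s ∉ p.asIdeal :=
    (hU.fromSpec_preimage_basicOpen s) ▸ Iff.rfl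
  exact (not_iff_comm.1 h1.symm).symm

/-- A function vanishing on all of `D` vanishes at the point `(δ)` of the chart, which is to say
that it is divisible by `δ`. Primality thus makes the equation reduced. -/
lemma vanishingIdeal_chartOpen {D : Closeds X} {δ : L} (hδ : (Ideal.span {δ}).IsPrime)
    (hD : ∀ q, ι q ∈ D ↔ δ ∈ q.asIdeal) :
    (Scheme.IdealSheafData.vanishingIdeal D).ideal (chartOpen ι) =
      Ideal.span {(chartSections ι).symm δ} := by
  have key : ∀ s, s ∈ (Scheme.IdealSheafData.vanishingIdeal D).ideal (chartOpen ι) ↔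
      ∀ q : Spec (.of L), δ ∈ q.asIdeal → chartSections ι s ∈ q.asIdeal := by
    intro s
    rw [Scheme.IdealSheafData.vanishingIdeal_ideal, PrimeSpectrum.mem_vanishingIdeal]
    have hr := (isAffineOpen_chart ι).range_fromSpec
    constructor
    · intro h q hq
      obtain ⟨p, hp⟩ := hr.ge (mem_chartOpen ι q)
      have h1 := (mem_asIdeal_iff_fromSpec (isAffineOpen_chart ι) s p).1
        (h p (show (isAffineOpen_chart ι).fromSpec p ∈ D from hp ▸ (hD q).2 hq))
      rw [hp] at h1
      exact not_not.1 (fun h2 => h1 ((mem_basicOpen_iff_chartSections ι s q).2 h2))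
    · intro h p hp
      refine (mem_asIdeal_iff_fromSpec (isAffineOpen_chart ι) s p).2 ?_
      obtain ⟨q, -, hq⟩ := hr.le ⟨p, rfl⟩
      have hq' : ι q = (isAffineOpen_chart ι).fromSpec p := hq
      have hp' : (isAffineOpen_chart ι).fromSpec p ∈ D := hp
      rw [← hq', hD] at hp'
      rw [← hq']
      exact fun h1 => (mem_basicOpen_iff_chartSections ι s q).1 h1 (h q hp')
  ext s
  rw [key, Ideal.mem_span_singleton]
  constructor
  · intro h
    obtain ⟨b, hb⟩ := Ideal.mem_span_singleton.1 (h ⟨Ideal.span {δ}, hδ⟩ (Ideal.mem_span_singleton_self δ))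
    exact ⟨(chartSections ι).symm b, by rw [← map_mul, ← hb, RingEquiv.symm_apply_apply]⟩
  · rintro ⟨b, rfl⟩ q hq
    rw [map_mul, RingEquiv.apply_symm_apply]
    exact Ideal.mul_mem_right _ _ hq

/-- Homomorphisms from the ring of a chart extend to stalks. -/
lemma exists_stalk_lift {q : Spec (.of L)} {P : Type} [CommRing P] (φ : L →+* P)
    (hφ : ∀ l, l ∉ q.asIdeal → IsUnit (φ l)) :
    ∃ ψ : X.presheaf.stalk (ι q) →+* P,
      ∀ s, ψ (X.presheaf.germ (ι ''ᵁ ⊤) (ι q) (mem_chartOpen ι q) s) = φ (chartSections ι s) := by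
  have hU := isAffineOpen_chart ι
  let x : (ι ''ᵁ ⊤ : X.Opens) := ⟨ι q, mem_chartOpen ι q⟩
  let := X.presheaf.algebra_section_stalk x
  have := hU.isLocalization_stalk x
  let g : Γ(X, ι ''ᵁ ⊤) →+* P := φ.comp (chartSections ι : Γ(X, ι ''ᵁ ⊤) →+* L)
  have hu : ∀ s : (hU.primeIdealOf x).asIdeal.primeCompl, IsUnit (g s) := by
    rintro ⟨s, hs⟩
    refine hφ _ ((mem_basicOpen_iff_chartSections ι s q).1 ?_)
    have h1 := (mem_asIdeal_iff_fromSpec hU s (hU.primeIdealOf x)).not.1 hs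
    rw [IsAffineOpen.fromSpec_primeIdealOf] at h1
    exact not_not.1 h1
  exact ⟨IsLocalization.lift (S := X.presheaf.stalk x.1) hu, fun s => IsLocalization.lift_eq hu s⟩

end Chart

/-- The map `ψ` is a tangent vector: it sends the maximal ideal to multiples of `ε` and hence kills
its square. If `a` were a unit, `ψ (a * d) = 0` would force `ψ d = 0`. -/
lemma mem_maximalIdeal_of_mul_mem_sq {S : Type} [CommRing S] [IsLocalRing S]
    (ψ : S →+* DualNumber ℂ) (hψ : ∀ z : ℂ, ∃ s, (ψ s).fst = z) {a d : S} (hd : ψ d ≠ 0)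
    (h : a * d ∈ IsLocalRing.maximalIdeal S ^ 2) : a ∈ IsLocalRing.maximalIdeal S := by
  let χ : S →+* ℂ := (TrivSqZeroExt.fstHom ℂ ℂ ℂ).toRingHom.comp ψ
  have hχ : RingHom.ker χ = IsLocalRing.maximalIdeal S :=
    have := RingHom.ker_isMaximal_of_surjective χ hψ
    IsLocalRing.eq_maximalIdeal this
  have h0 : ψ (a * d) = 0 := by
    rw [pow_two] at h
    refine Submodule.mul_induction_on h (fun u hu v hv => ?_) fun u v hu hv => ?_
    · rw [← hχ] at hu hv
      have hu' : (ψ u).fst = 0 := hu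
      have hv' : (ψ v).fst = 0 := hv
      rw [map_mul]
      ext
      · simp [hu']
      · simp [hu', hv']
    · rw [map_add, hu, hv, add_zero]
  by_contra ha
  rw [← hχ] at ha
  have hu : IsUnit (ψ a) := TrivSqZeroExt.isUnit_iff_isUnit_fst.2 (isUnit_iff_ne_zero.2 ha)
  rw [map_mul] at h0
  exact hd ((hu.mul_right_eq_zero).1 h0)

/-! ### Smoothness of the boundary divisor -/

namespace PluckerGIT

lemma isNormalCrossingAt_of_notMem {X : Scheme.{0}} {k : ℕ} {D : Fin k → Closeds X} {x : X}
    (h : ∀ i, x ∉ D i) : IsNormalCrossingAt D x := by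
  obtain ⟨_, ⟨U, hU, rfl⟩, hxU, -⟩ :=
    X.isBasis_affineOpens.exists_subset_of_mem_open (Set.mem_univ x) isOpen_univ
  exact ⟨⟨U, hU⟩, hxU, fun i => absurd i.2 (h i.1), fun i => absurd i.2 (h i.1),
    fun _ _ i => absurd i.2 (h i.1)⟩

/-- A prime divisor with an equation that does not vanish on some tangent vector. -/
lemma isNormalCrossingAt_of_chart {X : Scheme.{0}} {L : Type} [CommRing L]
    (ι : Spec (.of L) ⟶ X) [IsOpenImmersion ι] {D : Closeds X} {δ : L}
    (hδ : (Ideal.span {δ}).IsPrime) (hD : ∀ q, ι q ∈ D ↔ δ ∈ q.asIdeal) {q : Spec (.of L)}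
    (φ : L →+* DualNumber ℂ) (hφ : ∀ l, l ∉ q.asIdeal → (φ l).fst ≠ 0)
    (hs : ∀ z : ℂ, ∃ l, (φ l).fst = z) (hφδ : φ δ ≠ 0) :
    IsNormalCrossingAt (fun _ => D : Fin 1 → Closeds X) (ι q) := by
  obtain ⟨ψ, hψ⟩ := exists_stalk_lift ι φ fun l hl =>
    TrivSqZeroExt.isUnit_iff_isUnit_fst.2 (isUnit_iff_ne_zero.2 (hφ l hl))
  refine ⟨chartOpen ι, mem_chartOpen ι q, fun _ => (chartSections ι).symm δ,
    fun _ => vanishingIdeal_chartOpen ι hδ hD, fun a ha i => ?_⟩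
  classical
  rw [Fintype.sum_subsingleton _ i] at ha
  refine mem_maximalIdeal_of_mul_mem_sq ψ (fun z => ?_) ?_ ha
  · obtain ⟨l, hl⟩ := hs z
    exact ⟨X.presheaf.germ _ (ι q) (mem_chartOpen ι q) ((chartSections ι).symm l), by
      rw [hψ, RingEquiv.apply_symm_apply, hl]⟩
  · rw [hψ, RingEquiv.apply_symm_apply]
    exact hφδ

open MvPolynomial

variable {n : ℕ}

/-- Add `c` to the entry in the second row and in the column of the first block other than `i`. -/
def addEntry {K : Type} [CommRing K] (i : Fin 2) (c : K) (N : Matrix (Fin 2) (Col 2 n) K) :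
    Matrix (Fin 2) (Col 2 n) K :=
  N.updateRow 1 (Function.update (N 1) (.inl (1 - i)) (N 1 (.inl (1 - i)) + c))

lemma IsNormalized.addEntry {K : Type} [CommRing K] {i : Fin 2} {j k : Fin (n - 2)}
    {N : Matrix (Fin 2) (Col 2 n) K} (hN : IsNormalized i j k N) (c : K) :
    IsNormalized i j k (addEntry i c N) := by
  constructor <;> simp [PluckerGIT.addEntry, hN.zero_left, hN.zero_j, hN.one_j, hN.zero_k, hN.one_k]

/-- `p₁₂` is affine linear in the altered entry, with coefficient `± N (0, i) = ± 1`; the sign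
depends on which column of the first block is `i`. -/
lemma IsNormalized.evalMat_topP_addEntry {K : Type} [CommRing K] [Algebra ℂ K] {i : Fin 2}
    {j k : Fin (n - 2)} {N : Matrix (Fin 2) (Col 2 n) K} (hN : IsNormalized i j k N) (c : K) :
    evalMat (PluckerGIT.addEntry i c N) (topP n) = evalMat N (topP n) + (if i = 0 then c else -c) := by
  have h := hN.zero_left
  rw [evalMat_topP, evalMat_topP]
  fin_cases i
  · simp [PluckerGIT.addEntry] at h ⊢
    rw [h]
    ring
  · simp [PluckerGIT.addEntry] at h ⊢
    rw [h]
    ring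

/-- The equation of the boundary divisor in a chart. -/
abbrev boundaryEq (i : Fin 2) (j k : Fin (n - 2)) : ChartRing i j k := evalMat (chartMat i j k) (topP n)

/-- The universal normalized matrix with degenerate first block. -/
def degenChartMat (i : Fin 2) (j k : Fin (n - 2)) : Matrix (Fin 2) (Col 2 n) (ChartRing i j k) :=
  addEntry i (if i = 0 then - boundaryEq i j k else boundaryEq i j k) (chartMat i j k)

/-- Correcting one free entry so that `p₁₂` becomes zero defines an endomorphism of the polynomial
ring. Its kernel is prime and is shown to be generated by `p₁₂`. -/
lemma isPrime_span_boundaryEq (i : Fin 2) {j k : Fin (n - 2)} (hjk : j ≠ k) :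
    (Ideal.span {boundaryEq i j k}).IsPrime := by
  have hN := isNormalized_chartMat i hjk
  have hN' : IsNormalized i j k (degenChartMat i j k) := hN.addEntry _
  suffices h : Ideal.span {boundaryEq i j k} = RingHom.ker (chartSpec i j k (degenChartMat i j k)) by
    rw [h]; exact RingHom.ker_isPrime _
  refine le_antisymm ((Ideal.span_singleton_le_iff_mem _).2 ?_) fun l hl => ?_
  · rw [RingHom.mem_ker, ← hN'.evalMat_eq hjk, degenChartMat, hN.evalMat_topP_addEntry]
    split_ifs <;> ring
  -- The correction is a multiple of `p₁₂`, so the substitution is the identity modulo `p₁₂`, and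
  -- whatever it kills is zero in the quotient.
  · let π := Ideal.Quotient.mkₐ ℂ (Ideal.span {boundaryEq i j k})
    have hπ : π (boundaryEq i j k) = 0 :=
      Ideal.Quotient.eq_zero_iff_mem.2 (Ideal.mem_span_singleton_self _)
    have h1 : π.comp (chartSpec i j k (degenChartMat i j k)) = π := by
      refine algHom_ext fun p => ?_
      rw [AlgHom.comp_apply, chartSpec, aeval_X]
      have h2 : (X p : ChartRing i j k) = chartMat i j k p.1.1 p.1.2 := by
        rw [chartMat, dif_pos p.2]
      rw [h2]
      obtain ⟨⟨r, c⟩, hp⟩ := p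
      change π (degenChartMat i j k r c) = π (chartMat i j k r c)
      rw [degenChartMat, addEntry, Matrix.updateRow_apply]
      split_ifs with hr h0 <;> try rfl
      all_goals
        subst hr
        rw [Function.update_apply]
        split_ifs with hc
        · subst hc
          simp [hπ]
        · rfl
    have h3 := DFunLike.congr_fun h1 l
    rw [AlgHom.comp_apply, (RingHom.mem_ker).1 hl, map_zero] at h3
    exact Ideal.Quotient.eq_zero_iff_mem.1 h3.symm

lemma isNormalCrossingAt_boundary (hn : 5 ≤ n) {x : GITQuotient 2 2 n} (hx : IsClosed {x}) :
    IsNormalCrossingAt (fun _ => boundary hn : Fin 1 → Closeds (GITQuotient 2 2 n)) x := by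
  by_cases hxD : x ∈ boundary hn
  swap
  · exact isNormalCrossingAt_of_notMem fun _ => hxD
  obtain ⟨i, j, k, M, hjk, hM, hMx⟩ := exists_represents hn hx
  have hx' : x ∈ Set.range (quotientChart hn i hjk).ι := by
    rw [ProjChart.mem_range_ι]
    intro h
    have h1 := (hMx 1 one_pos (mixBot (by omega) i k j k) (by
      rw [mul_one]; exact mixBot_mem _ i k j k)).1 h
    rw [hM.evalMat_mixBot] at h1
    exact one_ne_zero h1
  obtain ⟨q, rfl⟩ := hx'
  -- The point `q` of the chart has the entries of `M` as coordinates. The extra factor below makes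
  -- the degree positive and has value `1` on normalized matrices.
  have hq : ∀ l, l ∈ q.asIdeal ↔ chartSpec i j k M l = 0 := by
    intro l
    obtain ⟨m, a, ha, rfl⟩ := exists_evalMat_chartMat_eq hn i hjk l
    have ha' : a * mixBot (by omega) i k j k ∈ invGrading 2 2 n (n * (m + 1)) := by
      rw [mul_add, mul_one]
      exact SetLike.mul_mem_graded ha (mixBot_mem _ i k j k)
    have h1 := hMx (m + 1) m.succ_pos _ ha'
    rw [(quotientChart hn i hjk).ι_mem (by positivity) ha', quotientChart_hom] at h1
    have h2 : ∀ {K : Type} [CommRing K] [Algebra ℂ K] (N : Matrix (Fin 2) (Col 2 n) K),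
        IsNormalized i j k N → evalMat N ((a * mixBot (by omega) i k j k : invariantRing 2 2 n) :
          MatPoly 2 2 n) = evalMat N (a : MatPoly 2 2 n) := fun N hN => by
      rw [MulMemClass.coe_mul, map_mul, hN.evalMat_mixBot, mul_one]
    rw [h2 _ (isNormalized_chartMat i hjk), h2 _ hM] at h1
    rw [← hM.evalMat_eq hjk]
    exact h1
  have hM0 := (hMx.mem_boundary_iff hn hM).1 hxD
  let inl := TrivSqZeroExt.inlAlgHom ℂ ℂ ℂ
  let fst := TrivSqZeroExt.fstHom ℂ ℂ ℂ
  have hN : IsNormalized i j k (addEntry i DualNumber.eps (M.map inl)) := (hM.map inl).addEntry _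
  -- The tangent vector at `M` in the direction of the entry in which `p₁₂` is linear; it takes
  -- `p₁₂` to `± ε`.
  let φ := chartSpec i j k (addEntry i DualNumber.eps (M.map inl))
  have hφ : ∀ l, (φ l).fst = chartSpec i j k M l := by
    refine DFunLike.congr_fun (algHom_ext fun p => ?_ : fst.comp φ = chartSpec i j k M)
    rw [AlgHom.comp_apply]
    refine (congrArg fst (aeval_X _ _)).trans (Eq.trans ?_ (aeval_X _ _).symm)
    obtain ⟨⟨r, c⟩, hp⟩ := p
    change (addEntry i DualNumber.eps (M.map inl) r c).fst = M r c
    rw [addEntry, Matrix.updateRow_apply]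
    split_ifs with hr
    · subst hr
      rw [Function.update_apply]
      split_ifs with hc
      · subst hc
        simp [inl]
      · rfl
    · rfl
  refine isNormalCrossingAt_of_chart (quotientChart hn i hjk).ι (isPrime_span_boundaryEq i hjk)
    (ι_mem_boundary_iff hn i hjk) φ.toRingHom (fun l hl => ?_) (fun z => ⟨C z, ?_⟩) ?_
  · exact fun h => hl ((hq l).2 ((hφ l).symm.trans h))
  · exact (hφ _).trans (aeval_C _ _)
  · change φ (boundaryEq i j k) ≠ 0
    rw [boundaryEq, ← hN.evalMat_eq hjk, (hM.map inl).evalMat_topP_addEntry, evalMat_map, hM0, map_zero,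
      zero_add]
    intro h
    have h1 := congrArg TrivSqZeroExt.snd h
    split_ifs at h1 <;> simp at h1

end PluckerGIT

end

theorem mainTheorem12 :
    -- `n = 3`
    ((PluckerGIT.invariantRing 2 2 3 = Algebra.adjoin ℂ
        {PluckerGIT.coord 0 1 * PluckerGIT.coord 0 2 ^ 2,
          PluckerGIT.coord 0 1 * PluckerGIT.coord 0 2 * PluckerGIT.coord 1 2,
          PluckerGIT.coord 0 1 * PluckerGIT.coord 1 2 ^ 2}) ∧
      RingHom.ker (MvPolynomial.aeval
        ![PluckerGIT.coord 0 1 * PluckerGIT.coord 0 2 ^ 2,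
          PluckerGIT.coord 0 1 * PluckerGIT.coord 0 2 * PluckerGIT.coord 1 2,
          PluckerGIT.coord 0 1 * PluckerGIT.coord 1 2 ^ 2] :
          MvPolynomial (Fin 3) ℂ →ₐ[ℂ] PluckerGIT.MatPoly 2 2 3) =
        Ideal.span {(MvPolynomial.X 1 ^ 2 - MvPolynomial.X 0 * MvPolynomial.X 2 :
          MvPolynomial (Fin 3) ℂ)} ∧
      PluckerGIT.Descends 2 2 3 3 ∧
      ∃ e : PluckerGIT.GITQuotient 2 2 3 ≅ PluckerGIT.PSpace 1,
        e.hom ≫ PluckerGIT.projToSpec (PluckerGIT.PGrading 1) = PluckerGIT.quotientToSpec 2 2 3 ∧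
        Nonempty (PluckerGIT.descent 2 2 3 3 ≅
          (AlgebraicGeometry.Scheme.Modules.pullback e.hom).obj (PluckerGIT.lineBundle 1 2))) ∧
    -- `n = 4`
    ((PluckerGIT.invariantRing 2 2 4 = Algebra.adjoin ℂ
        {PluckerGIT.coord 0 2, PluckerGIT.coord 0 3, PluckerGIT.coord 1 2, PluckerGIT.coord 1 3}) ∧
      AlgebraicIndependent ℂ
        ![(PluckerGIT.coord 0 2 : PluckerGIT.MatPoly 2 2 4), PluckerGIT.coord 0 3,
          PluckerGIT.coord 1 2, PluckerGIT.coord 1 3] ∧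
      (PluckerGIT.coord 0 1 * PluckerGIT.coord 2 3 : PluckerGIT.MatPoly 2 2 4) =
        PluckerGIT.coord 0 2 * PluckerGIT.coord 1 3 -
          PluckerGIT.coord 0 3 * PluckerGIT.coord 1 2 ∧
      PluckerGIT.Descends 2 2 4 1 ∧ PluckerGIT.Descends 2 2 4 2 ∧
      ∃ e : PluckerGIT.GITQuotient 2 2 4 ≅ PluckerGIT.PSpace 3,
        e.hom ≫ PluckerGIT.projToSpec (PluckerGIT.PGrading 3) = PluckerGIT.quotientToSpec 2 2 4 ∧
        Nonempty (PluckerGIT.descent 2 2 4 1 ≅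
          (AlgebraicGeometry.Scheme.Modules.pullback e.hom).obj (PluckerGIT.lineBundle 3 1)) ∧
        Nonempty (PluckerGIT.descent 2 2 4 2 ≅
          (AlgebraicGeometry.Scheme.Modules.pullback e.hom).obj (PluckerGIT.lineBundle 3 2))) ∧
    -- `n ≥ 5`
    (∀ n : ℕ, 5 ≤ n →
      (∃ D : Fin 1 → TopologicalSpace.Closeds (PluckerGIT.GITQuotient 2 2 n),
        PluckerGIT.IsWonderful (PluckerGIT.leviCoord 2 n) (PluckerGIT.quotientToSpec 2 2 n)
          (PluckerGIT.leviAct 2 2 n) D) ∧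
      (PluckerGIT.orbits (PluckerGIT.leviAct 2 2 n)).ncard = 2) := by
  exact ⟨⟨PluckerGIT.invariantRing_three, PluckerGIT.ker_three, PluckerGIT.descends_three,
    PluckerGIT.exists_iso_three⟩, ⟨PluckerGIT.invariantRing_four,
    PluckerGIT.algebraicIndependent_four, PluckerGIT.coord_relation_four,
    PluckerGIT.descends_four 1, PluckerGIT.descends_four 2, PluckerGIT.exists_iso_four⟩,
    fun n hn => ⟨⟨fun _ => PluckerGIT.boundary hn,
    PluckerGIT.isWonderful_quotient hn fun _ => PluckerGIT.isNormalCrossingAt_boundary hn⟩,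
    PluckerGIT.ncard_orbits hn⟩⟩
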